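/- Fix $\alpha'>0$ and $p\in\mathbb R^{26}$, and let $\mathcal F(p)$ be the complex Fock space of the open bosonic string in $D=26$ at momentum $p$: it is generated from $|0,p;\downarrow\rangle$ by $\alpha^\mu_{-n}$, $c_{-n}$, $b_{-n}$ ($n>0$) and $c_0$, where $[\alpha^\mu_m,\alpha^\nu_n]=m\eta^{\mu\nu}\delta_{m+n,0}$, $\{b_m,c_n\}=\delta_{m+n,0}$, $\alpha_0^\mu=\sqrt{2\alpha'}\,p^\mu$, and $\alpha^\mu_n,b_n,c_n$ ($n>0$) and $b_0$ annihilate $|0,p;\downarrow\rangle$. Let $\mathcal F^n$ be the span of the monomial states without $c_0$ having (number of $c$'s) $-$ (number of $b$'s) $=n$. The BRST operator is $Q=\tilde Q+c_0L_0+b_0M$ with $$M=-2\sum_{n>0}n\,c_{-n}c_n,\qquad \tilde Q=\sum_{n\neq0}c_{-n}L^{(\mathrm m)}_n-\tfrac12\sum_{mn\ne0,\;m+n\ne0}(m-n):\!c_{-m}c_{-n}b_{m+n}\!:,$$ where $L^{(\mathrm m)}_n=\tfrac12\sum_k\eta_{\mu\nu}:\!\alpha^\mu_{n-k}\alpha^\nu_k\!:$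 and $L_0=L_0^{(\mathrm m)}+\sum_{n>0}n(c_{-n}b_n+b_{-n}c_n)-1$ (so $L_0=\alpha'p^2+N-1$ at level $N$). A string field of ghost number $n$ is $\Phi_n=\phi^{(n-1)}+c_0\omega^{(n-2)}$ with $\phi^{(n-1)}\in\mathcal F^{n-1}$, $\omega^{(n-2)}\in\mathcal F^{n-2}$; free gauge transformations are $\Phi_n\mapsto\Phi_n+Q\Lambda_{n-1}$ with $\Lambda_{n-1}$ of ghost number $n-1$. "States with $L_0\ne0$" are the sums of $L_0$-eigenstates with nonzero eigenvalue. A condition on $\Phi_n$ *fixes the gauge exactly* if, for fields and parameters with $L_0\neq 0$, (i) every $\Phi_n$ can be brought to satisfy it by a gauge transformation, and (ii) whenever $\Phi_n$ and $\Phi_n+Q\Lambda_{n-1}$ both satisfy it, $Q\Lambda_{n-1}=0$. Then: 1. For every $n\ge0$, $M^n$ maps $\mathcal F^{-n}$ bijectively onto $\mathcal F^n$. Let $W_n:\mathcal F^n\to\mathcal F^{-n}$ be the inverse, extended by $W_n(c_0 f)=c_0W_nf$ and by zero on the other $\tilde N^g$-homogeneous components. 2. For $a\in\mathbb R$, consider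 the condition $$b_0(M+a\,c_0\tilde Q)\Phi_1=0\iff M\omega^{(-1)}+a\tilde Q\phi^{(0)}=0,$$ and, for ghost number $n$, the extended condition, denoted $\mathrm{bpz}(\mathcal O_a)\Phi_n=0$: $$b_0(M^{2-n}+a\,c_0\tilde QM^{1-n})\Phi_n=0\iff M^{2-n}\omega^{(n-2)}+a\tilde QM^{1-n}\phi^{(n-1)}=0\qquad(n\le1),$$ $$b_0(W_{n-2}+a\,c_0\tilde QW_{n-1})\Phi_n=0\iff W_{n-2}\omega^{(n-2)}+a\tilde QW_{n-1}\phi^{(n-1)}=0\qquad(n\ge2).$$ The stated equivalences hold. 3. If $a\ne1$, the condition on $\Phi_1$ fixes the gauge exactly, and so does the extended condition on $\Phi_n$ for every $n\in\mathbb Z$. 4. For $a=0$ the conditions are equivalent to the Siegel gauge $b_0\Phi_1=0$, respectively $b_0\Phi_n=0$ for every $n\in\mathbb Z$. 5. For $a=1$ the expression $b_0(M+c_0\tilde Q)\Phi_1$ is gauge invariant, and the condition $b_0(M+c_0\tilde Q)\Phi_1=0$ fails as a gauge condition: for states with $L_0\ne0$ it cannot be reached from every $\Phi_1$, and it leaves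 a nontrivial residual gauge symmetry. -/

import Mathlib

open scoped TensorProduct

noncomputable section

namespace StringFieldTheory

/-! ### Locally finite sums of operators -/

/-- The operator `∑ i, A i` for a family that is locally finite: on every vector only finitely many
terms are nonzero. (For other families it is `0` by convention; all families used below are locally
finite on the Fock space.) -/
def opSum {ι V : Type*} [AddCommGroup V] [Module ℂ V] (A : ι → Module.End ℂ V) :
    Module.End ℂ V :=
  open Classical in
  if h : ∀ v, (Function.support fun i => A i v).Finite then
    { toFun := fun v => ∑ᶠ i, A i v
      map_add' := fun v w => by
        simp only [map_add]
        exact finsum_add_distrib (h v) (h w)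
      map_smul' := fun c v => by
        simp only [map_smul, RingHom.id_apply]
        exact (smul_finsum' c (h v)).symm }
  else 0

/-! ### The Fock space at fixed momentum

The matter factor is the polynomial algebra in the creation operators `α_{-(k+1)}^μ`
(`k : ℕ`, `μ : Fin 26`); the ghost factor is the exterior algebra on the creation operators
`c_{-k}` (`k ≥ 0`) and `b_{-(k+1)}` (`k ≥ 0`). The vector `1 ⊗ 1` is `|0, p; ↓⟩`. The momentum `p`
enters only through the zero mode `α_0^μ`. -/

/-- Labels of the ghost creation operators: `c k` stands for `c_{-k}` and `b k` for `b_{-(k+1)}`. -/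
inductive GhostMode : Type
  | c (k : ℕ) : GhostMode
  | b (k : ℕ) : GhostMode

abbrev MatterFock : Type := MvPolynomial (ℕ × Fin 26) ℂ

abbrev GhostFock : Type := ExteriorAlgebra ℂ (GhostMode →₀ ℂ)

abbrev Fock : Type := MatterFock ⊗[ℂ] GhostFock

/-- A 26-momentum `p^μ`. -/
abbrev Momentum : Type := Fin 26 → ℝ

/-- The Fock vacuum `|0, p; ↓⟩`. -/
def vacuum : Fock := (1 : MatterFock) ⊗ₜ[ℂ] (1 : GhostFock)

/-- The diagonal entries of the Minkowski metric, signature `(-, +, …, +)`. -/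
def eta (μ : Fin 26) : ℂ := if μ = 0 then -1 else 1

/-- The creation operator `α_{-(k+1)}^μ`. -/
def matterCreate (x : ℕ × Fin 26) : Module.End ℂ Fock :=
  LinearMap.rTensor GhostFock (LinearMap.mulLeft ℂ (MvPolynomial.X x : MatterFock))

/-- The annihilation operator `α_{k+1}^μ = (k+1) η^{μμ} ∂ / ∂ α_{-(k+1)}^μ`. -/
def matterAnnihilate (x : ℕ × Fin 26) : Module.End ℂ Fock :=
  LinearMap.rTensor GhostFock
    ((((x.1 : ℂ) + 1) * eta x.2) •
      (MvPolynomial.pderiv (R := ℂ) x : Derivation ℂ MatterFock MatterFock).toLinearMap)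

/-- Left exterior multiplication by a ghost creation operator. -/
def ghostCreate (g : GhostMode) : Module.End ℂ Fock :=
  LinearMap.lTensor MatterFock
    (LinearMap.mulLeft ℂ (ExteriorAlgebra.ι ℂ (Finsupp.single g (1 : ℂ))))

/-- The anti-derivation that contracts with the ghost creation operator `g`. -/
def ghostAnnihilate (g : GhostMode) : Module.End ℂ Fock :=
  LinearMap.lTensor MatterFock
    (CliffordAlgebra.contractLeft (Q := (0 : QuadraticForm ℂ (GhostMode →₀ ℂ)))
      (Finsupp.lapply g : (GhostMode →₀ ℂ) →ₗ[ℂ] ℂ))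

/-! ### Oscillator modes

They satisfy `[α_m^μ, α_n^ν] = m η^{μν} δ_{m+n,0}`, `{b_m, c_n} = δ_{m+n,0}`, all other
(anti-)commutators being zero, and `α_n`, `b_n`, `c_n` with `n > 0`, as well as `b_0`, annihilate
the vacuum. -/

/-- The matter mode `α_n^μ`, with `α_0^μ = √(2 α′) p^μ`, where `slope = α′`. -/
def alpha (slope : ℝ) (p : Momentum) (μ : Fin 26) : ℤ → Module.End ℂ Fock
  | Int.ofNat 0 => ((Real.sqrt (2 * slope) * p μ : ℝ) : ℂ) • (1 : Module.End ℂ Fock)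
  | Int.ofNat (k + 1) => matterAnnihilate (k, μ)
  | Int.negSucc k => matterCreate (k, μ)

/-- The ghost mode `c_n`. -/
def c : ℤ → Module.End ℂ Fock
  | Int.ofNat 0 => ghostCreate (GhostMode.c 0)
  | Int.ofNat (k + 1) => ghostAnnihilate (GhostMode.b k)
  | Int.negSucc k => ghostCreate (GhostMode.c (k + 1))

/-- The anti-ghost mode `b_n`. -/
def b : ℤ → Module.End ℂ Fock
  | Int.ofNat k => ghostAnnihilate (GhostMode.c k)
  | Int.negSucc k => ghostCreate (GhostMode.b k)

/-! ### Virasoro operators and the BRST operator -/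

/-- The normal ordered product `:α_i^μ α_j^μ:` (the larger mode number stands on the right). -/
def alphaAlpha (slope : ℝ) (p : Momentum) (μ : Fin 26) (i j : ℤ) : Module.End ℂ Fock :=
  if i ≤ j then alpha slope p μ i * alpha slope p μ j
  else alpha slope p μ j * alpha slope p μ i

/-- The matter Virasoro operator `L_n^(m) = 1/2 ∑_k η_{μν} :α_{n-k}^μ α_k^ν:`. -/
def matterL (slope : ℝ) (p : Momentum) (n : ℤ) : Module.End ℂ Fock :=
  opSum fun k : ℤ => (1 / 2 : ℂ) • ∑ μ : Fin 26, eta μ • alphaAlpha slope p μ (n - k) k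

/-- The ghost part `L_0^(g) = ∑_{n>0} n (c_{-n} b_n + b_{-n} c_n) - 1`. -/
def ghostL0 : Module.End ℂ Fock :=
  (opSum fun k : ℕ => ((k : ℂ) + 1) • (c (-(k + 1)) * b (k + 1) + b (-(k + 1)) * c (k + 1))) - 1

/-- `L_0 = L_0^(m) + L_0^(g)`, equal to `α′ p² + N - 1` on states of level `N`. -/
def L0 (slope : ℝ) (p : Momentum) : Module.End ℂ Fock := matterL slope p 0 + ghostL0

/-- `M = -2 ∑_{n>0} n c_{-n} c_n`. -/
def M : Module.End ℂ Fock :=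
  opSum fun k : ℕ => (-2 * ((k : ℂ) + 1)) • (c (-(k + 1)) * c (k + 1))

/-- The normal ordered product `:c_i c_j b_k:` for `k ≠ 0`. Since all `c` modes anticommute with
one another, only the position of `b_k` matters: it stands on the right if it is an annihilation
operator and on the left if it is a creation operator (two transpositions, hence no sign). -/
def ccb (i j k : ℤ) : Module.End ℂ Fock :=
  if 0 < k then c i * c j * b k else b k * c i * c j

/-- `Q̃ = ∑_{n≠0} c_{-n} L_n^(m) - 1/2 ∑_{mn≠0, m+n≠0} (m-n) :c_{-m} c_{-n} b_{m+n}:`. -/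
def Qtilde (slope : ℝ) (p : Momentum) : Module.End ℂ Fock :=
  (opSum fun n : ℤ => if n ≠ 0 then c (-n) * matterL slope p n else 0) -
  (1 / 2 : ℂ) • opSum fun q : ℤ × ℤ =>
    if q.1 * q.2 ≠ 0 ∧ q.1 + q.2 ≠ 0 then
      ((q.1 : ℂ) - q.2) • ccb (-q.1) (-q.2) (q.1 + q.2)
    else 0

/-- The BRST operator `Q = Q̃ + c_0 L_0 + b_0 M`. -/
def Q (slope : ℝ) (p : Momentum) : Module.End ℂ Fock :=
  Qtilde slope p + c 0 * L0 slope p + b 0 * M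

/-! ### Gradings -/

/-- The state `α_{-n_1}^{μ_1} ⋯ α_{-n_i}^{μ_i} c_{-l_1} ⋯ c_{-l_j} b_{-m_1} ⋯ b_{-m_k} |0, p; ↓⟩`
without `c_0`; an entry `r` of one of the lists stands for the frequency `r + 1`. -/
def oscillatorState (A : List (ℕ × Fin 26)) (C B : List ℕ) : Fock :=
  ((A.map matterCreate).prod * (C.map fun r => c (-((r : ℤ) + 1))).prod *
    (B.map fun r => b (-((r : ℤ) + 1))).prod) vacuum

/-- The space `F^n` spanned by the states without `c_0` that have `#c - #b = n`. -/
def F (n : ℤ) : Submodule ℂ Fock :=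
  Submodule.span ℂ
    {f | ∃ (A : List (ℕ × Fin 26)) (C B : List ℕ),
      (C.length : ℤ) - B.length = n ∧ f = oscillatorState A C B}

/-- The states `φ^(n-1) + c_0 ω^(n-2)` of total ghost number `n`. -/
def ghostSector (n : ℤ) : Submodule ℂ Fock := F (n - 1) ⊔ (F (n - 2)).map (c 0)

/-- The space of states with `L_0 ≠ 0`: sums of `L_0`-eigenstates with nonzero eigenvalue. -/
def nonzeroL0 (slope : ℝ) (p : Momentum) : Submodule ℂ Fock :=
  ⨆ (h : ℂ) (_ : h ≠ 0), Module.End.eigenspace (L0 slope p) h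

/-- String fields of ghost number `n` with `L_0 ≠ 0`. -/
def sector (slope : ℝ) (p : Momentum) (n : ℤ) : Submodule ℂ Fock :=
  ghostSector n ⊓ nonzeroL0 slope p

/-! ### The inverse `W_n` of `M^n : F^{-n} → F^n` -/

open Classical in
/-- The inverse of `M^n : F^{-n} → F^n`, extended by `0` outside `F^n`. -/
def invM (n : ℕ) (f : Fock) : Fock :=
  if h : ∃ g ∈ F (-(n : ℤ)), (M ^ n) g = f then h.choose else 0

/-- The operator `W_n` on the full Fock space: on `φ + c_0 ω`, with `φ` and `ω` free of `c_0`, it is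
`W_n φ + c_0 W_n ω`. Here `b_0 c_0` and `b_0` extract `φ` and `ω`. -/
def W (n : ℕ) (Φ : Fock) : Fock :=
  invM n (b 0 (c 0 Φ)) + c 0 (invM n (b 0 Φ))

/-! ### Gauge conditions -/

/-- The left-hand side of the one-parameter gauge condition `b_0 (M + a c_0 Q̃) Φ_1 = 0`. -/
def gaugeFunction (slope : ℝ) (p : Momentum) (a : ℝ) (Φ : Fock) : Fock :=
  b 0 (M Φ + (a : ℂ) • c 0 (Qtilde slope p Φ))

/-- The left-hand side of the extended condition `bpz(O_a) Φ_n = 0` on ghost number `n` (up to an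
overall sign): `b_0 (M^{2-n} + a c_0 Q̃ M^{1-n}) Φ_n` for `n ≤ 1`, and
`b_0 (W_{n-2} + a c_0 Q̃ W_{n-1}) Φ_n` for `n ≥ 2`. -/
def extendedGaugeFunction (slope : ℝ) (p : Momentum) (a : ℝ) (n : ℤ) (Φ : Fock) : Fock :=
  if n ≤ 1 then
    b 0 ((M ^ (2 - n).toNat) Φ + (a : ℂ) • c 0 (Qtilde slope p ((M ^ (1 - n).toNat) Φ)))
  else
    b 0 (W (n - 2).toNat Φ + (a : ℂ) • c 0 (Qtilde slope p (W (n - 1).toNat Φ)))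

/-- Every string field of ghost number `n` can be brought to satisfy `C` by a gauge transformation
`Φ ↦ Φ + Q Λ`. -/
def CanBeReached (slope : ℝ) (p : Momentum) (n : ℤ) (C : Fock → Prop) : Prop :=
  ∀ Φ ∈ sector slope p n, ∃ Λ ∈ sector slope p (n - 1), C (Φ + Q slope p Λ)

/-- A gauge transformation between two string fields of ghost number `n` that both satisfy `C` is
trivial. -/
def NoResidualSymmetry (slope : ℝ) (p : Momentum) (n : ℤ) (C : Fock → Prop) : Prop :=
  ∀ Φ ∈ sector slope p n, ∀ Λ ∈ sector slope p (n - 1),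
    C Φ → C (Φ + Q slope p Λ) → Q slope p Λ = 0

end StringFieldTheory

end

/-!
Everything rests on three facts about the operators of the open string Fock space.

*The action of `sl₂`.* The operator `M`, the operator `lower = -½ ∑_{n>0} n⁻¹ b_{-n} b_n` and the
ghost number form an `sl₂` triple (`M_lower`), and `M` and `lower` are locally nilpotent. Hence
`M ^ n` is a bijection from ghost number `-n` onto ghost number `n` (`M_pow_injective`,
`M_pow_surjective`).

*Nilpotency of the BRST operator in 26 dimensions.* In terms of `Q̃` it reads `Q̃² = -L_0 M`
(`Qt_Qt`) and `[Q̃, M] = 0` (`Qt_M`). Infinite normal ordered sums are never multiplied. Instead,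
every identity is reduced to its commutators with the modes. An operator of nonzero ghost number or
level that commutes, up to a sign, with all modes maps the vacuum to a vector annihilated by all
annihilation operators; such a vector has ghost number and level zero, so that the operator vanishes
(`eq_zero_of_graded`; the mode `b_0` is not needed). Commuting repeatedly with modes brings
`Q̃² + L_0 M` down to the commutators of the total Virasoro operators `{Q̃, b_n}`. The only case in
which no grading helps is that of `{Q̃, b_n}` and `{Q̃, b_{-n}}`; it is settled by evaluating on the
vacuum, where the central charges `26` and `-26` cancel (`db_db_vac`).

*The range of `L_0`.* Since `L_0` is diagonalisable, the states with `L_0 ≠ 0` form the range of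
`L_0`, on which `L_0` is bijective. This makes them stable under all operators that commute with
`L_0` and under the inverses of the powers of `M`.

Given these facts the gauge conditions are linear algebra. On `Φ = φ + c_0 ω` a gauge parameter
`ρ + c_0 κ` acts by `φ ↦ φ + Q̃ ρ + M κ`, `ω ↦ ω + L_0 ρ - Q̃ κ` (`Q_apply`). For ghost number
`n ≤ 1` a parameter with `κ = 0` changes the gauge function by `(1 - a) M^{2-n} L_0 ρ`; for `n ≥ 2`
and `a ≠ 1` a suitable `κ` makes the change equal to `W_{n-2} L_0 ρ`. For `a ≠ 1` either change can
be prescribed arbitrarily, and a pure gauge field that satisfies the condition vanishes because it is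
BRST closed. At `n = a = 1` the gauge function does not change at all, so that a state on which it is
nonzero can never be brought to satisfy the condition, while every gauge transformation preserves
it.

The operator identities are proved for an arbitrary Fock module of the oscillator algebra
(`Oscillators`), of which the string Fock space is an instance. Identities between products of
operators are obtained by multiplying known commutators from both sides, adding them up with
`linear_combination`, and comparing both sides as linear combinations of words with `module`.
-/

namespace StringFieldTheory

/-! ### Locally finite families of operators -/

section LocallyFinite

variable {ι V : Type*} [AddCommGroup V] [Module ℂ V]

/-- A family of operators is locally finite if every vector is annihilated by all but finitely many
of its members; `opSum` is the honest sum of such a family. -/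
def LocFin (A : ι → Module.End ℂ V) : Prop :=
  ∀ v, (Function.support fun i => A i v).Finite

theorem opSum_apply {A : ι → Module.End ℂ V} (h : LocFin A) (v : V) :
    opSum A v = ∑ᶠ i, A i v := by
  have h' : ∀ v, (Function.support fun i => A i v).Finite := h
  rw [opSum, dif_pos h']
  rfl

theorem LocFin.mul_right {A : ι → Module.End ℂ V} (h : LocFin A) (B : Module.End ℂ V) :
    LocFin fun i => A i * B := fun v => h (B v)

theorem LocFin.mul_left {A : ι → Module.End ℂ V} (h : LocFin A) (B : Module.End ℂ V) :
    LocFin fun i => B * A i := fun v => (h v).subset fun i hi => by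
  contrapose! hi
  simp only [Function.mem_support, not_not, Module.End.mul_apply] at hi ⊢
  rw [hi, map_zero]

theorem LocFin.smul {A : ι → Module.End ℂ V} (h : LocFin A) (z : ℂ) :
    LocFin fun i => z • A i := fun v => (h v).subset fun i hi => by
  contrapose! hi
  simp only [Function.mem_support, not_not, LinearMap.smul_apply] at hi ⊢
  rw [hi, smul_zero]

theorem LocFin.add {A B : ι → Module.End ℂ V} (hA : LocFin A) (hB : LocFin B) :
    LocFin fun i => A i + B i := fun v => ((hA v).union (hB v)).subset fun i hi => by
  contrapose! hi
  simp only [Set.mem_union, Function.mem_support, not_or, not_not, LinearMap.add_apply] at hi ⊢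
  rw [hi.1, hi.2, add_zero]

theorem LocFin.sub {A B : ι → Module.End ℂ V} (hA : LocFin A) (hB : LocFin B) :
    LocFin fun i => A i - B i := by
  simpa [sub_eq_add_neg] using hA.add (hB.smul (-1))

theorem locFin_single [DecidableEq ι] (p : ι) (A : ι → Module.End ℂ V) :
    LocFin fun i => if i = p then A i else 0 := fun v =>
  (Set.finite_singleton p).subset fun i hi => by
    contrapose! hi
    simp only [Set.mem_singleton_iff] at hi
    simp [hi]

theorem opSum_mul {A : ι → Module.End ℂ V} (h : LocFin A) (B : Module.End ℂ V) :
    opSum A * B = opSum fun i => A i * B := by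
  ext v
  rw [Module.End.mul_apply, opSum_apply h, opSum_apply (h.mul_right B)]
  rfl

theorem mul_opSum {A : ι → Module.End ℂ V} (h : LocFin A) (B : Module.End ℂ V) :
    B * opSum A = opSum fun i => B * A i := by
  ext v
  rw [Module.End.mul_apply, opSum_apply h, opSum_apply (h.mul_left B)]
  exact B.toAddMonoidHom.map_finsum (h v)

theorem opSum_add {A B : ι → Module.End ℂ V} (hA : LocFin A) (hB : LocFin B) :
    opSum (fun i => A i + B i) = opSum A + opSum B := by
  ext v
  rw [LinearMap.add_apply, opSum_apply hA, opSum_apply hB, opSum_apply (hA.add hB)]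
  exact finsum_add_distrib (hA v) (hB v)

theorem opSum_sub {A B : ι → Module.End ℂ V} (hA : LocFin A) (hB : LocFin B) :
    opSum (fun i => A i - B i) = opSum A - opSum B := by
  ext v
  rw [LinearMap.sub_apply, opSum_apply hA, opSum_apply hB, opSum_apply (hA.sub hB)]
  exact finsum_sub_distrib (hA v) (hB v)

theorem opSum_smul {A : ι → Module.End ℂ V} (hA : LocFin A) (z : ℂ) :
    opSum (fun i => z • A i) = z • opSum A := by
  ext v
  rw [LinearMap.smul_apply, opSum_apply hA, opSum_apply (hA.smul z)]
  exact (smul_finsum' z (hA v)).symm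

theorem opSum_zero : opSum (fun _ : ι => (0 : Module.End ℂ V)) = 0 := by
  ext v
  rw [opSum_apply (fun v => by simp)]
  simp

theorem opSum_single [DecidableEq ι] (p : ι) (A : ι → Module.End ℂ V) :
    opSum (fun i => if i = p then A i else 0) = A p := by
  ext v
  rw [opSum_apply (locFin_single p A), finsum_eq_single _ p]
  · simp
  · intro i hi
    simp [hi]

theorem opSum_apply_eq_zero {A : ι → Module.End ℂ V} (h : LocFin A) {v : V}
    (hv : ∀ i, A i v = 0) : opSum A v = 0 := by
  rw [opSum_apply h]
  simp [hv]

theorem opSum_comm {A : ι → Module.End ℂ V} (h : LocFin A) (B : Module.End ℂ V) :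
    opSum A * B - B * opSum A = opSum fun i => A i * B - B * A i := by
  rw [opSum_mul h, mul_opSum h, opSum_sub (h.mul_right B) (h.mul_left B)]

theorem opSum_acomm {A : ι → Module.End ℂ V} (h : LocFin A) (B : Module.End ℂ V) :
    opSum A * B + B * opSum A = opSum fun i => A i * B + B * A i := by
  rw [opSum_mul h, mul_opSum h, opSum_add (h.mul_right B) (h.mul_left B)]

theorem LocFin.comm {A : ι → Module.End ℂ V} (h : LocFin A) (B : Module.End ℂ V) :
    LocFin fun i => A i * B - B * A i := (h.mul_right B).sub (h.mul_left B)

theorem LocFin.acomm {A : ι → Module.End ℂ V} (h : LocFin A) (B : Module.End ℂ V) :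
    LocFin fun i => A i * B + B * A i := (h.mul_right B).add (h.mul_left B)

end LocallyFinite

/-! ### Canonical commutation relations -/

theorem eta_mul_eta (μ : Fin 26) : eta μ * eta μ = 1 := by
  unfold eta; split_ifs <;> norm_num

section Generators

theorem matterCreate_comm (x y : ℕ × Fin 26) :
    matterCreate x * matterCreate y = matterCreate y * matterCreate x := by
  refine TensorProduct.ext' fun P g => ?_
  simp only [matterCreate, Module.End.mul_apply, LinearMap.rTensor_tmul, LinearMap.mulLeft_apply,
    mul_left_comm]

theorem matterAnnihilate_comm (x y : ℕ × Fin 26) :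
    matterAnnihilate x * matterAnnihilate y = matterAnnihilate y * matterAnnihilate x := by
  refine TensorProduct.ext' fun P g => ?_
  -- the Lie bracket of two partial derivatives is a derivation that vanishes on the variables
  have h : MvPolynomial.pderiv x (MvPolynomial.pderiv y P) =
      MvPolynomial.pderiv y (MvPolynomial.pderiv x P) := by
    have hD : ⁅(MvPolynomial.pderiv x : Derivation ℂ MatterFock MatterFock),
        (MvPolynomial.pderiv y : Derivation ℂ MatterFock MatterFock)⁆ = 0 :=
      MvPolynomial.derivation_ext fun i => by
        simp only [Derivation.commutator_apply, MvPolynomial.pderiv_X, Derivation.zero_apply]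
        simp only [Pi.single_apply]
        split_ifs <;> simp
    have := DFunLike.congr_fun hD P
    rwa [Derivation.commutator_apply, Derivation.zero_apply, sub_eq_zero] at this
  simp only [matterAnnihilate, Module.End.mul_apply, LinearMap.rTensor_tmul, LinearMap.smul_apply,
    Derivation.coeFn_coe, map_smul]
  rw [smul_comm, h]

theorem matterAnnihilate_create (x y : ℕ × Fin 26) :
    matterAnnihilate x * matterCreate y = matterCreate y * matterAnnihilate x +
      (if x = y then ((x.1 : ℂ) + 1) * eta x.2 else 0) • (1 : Module.End ℂ Fock) := by
  refine TensorProduct.ext' fun P g => ?_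
  simp only [matterAnnihilate, matterCreate, LinearMap.add_apply, Module.End.mul_apply,
    LinearMap.rTensor_tmul, LinearMap.smul_apply,
    Derivation.coeFn_coe, LinearMap.mulLeft_apply, Derivation.leibniz, MvPolynomial.pderiv_X,
    Module.End.one_apply]
  rw [TensorProduct.smul_tmul', ← TensorProduct.add_tmul]
  congr 1
  by_cases h : x = y
  · subst h
    simp [smul_add]
  · simp [h, Ne.symm h]

theorem ghostCreate_acomm (g h : GhostMode) :
    ghostCreate g * ghostCreate h + ghostCreate h * ghostCreate g = 0 := by
  refine TensorProduct.ext' fun P x => ?_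
  simp only [ghostCreate, LinearMap.add_apply, Module.End.mul_apply, LinearMap.lTensor_tmul,
    LinearMap.mulLeft_apply]
  rw [← TensorProduct.tmul_add, ← mul_assoc, ← mul_assoc, ← add_mul,
    ExteriorAlgebra.ι_add_mul_swap, zero_mul, TensorProduct.tmul_zero, LinearMap.zero_apply]

theorem ghostAnnihilate_acomm (g h : GhostMode) :
    ghostAnnihilate g * ghostAnnihilate h + ghostAnnihilate h * ghostAnnihilate g = 0 := by
  simp only [ghostAnnihilate, ← LinearMap.lTensor_mul, ← LinearMap.lTensor_add]
  rw [← LinearMap.lTensor_zero]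
  congr 1
  refine LinearMap.ext fun x => ?_
  simp only [LinearMap.add_apply, Module.End.mul_apply, LinearMap.zero_apply]
  rw [CliffordAlgebra.contractLeft_comm, neg_add_cancel]

theorem ghostAnnihilate_create [DecidableEq GhostMode] (g h : GhostMode) :
    ghostAnnihilate g * ghostCreate h + ghostCreate h * ghostAnnihilate g =
      (if g = h then (1 : ℂ) else 0) • (1 : Module.End ℂ Fock) := by
  refine TensorProduct.ext' fun P x => ?_
  simp only [ghostAnnihilate, ghostCreate, LinearMap.add_apply, Module.End.mul_apply,
    LinearMap.lTensor_tmul, LinearMap.mulLeft_apply, LinearMap.smul_apply, Module.End.one_apply]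
  have := CliffordAlgebra.contractLeft_ι_mul (Q := (0 : QuadraticForm ℂ (GhostMode →₀ ℂ)))
    (Finsupp.lapply g : (GhostMode →₀ ℂ) →ₗ[ℂ] ℂ) (Finsupp.single h 1) x
  rw [ExteriorAlgebra.ι, this, TensorProduct.tmul_sub, sub_add_cancel]
  by_cases e : g = h
  · subst e; simp
  · simp [e]

theorem rTensor_lTensor_comm (f : Module.End ℂ MatterFock) (g : Module.End ℂ GhostFock) :
    (LinearMap.rTensor GhostFock f : Module.End ℂ Fock) * LinearMap.lTensor MatterFock g =
      LinearMap.lTensor MatterFock g * LinearMap.rTensor GhostFock f := by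
  rw [Module.End.mul_eq_comp, Module.End.mul_eq_comp, LinearMap.rTensor_comp_lTensor,
    LinearMap.lTensor_comp_rTensor]

theorem matterAnnihilate_vacuum (x : ℕ × Fin 26) : matterAnnihilate x vacuum = 0 := by
  simp [matterAnnihilate, vacuum]

theorem ghostAnnihilate_vacuum (g : GhostMode) : ghostAnnihilate g vacuum = 0 := by
  simp only [ghostAnnihilate, vacuum, LinearMap.lTensor_tmul]
  rw [CliffordAlgebra.contractLeft_one, TensorProduct.tmul_zero]

end Generators

/-- The oscillators act cyclically on the vacuum: a subspace that contains the vacuum and is stable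
under the creation operators is everything. -/
theorem fock_eq_top {p : Submodule ℂ Fock} (h0 : vacuum ∈ p)
    (hm : ∀ x, ∀ v ∈ p, matterCreate x v ∈ p) (hg : ∀ g, ∀ v ∈ p, ghostCreate g v ∈ p) :
    p = ⊤ := by
  have h1 : ∀ y : GhostFock, (1 : MatterFock) ⊗ₜ[ℂ] y ∈ p := by
    intro y
    induction y using CliffordAlgebra.left_induction with
    | algebraMap r =>
      rw [Algebra.algebraMap_eq_smul_one, TensorProduct.tmul_smul]
      exact p.smul_mem _ h0
    | add x y hx hy => rw [TensorProduct.tmul_add]; exact p.add_mem hx hy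
    | ι_mul x m hx =>
      induction m using Finsupp.induction_linear with
      | zero => simp
      | add f g hf hg => rw [map_add, add_mul, TensorProduct.tmul_add]; exact p.add_mem hf hg
      | single g z =>
        have := p.smul_mem z (hg g _ hx)
        rw [ghostCreate, LinearMap.lTensor_tmul, LinearMap.mulLeft_apply, ExteriorAlgebra.ι,
          ← TensorProduct.tmul_smul, ← smul_mul_assoc, ← map_smul, Finsupp.smul_single,
          smul_eq_mul, mul_one] at this
        exact this
  rw [eq_top_iff]
  rintro v -
  induction v using TensorProduct.induction_on with
  | zero => exact p.zero_mem
  | add x y hx hy => exact p.add_mem hx hy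
  | tmul P y =>
    induction P using MvPolynomial.induction_on with
    | C z =>
      have : (MvPolynomial.C z : MatterFock) = z • 1 := by
        rw [← MvPolynomial.algebraMap_eq, Algebra.algebraMap_eq_smul_one]
      rw [this, ← TensorProduct.smul_tmul']
      exact p.smul_mem _ (h1 y)
    | add P R hP hR => rw [TensorProduct.add_tmul]; exact p.add_mem hP hR
    | mul_X P x hP =>
      have := hm x _ hP
      rwa [matterCreate, LinearMap.rTensor_tmul, LinearMap.mulLeft_apply, mul_comm] at this

section Modes

variable (s : ℝ) (p : Momentum)

theorem alpha_zero (μ : Fin 26) :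
    alpha s p μ 0 = ((Real.sqrt (2 * s) * p μ : ℝ) : ℂ) • (1 : Module.End ℂ Fock) := rfl

theorem alpha_comm (μ ν : Fin 26) (m n : ℤ) :
    alpha s p μ m * alpha s p ν n = alpha s p ν n * alpha s p μ m +
      (if μ = ν ∧ m + n = 0 then (m : ℂ) * eta μ else 0) • (1 : Module.End ℂ Fock) := by
  match m, n with
  | Int.ofNat 0, n =>
    simp only [alpha, mul_smul_comm, smul_mul_assoc, mul_one, one_mul, Int.ofNat_eq_natCast,
      Nat.cast_zero, Int.cast_zero, zero_mul, ite_self, zero_smul, add_zero]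
  | m, Int.ofNat 0 =>
    have : (if μ = ν ∧ m + Int.ofNat 0 = 0 then (m : ℂ) * eta μ else 0) = 0 := by
      split_ifs with h
      · have : m = 0 := by simpa using h.2
        simp [this]
      · rfl
    rw [this, zero_smul, add_zero]
    simp only [alpha, mul_smul_comm, smul_mul_assoc, mul_one, one_mul]
  | Int.ofNat (k + 1), Int.ofNat (l + 1) =>
    have : ¬ ((Int.ofNat (k + 1)) + (Int.ofNat (l + 1)) = 0) := by
      simp only [Int.ofNat_eq_natCast]; omega
    rw [if_neg (fun h => this h.2), zero_smul, add_zero]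
    exact matterAnnihilate_comm _ _
  | Int.negSucc k, Int.negSucc l =>
    have : ¬ ((Int.negSucc k) + (Int.negSucc l) = 0) := by omega
    rw [if_neg (fun h => this h.2), zero_smul, add_zero]
    exact matterCreate_comm _ _
  | Int.ofNat (k + 1), Int.negSucc l =>
    have h := matterAnnihilate_create (k, μ) (l, ν)
    have aux : (Int.ofNat (k + 1) + Int.negSucc l = 0) ↔ k = l := by
      simp only [Int.ofNat_eq_natCast]; omega
    simp only [alpha]
    rw [h]
    simp only [aux, Prod.mk.injEq, and_comm (a := k = l)]
    simp
  | Int.negSucc l, Int.ofNat (k + 1) =>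
    have h := matterAnnihilate_create (k, ν) (l, μ)
    have aux : (Int.negSucc l + Int.ofNat (k + 1) = 0) ↔ k = l := by
      simp only [Int.ofNat_eq_natCast]; omega
    simp only [alpha]
    rw [h, add_assoc, ← add_smul]
    simp only [aux, Prod.mk.injEq]
    by_cases h : k = l ∧ ν = μ
    · obtain ⟨rfl, rfl⟩ := h
      simp [Int.cast_negSucc]
      ring_nf
      simp
    · rw [if_neg h, if_neg (fun h' => h ⟨h'.2, h'.1.symm⟩), zero_add, zero_smul, add_zero]

theorem c_acomm (m n : ℤ) : c m * c n + c n * c m = 0 := by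
  classical
  match m, n with
  | Int.ofNat 0, Int.ofNat 0 => exact ghostCreate_acomm _ _
  | Int.ofNat 0, Int.negSucc l => exact ghostCreate_acomm _ _
  | Int.negSucc l, Int.ofNat 0 => exact ghostCreate_acomm _ _
  | Int.negSucc l, Int.negSucc k => exact ghostCreate_acomm _ _
  | Int.ofNat (k + 1), Int.ofNat (l + 1) => exact ghostAnnihilate_acomm _ _
  | Int.ofNat (k + 1), Int.ofNat 0 =>
    simp only [c]; rw [ghostAnnihilate_create]; simp
  | Int.ofNat (k + 1), Int.negSucc l =>
    simp only [c]; rw [ghostAnnihilate_create]; simp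
  | Int.ofNat 0, Int.ofNat (k + 1) =>
    simp only [c]; rw [add_comm, ghostAnnihilate_create]; simp
  | Int.negSucc l, Int.ofNat (k + 1) =>
    simp only [c]; rw [add_comm, ghostAnnihilate_create]; simp

theorem b_acomm (m n : ℤ) : b m * b n + b n * b m = 0 := by
  classical
  match m, n with
  | Int.ofNat k, Int.ofNat l => exact ghostAnnihilate_acomm _ _
  | Int.negSucc l, Int.negSucc k => exact ghostCreate_acomm _ _
  | Int.ofNat k, Int.negSucc l =>
    simp only [b]; rw [ghostAnnihilate_create]; simp
  | Int.negSucc l, Int.ofNat k =>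
    simp only [b]; rw [add_comm, ghostAnnihilate_create]; simp

theorem b_c_acomm (m n : ℤ) :
    b m * c n + c n * b m = (if m + n = 0 then (1 : ℂ) else 0) • (1 : Module.End ℂ Fock) := by
  classical
  match m, n with
  | Int.ofNat k, Int.ofNat 0 =>
    simp only [b, c]; rw [ghostAnnihilate_create]; simp
  | Int.ofNat k, Int.ofNat (l + 1) =>
    have : ¬ ((Int.ofNat k) + (Int.ofNat (l + 1)) = 0) := by
      simp only [Int.ofNat_eq_natCast]; omega
    rw [if_neg this, zero_smul]
    exact ghostAnnihilate_acomm _ _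
  | Int.ofNat k, Int.negSucc l =>
    have : (Int.ofNat k + Int.negSucc l = 0) ↔ k = l + 1 := by
      simp only [Int.ofNat_eq_natCast]; omega
    simp only [b, c, this]; rw [ghostAnnihilate_create]; simp
  | Int.negSucc k, Int.ofNat 0 =>
    have : ¬ (Int.negSucc k + Int.ofNat 0 = 0) := by simp
    rw [if_neg this, zero_smul]
    exact ghostCreate_acomm _ _
  | Int.negSucc k, Int.ofNat (l + 1) =>
    have : (Int.negSucc k + Int.ofNat (l + 1) = 0) ↔ l = k := by
      simp only [Int.ofNat_eq_natCast]; omega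
    simp only [b, c, this]; rw [add_comm, ghostAnnihilate_create]; simp
  | Int.negSucc k, Int.negSucc l =>
    have : ¬ (Int.negSucc k + Int.negSucc l = 0) := by omega
    rw [if_neg this, zero_smul]
    exact ghostCreate_acomm _ _

theorem alpha_c (μ : Fin 26) (m n : ℤ) : alpha s p μ m * c n = c n * alpha s p μ m := by
  match m, n with
  | Int.ofNat 0, n => rw [show Int.ofNat 0 = 0 from rfl, alpha_zero, smul_mul_assoc,
      mul_smul_comm, one_mul, mul_one]
  | Int.ofNat (k + 1), Int.ofNat 0 => exact rTensor_lTensor_comm _ _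
  | Int.ofNat (k + 1), Int.ofNat (l + 1) => exact rTensor_lTensor_comm _ _
  | Int.ofNat (k + 1), Int.negSucc l => exact rTensor_lTensor_comm _ _
  | Int.negSucc k, Int.ofNat 0 => exact rTensor_lTensor_comm _ _
  | Int.negSucc k, Int.ofNat (l + 1) => exact rTensor_lTensor_comm _ _
  | Int.negSucc k, Int.negSucc l => exact rTensor_lTensor_comm _ _

theorem alpha_b (μ : Fin 26) (m n : ℤ) : alpha s p μ m * b n = b n * alpha s p μ m := by
  match m, n with
  | Int.ofNat 0, n => rw [show Int.ofNat 0 = 0 from rfl, alpha_zero, smul_mul_assoc,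
      mul_smul_comm, one_mul, mul_one]
  | Int.ofNat (k + 1), Int.ofNat l => exact rTensor_lTensor_comm _ _
  | Int.ofNat (k + 1), Int.negSucc l => exact rTensor_lTensor_comm _ _
  | Int.negSucc k, Int.ofNat l => exact rTensor_lTensor_comm _ _
  | Int.negSucc k, Int.negSucc l => exact rTensor_lTensor_comm _ _

theorem alpha_vacuum (μ : Fin 26) {n : ℤ} (hn : 0 < n) : alpha s p μ n vacuum = 0 := by
  match n, hn with
  | Int.ofNat (k + 1), _ => exact matterAnnihilate_vacuum _

theorem c_vacuum {n : ℤ} (hn : 0 < n) : c n vacuum = 0 := by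
  match n, hn with
  | Int.ofNat (k + 1), _ => exact ghostAnnihilate_vacuum _

theorem b_vacuum {n : ℤ} (hn : 0 ≤ n) : b n vacuum = 0 := by
  match n, hn with
  | Int.ofNat k, _ => exact ghostAnnihilate_vacuum _

theorem vacuum_ne_zero : vacuum ≠ 0 := by
  intro h
  have := congrArg (TensorProduct.lift ((LinearMap.mul ℂ ℂ).compl₁₂
    (MvPolynomial.aeval (fun _ => (0 : ℂ)) : MatterFock →ₐ[ℂ] ℂ).toLinearMap
    (ExteriorAlgebra.algebraMapInv : GhostFock →ₐ[ℂ] ℂ).toLinearMap)) h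
  simp [vacuum] at this

end Modes

/-! ### Fock modules over the oscillator algebra -/

/-- A Fock module: a vector space with an action of the modes of 26 bosons and of a `b`-`c` ghost
pair that is generated by a vacuum vector `vac`, on which the annihilation operators vanish. The
zero mode `α_0^μ` is the scalar `a μ`. The string Fock space at fixed momentum is the instance
`fockOscillators`; nothing in the argument uses its concrete realisation. -/
structure Oscillators (V : Type*) [AddCommGroup V] [Module ℂ V] where
  α : Fin 26 → ℤ → Module.End ℂ V
  c : ℤ → Module.End ℂ V
  b : ℤ → Module.End ℂ V
  a : Fin 26 → ℂ
  vac : V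
  α_comm : ∀ μ ν m n, α μ m * α ν n - α ν n * α μ m =
    (if μ = ν ∧ m + n = 0 then (m : ℂ) * eta μ else 0) • (1 : Module.End ℂ V)
  α_zero : ∀ μ, α μ 0 = a μ • (1 : Module.End ℂ V)
  c_acomm : ∀ m n, c m * c n + c n * c m = 0
  b_acomm : ∀ m n, b m * b n + b n * b m = 0
  b_c : ∀ m n, b m * c n + c n * b m = (if m + n = 0 then (1 : ℂ) else 0) • (1 : Module.End ℂ V)
  α_c : ∀ μ m n, α μ m * c n - c n * α μ m = 0
  α_b : ∀ μ m n, α μ m * b n - b n * α μ m = 0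
  α_vac : ∀ μ n, 0 < n → α μ n vac = 0
  c_vac : ∀ n, 0 < n → c n vac = 0
  b_vac : ∀ n, 0 ≤ n → b n vac = 0
  vac_ne_zero : vac ≠ 0
  cyclic : ∀ P : Submodule ℂ V, vac ∈ P → (∀ μ, ∀ n < 0, ∀ v ∈ P, α μ n v ∈ P) →
    (∀ n ≤ 0, ∀ v ∈ P, c n v ∈ P) → (∀ n < 0, ∀ v ∈ P, b n v ∈ P) → P = ⊤

theorem comm_eq_of_mul_eq {V : Type*} [AddCommGroup V] [Module ℂ V] {A B X : Module.End ℂ V}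
    (h : A * B = B * A + X) : A * B - B * A = X := sub_eq_of_eq_add' h

/-- The Fock space at momentum `p`. -/
noncomputable def fockOscillators (s : ℝ) (p : Momentum) : Oscillators Fock where
  α := alpha s p
  c := c
  b := b
  a μ := ((Real.sqrt (2 * s) * p μ : ℝ) : ℂ)
  vac := vacuum
  α_comm μ ν m n := comm_eq_of_mul_eq (alpha_comm s p μ ν m n)
  α_zero _ := rfl
  c_acomm := c_acomm
  b_acomm := b_acomm
  b_c := b_c_acomm
  α_c μ m n := comm_eq_of_mul_eq ((alpha_c s p μ m n).trans (add_zero _).symm)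
  α_b μ m n := comm_eq_of_mul_eq ((alpha_b s p μ m n).trans (add_zero _).symm)
  α_vac μ _ hn := alpha_vacuum s p μ hn
  c_vac _ hn := c_vacuum hn
  b_vac _ hn := b_vacuum hn
  vac_ne_zero := vacuum_ne_zero
  cyclic P h0 hα hc hb := by
    refine fock_eq_top h0 (fun x v hv => hα x.2 (Int.negSucc x.1) (Int.negSucc_lt_zero _) v hv)
      (fun g v hv => ?_)
    match g with
    | .c 0 => exact hc 0 le_rfl v hv
    | .c (k + 1) => exact hc (Int.negSucc k) (Int.negSucc_lt_zero _).le v hv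
    | .b k => exact hb (Int.negSucc k) (Int.negSucc_lt_zero _) v hv

namespace Oscillators

variable {V : Type*} [AddCommGroup V] [Module ℂ V] (O : Oscillators V)

theorem eq_mul_of_comm {A B X : Module.End ℂ V} (h : A * B - B * A = X) : A * B = B * A + X := by
  rw [← h]; abel

theorem eq_mul_of_acomm {A B X : Module.End ℂ V} (h : A * B + B * A = X) :
    A * B = X - B * A := by
  rw [← h]; abel

theorem apply_of_comm {A B X : Module.End ℂ V} (h : A * B - B * A = X) (v : V) :
    A (B v) = B (A v) + X v := by
  have := congrArg (fun T : Module.End ℂ V => T v) (eq_mul_of_comm h)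
  simpa using this

theorem apply_of_acomm {A B X : Module.End ℂ V} (h : A * B + B * A = X) (v : V) :
    A (B v) = X v - B (A v) := by
  have := congrArg (fun T : Module.End ℂ V => T v) (eq_mul_of_acomm h)
  simpa using this

theorem c_b (m n : ℤ) : O.c m * O.b n + O.b n * O.c m =
    (if m + n = 0 then (1 : ℂ) else 0) • (1 : Module.End ℂ V) := by
  rw [add_comm, O.b_c, add_comm]

theorem c_α (μ : Fin 26) (m n : ℤ) : O.c m * O.α μ n - O.α μ n * O.c m = 0 := by
  rw [← neg_sub, O.α_c, neg_zero]

theorem b_α (μ : Fin 26) (m n : ℤ) : O.b m * O.α μ n - O.α μ n * O.b m = 0 := by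
  rw [← neg_sub, O.α_b, neg_zero]

/-! ### Annihilation and local finiteness -/

/-- All modes of frequency greater than `R` annihilate `v`. -/
def KilledAbove (v : V) (R : ℕ) : Prop :=
  ∀ k : ℤ, R < k → (∀ μ, O.α μ k v = 0) ∧ O.c k v = 0 ∧ O.b k v = 0

theorem exists_killedAbove (v : V) : ∃ R, O.KilledAbove v R := by
  let P : Submodule ℂ V :=
    { carrier := {v | ∃ R, O.KilledAbove v R}
      zero_mem' := ⟨0, fun k _ => by simp⟩
      add_mem' := by
        rintro v w ⟨R, hR⟩ ⟨S, hS⟩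
        refine ⟨max R S, fun k hk => ?_⟩
        push_cast at hk
        obtain ⟨h1, h2, h3⟩ := hR k (lt_of_le_of_lt (le_max_left _ _) hk)
        obtain ⟨h4, h5, h6⟩ := hS k (lt_of_le_of_lt (le_max_right _ _) hk)
        exact ⟨fun μ => by rw [map_add, h1, h4, add_zero], by rw [map_add, h2, h5, add_zero],
          by rw [map_add, h3, h6, add_zero]⟩
      smul_mem' := by
        rintro z v ⟨R, hR⟩
        refine ⟨R, fun k hk => ?_⟩
        obtain ⟨h1, h2, h3⟩ := hR k hk
        exact ⟨fun μ => by rw [map_smul, h1, smul_zero], by rw [map_smul, h2, smul_zero],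
          by rw [map_smul, h3, smul_zero]⟩ }
  suffices P = ⊤ by
    have h : v ∈ P := this ▸ Submodule.mem_top
    exact h
  have key : ∀ R : ℕ, ∀ n k : ℤ, ((max R n.natAbs : ℕ) : ℤ) < k → (R : ℤ) < k ∧ k + n ≠ 0 := by
    intro R n k hk
    push_cast at hk
    constructor
    · exact lt_of_le_of_lt (le_max_left _ _) hk
    · have := lt_of_le_of_lt (le_max_right _ _) hk
      intro h
      have h' := neg_abs_le n
      omega
  refine O.cyclic P ⟨0, fun k hk => ?_⟩ ?_ ?_ ?_
  · have hk : 0 < k := by simpa using hk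
    exact ⟨fun μ => O.α_vac μ k hk, O.c_vac k hk, O.b_vac k hk.le⟩
  · rintro μ n - v ⟨R, hR⟩
    refine ⟨max R n.natAbs, fun k hk => ?_⟩
    obtain ⟨hk1, hk2⟩ := key R n k hk
    obtain ⟨h1, h2, h3⟩ := hR k hk1
    refine ⟨fun ν => ?_, ?_, ?_⟩
    · rw [apply_of_comm (O.α_comm ν μ k n), h1, if_neg (fun h => hk2 h.2)]; simp
    · rw [apply_of_comm (O.c_α μ k n), h2]; simp
    · rw [apply_of_comm (O.b_α μ k n), h3]; simp
  · rintro n - v ⟨R, hR⟩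
    refine ⟨max R n.natAbs, fun k hk => ?_⟩
    obtain ⟨hk1, hk2⟩ := key R n k hk
    obtain ⟨h1, h2, h3⟩ := hR k hk1
    refine ⟨fun ν => ?_, ?_, ?_⟩
    · rw [apply_of_comm (O.α_c ν k n), h1]; simp
    · rw [apply_of_acomm (O.c_acomm k n), h2]; simp
    · rw [apply_of_acomm (O.b_c k n), h3, if_neg hk2]; simp
  · rintro n - v ⟨R, hR⟩
    refine ⟨max R n.natAbs, fun k hk => ?_⟩
    obtain ⟨hk1, hk2⟩ := key R n k hk
    obtain ⟨h1, h2, h3⟩ := hR k hk1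
    refine ⟨fun ν => ?_, ?_, ?_⟩
    · rw [apply_of_comm (O.α_b ν k n), h1]; simp
    · rw [apply_of_acomm (O.c_b k n), h2, if_neg hk2]; simp
    · rw [apply_of_acomm (O.b_acomm k n), h3]; simp

/-- `v` is annihilated by all modes of positive frequency. -/
def Annihilated (v : V) : Prop :=
  ∀ k : ℤ, 0 < k → (∀ μ, O.α μ k v = 0) ∧ O.c k v = 0 ∧ O.b k v = 0

theorem annihilated_vac : O.Annihilated O.vac := fun k hk =>
  ⟨fun μ => O.α_vac μ k hk, O.c_vac k hk, O.b_vac k hk.le⟩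

/-! ### Operators determined by their commutators with the modes -/

/-- `T` has weight `w` under the adjoint action of `D`. -/
def Graded (D : Module.End ℂ V) (w : ℂ) (T : Module.End ℂ V) : Prop := D * T - T * D = w • T

section Graded

variable {D A B : Module.End ℂ V} {w w' : ℂ}

theorem Graded.mul (hA : Graded D w A) (hB : Graded D w' B) : Graded D (w + w') (A * B) := by
  unfold Graded at *
  linear_combination (norm := skip) hA * B + A * hB
  simp only [mul_sub, sub_mul, mul_assoc, smul_mul_assoc, mul_smul_comm]
  module

theorem Graded.add (hA : Graded D w A) (hB : Graded D w B) : Graded D w (A + B) := by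
  unfold Graded at *
  linear_combination (norm := skip) hA + hB
  simp only [mul_add, add_mul]
  module

theorem Graded.sub (hA : Graded D w A) (hB : Graded D w B) : Graded D w (A - B) := by
  unfold Graded at *
  linear_combination (norm := skip) hA - hB
  simp only [mul_sub, sub_mul]
  module

theorem Graded.smul (z : ℂ) (hA : Graded D w A) : Graded D w (z • A) := by
  unfold Graded at *
  rw [mul_smul_comm, smul_mul_assoc, ← smul_sub, hA, smul_comm]

theorem Graded.congr (hA : Graded D w A) (h : w = w') : Graded D w' A := h ▸ hA

theorem Graded.zero : Graded D w (0 : Module.End ℂ V) := by simp [Graded]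

theorem Graded.one : Graded D 0 (1 : Module.End ℂ V) := by simp [Graded]

theorem Graded.comm (hA : Graded D w A) (hB : Graded D w' B) :
    Graded D (w + w') (A * B - B * A) :=
  (hA.mul hB).sub ((hB.mul hA).congr (add_comm _ _))

theorem Graded.acomm (hA : Graded D w A) (hB : Graded D w' B) :
    Graded D (w + w') (A * B + B * A) :=
  (hA.mul hB).add ((hB.mul hA).congr (add_comm _ _))

theorem Graded.sum {ι : Type*} {s : Finset ι} {A : ι → Module.End ℂ V}
    (h : ∀ i ∈ s, Graded D w (A i)) : Graded D w (∑ i ∈ s, A i) :=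
  Finset.sum_induction _ _ (fun _ _ => Graded.add) Graded.zero h

theorem Graded.opSum {ι : Type*} {A : ι → Module.End ℂ V} (hA : LocFin A)
    (h : ∀ i, Graded D w (A i)) : Graded D w (opSum A) := by
  unfold Graded at *
  rw [← neg_sub, opSum_comm hA, ← opSum_smul hA, ← neg_one_smul ℂ, ← opSum_smul (hA.comm D)]
  congr 1
  ext1 i
  rw [← h i]
  module

theorem Graded.apply (h : Graded D w A) {v : V} {x : ℂ} (hv : D v = x • v) :
    D (A v) = (w + x) • A v := by
  rw [apply_of_comm h, hv, map_smul, LinearMap.smul_apply, ← add_smul, add_comm]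

end Graded

/-- An operator that commutes, up to a sign, with all creation operators is determined by its value
on the vacuum. -/
theorem eq_zero_of_vac {T : Module.End ℂ V} (z : ℂ) (h0 : T O.vac = 0)
    (hα : ∀ μ, ∀ n < 0, T * O.α μ n = O.α μ n * T) (hc : ∀ n ≤ 0, T * O.c n = z • (O.c n * T))
    (hb : ∀ n < 0, T * O.b n = z • (O.b n * T)) : T = 0 := by
  have h : LinearMap.ker T = ⊤ := by
    refine O.cyclic _ h0 (fun μ n hn v hv => ?_) (fun n hn v hv => ?_) (fun n hn v hv => ?_)
    · have := congrArg (fun S : Module.End ℂ V => S v) (hα μ n hn)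
      simp only [Module.End.mul_apply, LinearMap.mem_ker] at this hv ⊢
      rw [this, hv, map_zero]
    · have := congrArg (fun S : Module.End ℂ V => S v) (hc n hn)
      simp only [Module.End.mul_apply, LinearMap.mem_ker, LinearMap.smul_apply] at this hv ⊢
      rw [this, hv, map_zero, smul_zero]
    · have := congrArg (fun S : Module.End ℂ V => S v) (hb n hn)
      simp only [Module.End.mul_apply, LinearMap.mem_ker, LinearMap.smul_apply] at this hv ⊢
      rw [this, hv, map_zero, smul_zero]
  exact LinearMap.ker_eq_top.1 h

/-- A vector annihilated by all annihilation operators is also annihilated by `D`. This holds for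
the sums of products (creation operator) · (annihilation operator), such as the ghost number and
the level. -/
def IsNumberOp (D : Module.End ℂ V) : Prop := ∀ v, O.Annihilated v → D v = 0

theorem IsNumberOp.eq_zero {D : Module.End ℂ V} (hD : O.IsNumberOp D) {w : ℂ} (hw : w ≠ 0) {v : V}
    (hv : O.Annihilated v) (h : D v = w • v) : v = 0 := by
  rw [hD v hv] at h
  exact (smul_eq_zero.1 h.symm).resolve_left hw

/-- The vanishing criterion: an operator of nonzero weight (ghost number or level) that commutes,
up to a sign, with all modes is zero, because it maps the vacuum to a vector annihilated by all
annihilation operators. -/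
theorem eq_zero_of_graded {D T : Module.End ℂ V} (hD : O.IsNumberOp D) {w z : ℂ} (hw : w ≠ 0)
    (hz : z ≠ 0) (hT : Graded D w T) (hα : ∀ μ n, T * O.α μ n = O.α μ n * T)
    (hc : ∀ n, T * O.c n = z • (O.c n * T)) (hb : ∀ n ≠ 0, T * O.b n = z • (O.b n * T)) :
    T = 0 := by
  refine O.eq_zero_of_vac z ?_ (fun μ n _ => hα μ n) (fun n _ => hc n) (fun n hn => hb n hn.ne)
  have key : ∀ S : Module.End ℂ V, S O.vac = 0 → T * S = z • (S * T) → S (T O.vac) = 0 := by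
    intro S hS h
    have := congrArg (fun S : Module.End ℂ V => S O.vac) h
    simp only [Module.End.mul_apply, LinearMap.smul_apply, hS, map_zero] at this
    exact (smul_eq_zero.1 this.symm).resolve_left hz
  refine hD.eq_zero O hw (fun k hk => ⟨fun μ => ?_, ?_, ?_⟩)
    ((hT.apply (x := 0) (by rw [hD _ O.annihilated_vac, zero_smul])).trans (by rw [add_zero]))
  · have := congrArg (fun S : Module.End ℂ V => S O.vac) (hα μ k)
    simpa [O.α_vac μ k hk] using this.symm
  · exact key _ (O.c_vac k hk) (hc k)
  · exact key _ (O.b_vac k hk.le) (hb k hk.ne')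

/-- The vanishing criterion for even operators. -/
theorem eq_zero_of_comm {D T : Module.End ℂ V} (hD : O.IsNumberOp D) {w : ℂ} (hw : w ≠ 0)
    (hT : Graded D w T) (hα : ∀ μ n, T * O.α μ n - O.α μ n * T = 0)
    (hc : ∀ n, T * O.c n - O.c n * T = 0) (hb : ∀ n ≠ 0, T * O.b n - O.b n * T = 0) : T = 0 :=
  O.eq_zero_of_graded hD hw one_ne_zero hT (fun μ n => sub_eq_zero.1 (hα μ n))
    (fun n => by rw [one_smul]; exact sub_eq_zero.1 (hc n))
    (fun n hn => by rw [one_smul]; exact sub_eq_zero.1 (hb n hn))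

/-- The vanishing criterion for odd operators. -/
theorem eq_zero_of_acomm {D T : Module.End ℂ V} (hD : O.IsNumberOp D) {w : ℂ} (hw : w ≠ 0)
    (hT : Graded D w T) (hα : ∀ μ n, T * O.α μ n - O.α μ n * T = 0)
    (hc : ∀ n, T * O.c n + O.c n * T = 0) (hb : ∀ n ≠ 0, T * O.b n + O.b n * T = 0) : T = 0 :=
  O.eq_zero_of_graded hD hw (neg_ne_zero.2 one_ne_zero) hT (fun μ n => sub_eq_zero.1 (hα μ n))
    (fun n => by rw [neg_one_smul]; exact eq_neg_of_add_eq_zero_left (hc n))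
    (fun n hn => by rw [neg_one_smul]; exact eq_neg_of_add_eq_zero_left (hb n hn))

/-! ### Bilinear operators -/

/-- The commutator of a product of two odd operators with an odd operator. -/
theorem mul_comm_of_acomm {A B x : Module.End ℂ V} {β γ : ℂ}
    (hB : B * x + x * B = β • (1 : Module.End ℂ V))
    (hA : A * x + x * A = γ • (1 : Module.End ℂ V)) :
    A * B * x - x * (A * B) = β • A - γ • B := by
  linear_combination (norm := skip) A * hB - hA * B
  simp only [mul_add, add_mul, mul_assoc, smul_mul_assoc, mul_smul_comm, mul_one, one_mul]
  module

theorem mul_comm_of_comm {A B x : Module.End ℂ V} (hA : A * x - x * A = 0)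
    (hB : B * x - x * B = 0) : A * B * x - x * (A * B) = 0 := by
  linear_combination (norm := skip) A * hB + hA * B
  simp only [mul_sub, sub_mul, mul_assoc, mul_zero, zero_mul]
  module

theorem locFin_of_killedAbove {ι : Type*} {A : ι → Module.End ℂ V}
    (h : ∀ v R, O.KilledAbove v R → ∃ t : Set ι, t.Finite ∧ ∀ i ∉ t, A i v = 0) : LocFin A := by
  intro v
  obtain ⟨R, hR⟩ := O.exists_killedAbove v
  obtain ⟨t, ht, hA⟩ := h v R hR
  refine ht.subset fun i hi => ?_
  by_contra h'
  exact hi (hA i h')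

theorem locFin_nat {A X Y : ℕ → Module.End ℂ V} (z : ℕ → ℂ) (hA : ∀ k, A k = z k • (X k * Y k))
    (hY : ∀ v R, O.KilledAbove v R → ∀ k : ℕ, (R : ℤ) < (k : ℤ) + 1 → Y k v = 0) : LocFin A := by
  refine O.locFin_of_killedAbove fun v R hR => ⟨Set.Iio R, Set.finite_Iio R, fun k hk => ?_⟩
  have hk : R ≤ k := by simpa using hk
  rw [hA, LinearMap.smul_apply, Module.End.mul_apply, hY v R hR k (by omega), map_zero, smul_zero]

theorem locFin_cc (z : ℕ → ℂ) : LocFin fun k : ℕ => z k • (O.c (-(k + 1)) * O.c (k + 1)) :=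
  O.locFin_nat z (fun _ => rfl) fun _ _ hR _ hk => (hR _ hk).2.1

theorem locFin_bb (z : ℕ → ℂ) : LocFin fun k : ℕ => z k • (O.b (-(k + 1)) * O.b (k + 1)) :=
  O.locFin_nat z (fun _ => rfl) fun _ _ hR _ hk => (hR _ hk).2.2

theorem locFin_cb (z : ℕ → ℂ) : LocFin fun k : ℕ => z k • (O.c (-(k + 1)) * O.b (k + 1)) :=
  O.locFin_nat z (fun _ => rfl) fun _ _ hR _ hk => (hR _ hk).2.2

theorem locFin_bc (z : ℕ → ℂ) : LocFin fun k : ℕ => z k • (O.b (-(k + 1)) * O.c (k + 1)) :=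
  O.locFin_nat z (fun _ => rfl) fun _ _ hR _ hk => (hR _ hk).2.1

theorem opSum_nat_single (m : ℤ) (X : Module.End ℂ V) :
    opSum (fun k : ℕ => if (k : ℤ) + 1 = m then X else 0) = if 0 < m then X else 0 := by
  split_ifs with h
  · have : ∀ k : ℕ, ((k : ℤ) + 1 = m) = (k = (m - 1).toNat) := fun k => by
      apply propext; omega
    simp only [this]
    exact opSum_single _ (fun _ => X)
  · have : ∀ k : ℕ, ¬ ((k : ℤ) + 1 = m) := fun k => by omega
    simp only [this, if_false]
    exact opSum_zero

theorem locFin_nat_single (m : ℤ) (X : Module.End ℂ V) :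
    LocFin (fun k : ℕ => if (k : ℤ) + 1 = m then X else 0) := by
  intro v
  refine (Set.finite_singleton (m - 1).toNat).subset fun k hk => ?_
  by_contra h
  apply hk
  have : ¬ ((k : ℤ) + 1 = m) := fun h' => h (by simp only [Set.mem_singleton_iff]; omega)
  simp [this]

/-- The commutator of `∑_{k>0} A_k` with a mode of frequency `n` collects only the terms
`k = n` and `k = -n`. -/
theorem opSum_comm_mode {A : ℕ → Module.End ℂ V} (hA : LocFin A) {x X Y : Module.End ℂ V} (n : ℤ)
    (h : ∀ k : ℕ, A k * x - x * A k =
      (if (k : ℤ) + 1 = n then X else 0) + (if (k : ℤ) + 1 = -n then Y else 0)) :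
    opSum A * x - x * opSum A = (if 0 < n then X else 0) + (if n < 0 then Y else 0) := by
  rw [opSum_comm hA]
  simp only [h]
  rw [opSum_add (locFin_nat_single _ _) (locFin_nat_single _ _), opSum_nat_single,
    opSum_nat_single]
  simp only [Left.neg_pos_iff]

theorem opSum_comm_eq_zero {ι : Type*} {A : ι → Module.End ℂ V} (hA : LocFin A)
    {x : Module.End ℂ V} (h : ∀ k, A k * x - x * A k = 0) :
    opSum A * x - x * opSum A = 0 := by
  rw [opSum_comm hA]
  simp only [h]
  exact opSum_zero

theorem opSum_acomm_eq_zero {ι : Type*} {A : ι → Module.End ℂ V} (hA : LocFin A)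
    {x : Module.End ℂ V} (h : ∀ k, A k * x + x * A k = 0) :
    opSum A * x + x * opSum A = 0 := by
  rw [opSum_acomm hA]
  simp only [h]
  exact opSum_zero

theorem smul_comm_eq {A x Y : Module.End ℂ V} (z : ℂ) (h : A * x - x * A = Y) :
    (z • A) * x - x * (z • A) = z • Y := by
  rw [smul_mul_assoc, mul_smul_comm, ← smul_sub, h]

theorem add_comm_eq {A B x X Y : Module.End ℂ V} (hA : A * x - x * A = X)
    (hB : B * x - x * B = Y) : (A + B) * x - x * (A + B) = X + Y := by
  rw [add_mul, mul_add, ← hA, ← hB]; abel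

theorem sub_comm_eq {A B x X Y : Module.End ℂ V} (hA : A * x - x * A = X)
    (hB : B * x - x * B = Y) : (A - B) * x - x * (A - B) = X - Y := by
  rw [sub_mul, mul_sub, ← hA, ← hB]; abel

theorem sum_comm_eq_zero {ι : Type*} {s : Finset ι} {A : ι → Module.End ℂ V} {x : Module.End ℂ V}
    (h : ∀ i ∈ s, A i * x - x * A i = 0) : (∑ i ∈ s, A i) * x - x * (∑ i ∈ s, A i) = 0 := by
  rw [Finset.sum_mul, Finset.mul_sum, ← Finset.sum_sub_distrib]
  exact Finset.sum_eq_zero h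

/-! ### The operator `M` and its `sl₂` partners -/

/-- `M = -2 ∑_{n>0} n c_{-n} c_n`. -/
noncomputable def M : Module.End ℂ V :=
  opSum fun k : ℕ => (-2 * ((k : ℂ) + 1)) • (O.c (-(k + 1)) * O.c (k + 1))

/-- The lowering operator `-1/2 ∑_{n>0} 1/n b_{-n} b_n` of the `sl₂` triple of `M`. -/
noncomputable def lower : Module.End ℂ V :=
  opSum fun k : ℕ => (-1 / (2 * ((k : ℂ) + 1))) • (O.b (-(k + 1)) * O.b (k + 1))

/-- The ghost number `∑_{n>0} (c_{-n} b_n - b_{-n} c_n)`; the zero modes are not counted. -/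
noncomputable def ghostNumber : Module.End ℂ V :=
  (opSum fun k : ℕ => (1 : ℂ) • (O.c (-(k + 1)) * O.b (k + 1))) -
    opSum fun k : ℕ => (1 : ℂ) • (O.b (-(k + 1)) * O.c (k + 1))

theorem M_α (μ : Fin 26) (n : ℤ) : O.M * O.α μ n - O.α μ n * O.M = 0 :=
  opSum_comm_eq_zero (O.locFin_cc _) fun k => by
    rw [smul_comm_eq _ (mul_comm_of_comm (O.c_α _ _ _) (O.c_α _ _ _)), smul_zero]

theorem M_c (n : ℤ) : O.M * O.c n - O.c n * O.M = 0 :=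
  opSum_comm_eq_zero (O.locFin_cc _) fun k => by
    rw [smul_comm_eq _ (mul_comm_of_acomm (β := 0) (γ := 0) (by rw [O.c_acomm, zero_smul])
      (by rw [O.c_acomm, zero_smul]))]
    simp

theorem M_b (n : ℤ) : O.M * O.b n - O.b n * O.M = (2 * n : ℂ) • O.c n := by
  rw [M, opSum_comm_mode (O.locFin_cc _) (X := (2 * n : ℂ) • O.c n) (Y := (2 * n : ℂ) • O.c n) n]
  · rcases lt_trichotomy n 0 with h | h | h
    · simp [h, h.not_gt]
    · simp [h]
    · simp [h, h.not_gt]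
  · intro k
    rw [smul_comm_eq _ (mul_comm_of_acomm (O.c_b _ _) (O.c_b _ _))]
    by_cases h1 : (k : ℤ) + 1 = n
    · subst h1
      rw [if_neg (by omega), if_pos (by omega), if_pos rfl, if_neg (by omega)]
      push_cast; module
    · by_cases h2 : (k : ℤ) + 1 = -n
      · obtain rfl : n = -((k : ℤ) + 1) := by omega
        rw [if_pos (by omega), if_neg (by omega), if_neg h1, if_pos (by omega)]
        push_cast; module
      · rw [if_neg (by omega), if_neg (by omega), if_neg h1, if_neg h2]
        simp

theorem lower_α (μ : Fin 26) (n : ℤ) : O.lower * O.α μ n - O.α μ n * O.lower = 0 :=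
  opSum_comm_eq_zero (O.locFin_bb _) fun k => by
    rw [smul_comm_eq _ (mul_comm_of_comm (O.b_α _ _ _) (O.b_α _ _ _)), smul_zero]

theorem lower_b (n : ℤ) : O.lower * O.b n - O.b n * O.lower = 0 :=
  opSum_comm_eq_zero (O.locFin_bb _) fun k => by
    rw [smul_comm_eq _ (mul_comm_of_acomm (β := 0) (γ := 0) (by rw [O.b_acomm, zero_smul])
      (by rw [O.b_acomm, zero_smul]))]
    simp

/-- For `n = 0` the coefficient is `1 / 0 = 0`, in accordance with the absence of `b_0` in
`lower`. -/
theorem lower_c (n : ℤ) : O.lower * O.c n - O.c n * O.lower = (1 / (2 * n) : ℂ) • O.b n := by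
  rw [lower, opSum_comm_mode (O.locFin_bb _) (X := (1 / (2 * n) : ℂ) • O.b n)
    (Y := (1 / (2 * n) : ℂ) • O.b n) n]
  · rcases lt_trichotomy n 0 with h | h | h
    · simp [h, h.not_gt]
    · simp [h]
    · simp [h, h.not_gt]
  · intro k
    rw [smul_comm_eq _ (mul_comm_of_acomm (O.b_c _ _) (O.b_c _ _))]
    by_cases h1 : (k : ℤ) + 1 = n
    · subst h1
      rw [if_neg (by omega), if_pos (by omega), if_pos rfl, if_neg (by omega)]
      push_cast; rw [neg_div]; module
    · by_cases h2 : (k : ℤ) + 1 = -n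
      · obtain rfl : n = -((k : ℤ) + 1) := by omega
        rw [if_pos (by omega), if_neg (by omega), if_neg h1, if_pos (by omega)]
        push_cast
        rw [mul_neg, div_neg, neg_div]; module
      · rw [if_neg (by omega), if_neg (by omega), if_neg h1, if_neg h2]
        simp

theorem ghostNumber_α (μ : Fin 26) (n : ℤ) : Graded O.ghostNumber 0 (O.α μ n) := by
  unfold Graded
  rw [zero_smul, ← sub_zero (0 : Module.End ℂ V)]
  refine sub_comm_eq (opSum_comm_eq_zero (O.locFin_cb _) fun k => ?_)
    (opSum_comm_eq_zero (O.locFin_bc _) fun k => ?_)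
  · rw [smul_comm_eq _ (mul_comm_of_comm (O.c_α _ _ _) (O.b_α _ _ _)), smul_zero]
  · rw [smul_comm_eq _ (mul_comm_of_comm (O.b_α _ _ _) (O.c_α _ _ _)), smul_zero]

section

variable (z : ℕ → ℂ) (n : ℤ) (w : ℂ)

/-- The commutators of `∑_{k>0} z_k c_{-k} b_k` and `∑_{k>0} z_k b_{-k} c_k` with ghost modes; here
`w` is the coefficient `z_{|n|}`. -/
theorem opSum_cb_c (hz : ∀ k : ℕ, (k : ℤ) + 1 = -n → z k = w) :
    opSum (fun k : ℕ => z k • (O.c (-(k + 1)) * O.b (k + 1))) * O.c n -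
      O.c n * opSum (fun k : ℕ => z k • (O.c (-(k + 1)) * O.b (k + 1))) =
      if n < 0 then w • O.c n else 0 := by
  rw [opSum_comm_mode (O.locFin_cb _) (X := 0) (Y := w • O.c n) n]
  · simp
  · intro k
    rw [smul_comm_eq _ (mul_comm_of_acomm (γ := 0) (O.b_c _ _) (by rw [O.c_acomm, zero_smul]))]
    by_cases h2 : (k : ℤ) + 1 = -n
    · rw [if_pos (by omega), if_pos h2, hz k h2, h2, neg_neg]; simp
    · rw [if_neg (by omega), if_neg h2]; simp

theorem opSum_cb_b (hz : ∀ k : ℕ, (k : ℤ) + 1 = n → z k = w) :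
    opSum (fun k : ℕ => z k • (O.c (-(k + 1)) * O.b (k + 1))) * O.b n -
      O.b n * opSum (fun k : ℕ => z k • (O.c (-(k + 1)) * O.b (k + 1))) =
      if 0 < n then -w • O.b n else 0 := by
  rw [opSum_comm_mode (O.locFin_cb _) (X := -w • O.b n) (Y := 0) n]
  · simp
  · intro k
    rw [smul_comm_eq _ (mul_comm_of_acomm (β := 0) (by rw [O.b_acomm, zero_smul]) (O.c_b _ _))]
    by_cases h2 : (k : ℤ) + 1 = n
    · rw [if_pos (by omega), if_pos h2, hz k h2, h2]; simp
    · rw [if_neg (by omega), if_neg h2]; simp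

theorem opSum_bc_b (hz : ∀ k : ℕ, (k : ℤ) + 1 = -n → z k = w) :
    opSum (fun k : ℕ => z k • (O.b (-(k + 1)) * O.c (k + 1))) * O.b n -
      O.b n * opSum (fun k : ℕ => z k • (O.b (-(k + 1)) * O.c (k + 1))) =
      if n < 0 then w • O.b n else 0 := by
  rw [opSum_comm_mode (O.locFin_bc _) (X := 0) (Y := w • O.b n) n]
  · simp
  · intro k
    rw [smul_comm_eq _ (mul_comm_of_acomm (γ := 0) (O.c_b _ _) (by rw [O.b_acomm, zero_smul]))]
    by_cases h2 : (k : ℤ) + 1 = -n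
    · rw [if_pos (by omega), if_pos h2, hz k h2, h2, neg_neg]; simp
    · rw [if_neg (by omega), if_neg h2]; simp

theorem opSum_bc_c (hz : ∀ k : ℕ, (k : ℤ) + 1 = n → z k = w) :
    opSum (fun k : ℕ => z k • (O.b (-(k + 1)) * O.c (k + 1))) * O.c n -
      O.c n * opSum (fun k : ℕ => z k • (O.b (-(k + 1)) * O.c (k + 1))) =
      if 0 < n then -w • O.c n else 0 := by
  rw [opSum_comm_mode (O.locFin_bc _) (X := -w • O.c n) (Y := 0) n]
  · simp
  · intro k
    rw [smul_comm_eq _ (mul_comm_of_acomm (β := 0) (by rw [O.c_acomm, zero_smul]) (O.b_c _ _))]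
    by_cases h2 : (k : ℤ) + 1 = n
    · rw [if_pos (by omega), if_pos h2, hz k h2, h2]; simp
    · rw [if_neg (by omega), if_neg h2]; simp

end

theorem ghostNumber_c {n : ℤ} (hn : n ≠ 0) : Graded O.ghostNumber 1 (O.c n) := by
  unfold Graded
  rw [ghostNumber, sub_comm_eq (O.opSum_cb_c _ n 1 fun _ _ => rfl)
    (O.opSum_bc_c _ n 1 fun _ _ => rfl)]
  rcases lt_or_gt_of_ne hn with h | h <;> simp [h, h.not_gt]

theorem ghostNumber_b {n : ℤ} (hn : n ≠ 0) : Graded O.ghostNumber (-1) (O.b n) := by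
  unfold Graded
  rw [ghostNumber, sub_comm_eq (O.opSum_cb_b _ n 1 fun _ _ => rfl)
    (O.opSum_bc_b _ n 1 fun _ _ => rfl)]
  rcases lt_or_gt_of_ne hn with h | h <;> simp [h, h.not_gt]

theorem ghostNumber_c_zero : Graded O.ghostNumber 0 (O.c 0) := by
  unfold Graded
  rw [ghostNumber, sub_comm_eq (O.opSum_cb_c _ 0 1 fun _ _ => rfl)
    (O.opSum_bc_c _ 0 1 fun _ _ => rfl)]
  simp

theorem isNumberOp_ghostNumber : O.IsNumberOp O.ghostNumber := fun v hv => by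
  have h : ∀ k : ℕ, (0 : ℤ) < (k : ℤ) + 1 := fun k => by omega
  rw [ghostNumber, LinearMap.sub_apply, opSum_apply_eq_zero (O.locFin_cb _),
    opSum_apply_eq_zero (O.locFin_bc _), sub_zero]
  · intro k
    simp [(hv _ (h k)).2.1]
  · intro k
    simp [(hv _ (h k)).2.2]

theorem ghostNumber_M : Graded O.ghostNumber 2 O.M := by
  refine Graded.opSum (O.locFin_cc _) fun k => Graded.smul _ ?_
  exact ((O.ghostNumber_c (by omega)).mul (O.ghostNumber_c (by omega))).congr (by norm_num)

theorem ghostNumber_lower : Graded O.ghostNumber (-2) O.lower := by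
  refine Graded.opSum (O.locFin_bb _) fun k => Graded.smul _ ?_
  exact ((O.ghostNumber_b (by omega)).mul (O.ghostNumber_b (by omega))).congr (by norm_num)

theorem M_vac : O.M O.vac = 0 := opSum_apply_eq_zero (O.locFin_cc _) fun k => by
  simp [O.c_vac ((k : ℤ) + 1) (by omega)]

theorem lower_vac : O.lower O.vac = 0 := opSum_apply_eq_zero (O.locFin_bb _) fun k => by
  simp [O.b_vac ((k : ℤ) + 1) (by omega)]

/-- `M`, `lower` and the ghost number form an `sl₂` triple. -/
theorem M_lower : O.M * O.lower - O.lower * O.M = O.ghostNumber := by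
  rw [← sub_eq_zero]
  refine O.eq_zero_of_vac 1 ?_ (fun μ n _ => ?_) (fun n _ => ?_) (fun n hn => ?_)
  · simp [M_vac, lower_vac, O.isNumberOp_ghostNumber _ O.annihilated_vac]
  · have hG := O.ghostNumber_α μ n
    unfold Graded at hG
    rw [← sub_eq_zero]
    linear_combination (norm := skip) O.M * O.lower_α μ n + O.M_α μ n * O.lower
      - O.lower * O.M_α μ n - O.lower_α μ n * O.M - hG
    simp only [mul_sub, sub_mul, mul_assoc, mul_zero, zero_mul]
    module
  · rw [← sub_eq_zero]
    by_cases h0 : n = 0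
    · subst h0
      have hl := O.lower_c 0
      have hG := O.ghostNumber_c_zero
      unfold Graded at hG
      simp only [Int.cast_zero, mul_zero, div_zero, zero_smul] at hl hG
      linear_combination (norm := skip) O.M * hl + O.M_c 0 * O.lower
        - O.lower * O.M_c 0 - hl * O.M - hG
      simp only [mul_sub, sub_mul, mul_assoc, mul_zero, zero_mul]
      module
    · have hG := O.ghostNumber_c h0
      unfold Graded at hG
      have hn : (n : ℂ) ≠ 0 := Int.cast_ne_zero.2 h0
      have hb : (1 / (2 * n) : ℂ) • (O.M * O.b n - O.b n * O.M) = O.c n := by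
        rw [O.M_b, smul_smul]
        field_simp
        simp
      linear_combination (norm := skip) O.M * O.lower_c n + O.M_c n * O.lower
        - O.lower * O.M_c n - O.lower_c n * O.M - hG + hb
      simp only [mul_sub, sub_mul, mul_assoc, smul_mul_assoc, mul_smul_comm, mul_zero, zero_mul]
      module
  · have hG := O.ghostNumber_b hn.ne
    unfold Graded at hG
    have hn' : (n : ℂ) ≠ 0 := Int.cast_ne_zero.2 hn.ne
    have hc : (2 * n : ℂ) • (O.lower * O.c n - O.c n * O.lower) = O.b n := by
      rw [O.lower_c, smul_smul]
      field_simp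
      simp
    rw [← sub_eq_zero]
    linear_combination (norm := skip) O.M * O.lower_b n + O.M_b n * O.lower
      - O.lower * O.M_b n - O.lower_b n * O.M - hG - hc
    simp only [mul_sub, sub_mul, mul_assoc, smul_mul_assoc, mul_smul_comm, mul_zero, zero_mul]
    module

/-! ### Level and Virasoro operators -/

/-- The matter part of the level operator. -/
noncomputable def matterLevel : Module.End ℂ V :=
  opSum fun k : ℕ => ∑ μ : Fin 26, eta μ • (O.α μ (-(k + 1)) * O.α μ (k + 1))

/-- The ghost part of the level operator. -/
noncomputable def ghostLevel : Module.End ℂ V :=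
  opSum fun k : ℕ => ((k : ℂ) + 1) •
    (O.c (-(k + 1)) * O.b (k + 1) + O.b (-(k + 1)) * O.c (k + 1))

/-- The level operator `N`. -/
noncomputable def level : Module.End ℂ V := O.matterLevel + O.ghostLevel

theorem locFin_matterLevel :
    LocFin fun k : ℕ => ∑ μ : Fin 26, eta μ • (O.α μ (-(k + 1)) * O.α μ (k + 1)) := by
  refine O.locFin_of_killedAbove fun v R hR => ⟨Set.Iio R, Set.finite_Iio R, fun k hk => ?_⟩
  have hk : R ≤ k := by simpa using hk
  rw [LinearMap.sum_apply]
  refine Finset.sum_eq_zero fun μ _ => ?_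
  rw [LinearMap.smul_apply, Module.End.mul_apply, (hR _ (by omega)).1 μ, map_zero, smul_zero]

theorem ghostLevel_eq : O.ghostLevel =
    opSum (fun k : ℕ => ((k : ℂ) + 1) • (O.c (-(k + 1)) * O.b (k + 1))) +
      opSum (fun k : ℕ => ((k : ℂ) + 1) • (O.b (-(k + 1)) * O.c (k + 1))) := by
  rw [ghostLevel, ← opSum_add (O.locFin_cb _) (O.locFin_bc _)]
  simp only [smul_add]

theorem locFin_ghostLevel : LocFin fun k : ℕ => ((k : ℂ) + 1) •
    (O.c (-(k + 1)) * O.b (k + 1) + O.b (-(k + 1)) * O.c (k + 1)) := by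
  simp only [smul_add]
  exact (O.locFin_cb _).add (O.locFin_bc _)

theorem ghostLevel_c (n : ℤ) : O.ghostLevel * O.c n - O.c n * O.ghostLevel = (-n : ℂ) • O.c n := by
  rw [ghostLevel_eq, add_comm_eq (O.opSum_cb_c _ n (-n) fun k hk => ?_)
    (O.opSum_bc_c _ n n fun k hk => ?_)]
  · rcases lt_trichotomy n 0 with h | h | h
    · simp [h, h.not_gt]
    · simp [h]
    · simp [h, h.not_gt]
  · have : (((k : ℤ) + 1 : ℤ) : ℂ) = ((-n : ℤ) : ℂ) := by rw [hk]
    simpa using this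
  · have : (((k : ℤ) + 1 : ℤ) : ℂ) = ((n : ℤ) : ℂ) := by rw [hk]
    simpa using this

theorem ghostLevel_b (n : ℤ) : O.ghostLevel * O.b n - O.b n * O.ghostLevel = (-n : ℂ) • O.b n := by
  rw [ghostLevel_eq, add_comm_eq (O.opSum_cb_b _ n n fun k hk => ?_)
    (O.opSum_bc_b _ n (-n) fun k hk => ?_)]
  · rcases lt_trichotomy n 0 with h | h | h
    · simp [h, h.not_gt]
    · simp [h]
    · simp [h, h.not_gt]
  · have : (((k : ℤ) + 1 : ℤ) : ℂ) = ((n : ℤ) : ℂ) := by rw [hk]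
    simpa using this
  · have : (((k : ℤ) + 1 : ℤ) : ℂ) = ((-n : ℤ) : ℂ) := by rw [hk]
    simpa using this

theorem ghostLevel_α (μ : Fin 26) (n : ℤ) :
    O.ghostLevel * O.α μ n - O.α μ n * O.ghostLevel = 0 :=
  opSum_comm_eq_zero O.locFin_ghostLevel fun k => by
    rw [smul_comm_eq _ (add_comm_eq (mul_comm_of_comm (O.c_α _ _ _) (O.b_α _ _ _))
      (mul_comm_of_comm (O.b_α _ _ _) (O.c_α _ _ _))), add_zero, smul_zero]

/-- The commutator of a product of two bosonic modes with a bosonic mode. -/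
theorem α_mul_α_comm (μ ν : Fin 26) (i j m : ℤ) :
    O.α μ i * O.α μ j * O.α ν m - O.α ν m * (O.α μ i * O.α μ j) =
      (if μ = ν ∧ j + m = 0 then (j : ℂ) * eta μ else 0) • O.α μ i +
        (if μ = ν ∧ i + m = 0 then (i : ℂ) * eta μ else 0) • O.α μ j := by
  linear_combination (norm := skip) O.α μ i * O.α_comm μ ν j m + O.α_comm μ ν i m * O.α μ j
  simp only [mul_sub, sub_mul, mul_assoc, smul_mul_assoc, mul_smul_comm, mul_one, one_mul]
  module

theorem sum_comm_single {A : Fin 26 → Module.End ℂ V} {x X : Module.End ℂ V} (ν : Fin 26)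
    (h0 : ∀ μ, μ ≠ ν → A μ * x - x * A μ = 0) (h : A ν * x - x * A ν = X) :
    (∑ μ, A μ) * x - x * (∑ μ, A μ) = X := by
  rw [Finset.sum_mul, Finset.mul_sum, ← Finset.sum_sub_distrib, ← h]
  exact Finset.sum_eq_single ν (fun μ _ hμ => h0 μ hμ) (fun h => absurd (Finset.mem_univ ν) h)

theorem eta_smul_smul (ν : Fin 26) (z : ℂ) (X : Module.End ℂ V) :
    eta ν • (z * eta ν) • X = z • X := by
  rw [smul_smul, mul_left_comm, eta_mul_eta, mul_one]

theorem matterLevel_α (ν : Fin 26) (n : ℤ) :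
    O.matterLevel * O.α ν n - O.α ν n * O.matterLevel = (-n : ℂ) • O.α ν n := by
  rw [matterLevel, opSum_comm_mode O.locFin_matterLevel (X := (-n : ℂ) • O.α ν n)
    (Y := (-n : ℂ) • O.α ν n) n]
  · rcases lt_trichotomy n 0 with h | h | h
    · simp [h, h.not_gt]
    · simp [h]
    · simp [h, h.not_gt]
  · intro k
    refine sum_comm_single ν (fun μ hμ => ?_) ?_
    · rw [smul_comm_eq _ (O.α_mul_α_comm μ ν _ _ _)]
      simp [hμ]
    · rw [smul_comm_eq _ (O.α_mul_α_comm ν ν _ _ _)]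
      simp only [true_and]
      by_cases h1 : (k : ℤ) + 1 = n
      · subst h1
        rw [if_neg (by omega), if_pos (by omega), if_pos rfl, if_neg (by omega), zero_smul,
          zero_add, eta_smul_smul]
        push_cast; module
      · by_cases h2 : (k : ℤ) + 1 = -n
        · obtain rfl : n = -((k : ℤ) + 1) := by omega
          rw [if_pos (by omega), if_neg (by omega), if_neg h1, if_pos (by omega), zero_smul,
            add_zero, eta_smul_smul]
          push_cast; module
        · rw [if_neg (by omega), if_neg (by omega), if_neg h1, if_neg h2]
          simp

theorem matterLevel_c (n : ℤ) : O.matterLevel * O.c n - O.c n * O.matterLevel = 0 :=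
  opSum_comm_eq_zero O.locFin_matterLevel fun k => sum_comm_eq_zero fun μ _ => by
    rw [smul_comm_eq _ (mul_comm_of_comm (O.α_c _ _ _) (O.α_c _ _ _)), smul_zero]

theorem matterLevel_b (n : ℤ) : O.matterLevel * O.b n - O.b n * O.matterLevel = 0 :=
  opSum_comm_eq_zero O.locFin_matterLevel fun k => sum_comm_eq_zero fun μ _ => by
    rw [smul_comm_eq _ (mul_comm_of_comm (O.α_b _ _ _) (O.α_b _ _ _)), smul_zero]

theorem level_α (μ : Fin 26) (n : ℤ) : Graded O.level (-n) (O.α μ n) := by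
  unfold Graded
  rw [level, add_comm_eq (O.matterLevel_α μ n) (O.ghostLevel_α μ n), add_zero]

theorem level_c (n : ℤ) : Graded O.level (-n) (O.c n) := by
  unfold Graded
  rw [level, add_comm_eq (O.matterLevel_c n) (O.ghostLevel_c n), zero_add]

theorem level_b (n : ℤ) : Graded O.level (-n) (O.b n) := by
  unfold Graded
  rw [level, add_comm_eq (O.matterLevel_b n) (O.ghostLevel_b n), zero_add]

theorem isNumberOp_matterLevel : O.IsNumberOp O.matterLevel := fun v hv =>
  opSum_apply_eq_zero O.locFin_matterLevel fun k => by
    rw [LinearMap.sum_apply]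
    refine Finset.sum_eq_zero fun μ _ => ?_
    rw [LinearMap.smul_apply, Module.End.mul_apply, (hv _ (by omega)).1 μ, map_zero, smul_zero]

theorem isNumberOp_level : O.IsNumberOp O.level := fun v hv => by
  rw [level, LinearMap.add_apply, O.isNumberOp_matterLevel v hv, zero_add]
  refine opSum_apply_eq_zero O.locFin_ghostLevel fun k => ?_
  have h := hv ((k : ℤ) + 1) (by omega)
  simp [h.2.1, h.2.2]

/-- The normal ordered product `:α_i^μ α_j^μ:`. -/
def αα (μ : Fin 26) (i j : ℤ) : Module.End ℂ V :=
  if i ≤ j then O.α μ i * O.α μ j else O.α μ j * O.α μ i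

/-- The matter Virasoro operator `L_n^(m)`. -/
noncomputable def L (n : ℤ) : Module.End ℂ V :=
  opSum fun k : ℤ => (1 / 2 : ℂ) • ∑ μ : Fin 26, eta μ • O.αα μ (n - k) k

theorem αα_apply_eq_zero {v : V} {R : ℕ} (hR : O.KilledAbove v R) (μ : Fin 26) {i j : ℤ}
    (h : R < i ∨ R < j) : O.αα μ i j v = 0 := by
  unfold αα
  split_ifs with hij
  · rw [Module.End.mul_apply, (hR j (by omega)).1 μ, map_zero]
  · rw [Module.End.mul_apply, (hR i (by omega)).1 μ, map_zero]

theorem locFin_L (n : ℤ) :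
    LocFin fun k : ℤ => (1 / 2 : ℂ) • ∑ μ : Fin 26, eta μ • O.αα μ (n - k) k := by
  refine O.locFin_of_killedAbove fun v R hR =>
    ⟨Set.Icc (n - R) R, Set.finite_Icc _ _, fun k hk => ?_⟩
  have hk : R < n - k ∨ R < k := by
    by_contra h
    exact hk ⟨by omega, by omega⟩
  rw [LinearMap.smul_apply, LinearMap.sum_apply, Finset.sum_eq_zero, smul_zero]
  intro μ _
  rw [LinearMap.smul_apply, O.αα_apply_eq_zero hR μ hk, smul_zero]

theorem L_apply_eq_zero {v : V} {R : ℕ} (hR : O.KilledAbove v R) {n : ℤ} (h : 2 * R < n) :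
    O.L n v = 0 :=
  opSum_apply_eq_zero (O.locFin_L n) fun k => by
    rw [LinearMap.smul_apply, LinearMap.sum_apply, Finset.sum_eq_zero, smul_zero]
    intro μ _
    rw [LinearMap.smul_apply, O.αα_apply_eq_zero hR μ (by omega), smul_zero]

theorem αα_comm (μ ν : Fin 26) (i j m : ℤ) :
    O.αα μ i j * O.α ν m - O.α ν m * O.αα μ i j =
      (if μ = ν ∧ j + m = 0 then (j : ℂ) * eta μ else 0) • O.α μ i +
        (if μ = ν ∧ i + m = 0 then (i : ℂ) * eta μ else 0) • O.α μ j := by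
  by_cases hij : i ≤ j
  · simp only [αα, if_pos hij]
    exact O.α_mul_α_comm μ ν i j m
  · simp only [αα, if_neg hij]
    rw [O.α_mul_α_comm μ ν j i m, add_comm]

theorem αα_comm_eq_zero (μ : Fin 26) (i j : ℤ) {x : Module.End ℂ V}
    (hx : ∀ n, O.α μ n * x - x * O.α μ n = 0) : O.αα μ i j * x - x * O.αα μ i j = 0 := by
  unfold αα
  split_ifs
  · exact mul_comm_of_comm (hx _) (hx _)
  · exact mul_comm_of_comm (hx _) (hx _)

theorem L_comm_eq_zero (n : ℤ) {x : Module.End ℂ V}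
    (hx : ∀ μ n, O.α μ n * x - x * O.α μ n = 0) : O.L n * x - x * O.L n = 0 :=
  opSum_comm_eq_zero (O.locFin_L n) fun k => by
    rw [smul_comm_eq _ (sum_comm_eq_zero fun μ _ => ?_), smul_zero]
    rw [smul_comm_eq _ (O.αα_comm_eq_zero μ _ _ (hx μ)), smul_zero]

theorem L_c (n m : ℤ) : O.L n * O.c m - O.c m * O.L n = 0 :=
  O.L_comm_eq_zero n fun μ k => O.α_c μ k m

theorem L_b (n m : ℤ) : O.L n * O.b m - O.b m * O.L n = 0 :=
  O.L_comm_eq_zero n fun μ k => O.α_b μ k m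

theorem L_α (n : ℤ) (ν : Fin 26) (m : ℤ) :
    O.L n * O.α ν m - O.α ν m * O.L n = (-m : ℂ) • O.α ν (n + m) := by
  rw [L, opSum_comm (O.locFin_L n)]
  have h : ∀ k : ℤ, ((1 / 2 : ℂ) • ∑ μ : Fin 26, eta μ • O.αα μ (n - k) k) * O.α ν m -
      O.α ν m * ((1 / 2 : ℂ) • ∑ μ : Fin 26, eta μ • O.αα μ (n - k) k) =
      (if k = -m then (-m / 2 : ℂ) • O.α ν (n + m) else 0) +
        (if k = n + m then (-m / 2 : ℂ) • O.α ν (n + m) else 0) := by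
    intro k
    have hs := sum_comm_single (A := fun μ => eta μ • O.αα μ (n - k) k) (x := O.α ν m) ν
      (fun μ hμ => by rw [smul_comm_eq _ (O.αα_comm μ ν _ _ _)]; simp [hμ])
      (smul_comm_eq _ (O.αα_comm ν ν _ _ _))
    simp only [true_and] at hs
    have e1 : (if k + m = 0 then (k : ℂ) * eta ν else 0) • O.α ν (n - k) =
        if k = -m then (-m * eta ν : ℂ) • O.α ν (n + m) else 0 := by
      by_cases h : k = -m
      · subst h; simp
      · rw [if_neg h, if_neg (by omega), zero_smul]
    have e2 : (if n - k + m = 0 then ((n - k : ℤ) : ℂ) * eta ν else 0) • O.α ν k =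
        if k = n + m then (-m * eta ν : ℂ) • O.α ν (n + m) else 0 := by
      by_cases h : k = n + m
      · subst h; simp
      · rw [if_neg h, if_neg (by omega), zero_smul]
    rw [smul_comm_eq (1 / 2) hs, e1, e2, smul_add (eta ν), smul_ite, smul_ite, eta_smul_smul,
      smul_zero]
    split_ifs <;> module
  simp only [h]
  rw [opSum_add (locFin_single _ (fun _ => _)) (locFin_single _ (fun _ => _)),
    opSum_single _ (fun _ => _), opSum_single _ (fun _ => _)]
  module

theorem αα_graded {D : Module.End ℂ V} {w : ℤ → ℂ} (hD : ∀ μ n, Graded D (w n) (O.α μ n))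
    (μ : Fin 26) (i j : ℤ) : Graded D (w i + w j) (O.αα μ i j) := by
  unfold αα
  split_ifs
  · exact (hD _ _).mul (hD _ _)
  · exact ((hD _ _).mul (hD _ _)).congr (add_comm _ _)

theorem level_L (n : ℤ) : Graded O.level (-n) (O.L n) :=
  Graded.opSum (O.locFin_L n) fun k => Graded.smul _ <| Graded.sum fun μ _ => Graded.smul _ <|
    (O.αα_graded O.level_α μ (n - k) k).congr (by push_cast; ring)

theorem ghostNumber_L (n : ℤ) : Graded O.ghostNumber 0 (O.L n) :=
  Graded.opSum (O.locFin_L n) fun k => Graded.smul _ <| Graded.sum fun μ _ => Graded.smul _ <|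
    (O.αα_graded O.ghostNumber_α μ (n - k) k).congr (add_zero _)

/-- The contribution `½ α_0 · α_0 = α′ p²` of the zero modes to `L_0`. -/
noncomputable def halfMomentumSq : ℂ := 1 / 2 * ∑ μ : Fin 26, eta μ * (O.a μ * O.a μ)

theorem L_zero_vac : O.L 0 O.vac = O.halfMomentumSq • O.vac := by
  have hR : O.KilledAbove O.vac 0 := fun k hk => O.annihilated_vac k hk
  rw [L, opSum_apply (O.locFin_L 0), finsum_eq_single _ 0]
  · simp only [sub_zero, αα, le_refl, if_true, α_zero, smul_mul_assoc, one_mul, smul_smul,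
      LinearMap.smul_apply, Module.End.one_apply, ← Finset.sum_smul,
      halfMomentumSq]
  · intro k hk
    rw [LinearMap.smul_apply, LinearMap.sum_apply, Finset.sum_eq_zero, smul_zero]
    intro μ _
    rw [LinearMap.smul_apply, O.αα_apply_eq_zero hR μ, smul_zero]
    push_cast
    omega

theorem L_zero : O.L 0 = O.matterLevel + O.halfMomentumSq • (1 : Module.End ℂ V) := by
  rw [← sub_eq_zero]
  refine O.eq_zero_of_vac 1 ?_ (fun μ n _ => ?_) (fun n _ => ?_) (fun n _ => ?_)
  · simp [L_zero_vac, O.isNumberOp_matterLevel _ O.annihilated_vac]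
  · have h := O.L_α 0 μ n
    rw [zero_add] at h
    linear_combination (norm := skip) h - O.matterLevel_α μ n
    simp only [sub_mul, add_mul, mul_add, mul_sub, smul_mul_assoc, mul_smul_comm, one_mul, mul_one]
    module
  · linear_combination (norm := skip) O.L_c 0 n - O.matterLevel_c n
    simp only [sub_mul, add_mul, mul_add, mul_sub, smul_mul_assoc, mul_smul_comm, one_mul, mul_one]
    module
  · linear_combination (norm := skip) O.L_b 0 n - O.matterLevel_b n
    simp only [sub_mul, add_mul, mul_add, mul_sub, smul_mul_assoc, mul_smul_comm, one_mul, mul_one]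
    module

/-- `L_0 = L_0^(m) + N^(g) - 1`. -/
noncomputable def L0 : Module.End ℂ V := O.L 0 + (O.ghostLevel - 1)

/-- The value `α′ p² - 1` of `L_0` on the vacuum. -/
noncomputable def intercept : ℂ := O.halfMomentumSq - 1

theorem L0_eq : O.L0 = O.level + O.intercept • (1 : Module.End ℂ V) := by
  rw [L0, L_zero, level, intercept]
  module

theorem Graded.L0 {w : ℂ} {T : Module.End ℂ V} (h : Graded O.level w T) : Graded O.L0 w T := by
  unfold Graded at *
  rw [L0_eq, ← h]
  simp only [add_mul, mul_add, smul_mul_assoc, mul_smul_comm, one_mul, mul_one]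
  abel

theorem level_M : Graded O.level 0 O.M :=
  Graded.opSum (O.locFin_cc _) fun k => Graded.smul _ <|
    ((O.level_c _).mul (O.level_c _)).congr (by push_cast; ring)

/-! ### The operator `Q̃` -/

/-- The ghost mode `c_n` with the zero mode removed. -/
noncomputable def ct (n : ℤ) : Module.End ℂ V := if n = 0 then 0 else O.c n

/-- The anti-ghost mode `b_n` with the zero mode removed. -/
noncomputable def bt (n : ℤ) : Module.End ℂ V := if n = 0 then 0 else O.b n

theorem ct_zero : O.ct 0 = 0 := if_pos rfl

theorem ct_of_ne {n : ℤ} (h : n ≠ 0) : O.ct n = O.c n := if_neg h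

theorem bt_of_ne {n : ℤ} (h : n ≠ 0) : O.bt n = O.b n := if_neg h

theorem ct_c (m n : ℤ) : O.ct m * O.c n + O.c n * O.ct m = 0 := by
  unfold ct; split_ifs
  · simp
  · exact O.c_acomm m n

theorem ct_α (μ : Fin 26) (m n : ℤ) : O.ct m * O.α μ n - O.α μ n * O.ct m = 0 := by
  unfold ct; split_ifs
  · simp
  · exact O.c_α μ m n

theorem bt_α (μ : Fin 26) (m n : ℤ) : O.bt m * O.α μ n - O.α μ n * O.bt m = 0 := by
  unfold bt; split_ifs
  · simp
  · exact O.b_α μ m n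

theorem bt_b (m n : ℤ) : O.bt m * O.b n + O.b n * O.bt m = 0 := by
  unfold bt; split_ifs
  · simp
  · exact O.b_acomm m n

theorem ct_b (m : ℤ) {n : ℤ} (hn : n ≠ 0) : O.ct m * O.b n + O.b n * O.ct m =
    (if m + n = 0 then (1 : ℂ) else 0) • (1 : Module.End ℂ V) := by
  unfold ct; split_ifs
  · omega
  · simp
  · rw [O.c_b, if_pos ‹_›]
  · rw [O.c_b, if_neg ‹_›]

theorem ct_b_zero (m : ℤ) : O.ct m * O.b 0 + O.b 0 * O.ct m = 0 := by
  unfold ct; split_ifs with h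
  · simp
  · rw [O.c_b, if_neg (by omega), zero_smul]

theorem bt_c (m n : ℤ) : O.bt m * O.c n + O.c n * O.bt m =
    (if m + n = 0 ∧ m ≠ 0 then (1 : ℂ) else 0) • (1 : Module.End ℂ V) := by
  unfold bt
  by_cases hm : m = 0
  · simp [hm]
  · simp only [hm, if_false, ne_eq, not_false_eq_true, and_true, O.b_c]

theorem ct_ct (m n : ℤ) : O.ct m * O.ct n + O.ct n * O.ct m = 0 := by
  by_cases h : n = 0
  · simp [h, ct_zero]
  · rw [O.ct_of_ne h, O.ct_c]

theorem ct_bt {m n : ℤ} (h : m + n ≠ 0) : O.ct m * O.bt n + O.bt n * O.ct m = 0 := by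
  by_cases hm : m = 0
  · simp [hm, ct_zero]
  · rw [O.ct_of_ne hm, add_comm, O.bt_c, if_neg (by omega), zero_smul]

/-- The normal ordered product `:c_i c_j b_k:`. -/
def ccb (i j k : ℤ) : Module.End ℂ V :=
  if 0 < k then O.c i * O.c j * O.b k else O.b k * O.c i * O.c j

/-- The part of the BRST operator without ghost zero modes. -/
noncomputable def Qt : Module.End ℂ V :=
  (opSum fun n : ℤ => if n ≠ 0 then O.c (-n) * O.L n else 0) -
  (1 / 2 : ℂ) • opSum fun q : ℤ × ℤ =>
    if q.1 * q.2 ≠ 0 ∧ q.1 + q.2 ≠ 0 then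
      ((q.1 : ℂ) - q.2) • O.ccb (-q.1) (-q.2) (q.1 + q.2)
    else 0

/-- The matter terms of `Q̃`. -/
noncomputable def matterTerm (n : ℤ) : Module.End ℂ V := O.ct (-n) * O.L n

/-- The ghost terms of `Q̃`. Once the zero modes are removed, the three factors anticommute, so that
no normal ordering is needed. -/
noncomputable def ghostTerm (q : ℤ × ℤ) : Module.End ℂ V :=
  ((q.1 : ℂ) - q.2) • (O.ct (-q.1) * O.ct (-q.2) * O.bt (q.1 + q.2))

theorem Qt_eq : O.Qt = opSum O.matterTerm - (1 / 2 : ℂ) • opSum O.ghostTerm := by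
  unfold Qt
  congr 2
  · funext n
    by_cases h : n = 0
    · simp [h, matterTerm, ct_zero]
    · rw [if_pos h, matterTerm, O.ct_of_ne (by omega)]
  · congr 1
    funext q
    obtain ⟨m, k⟩ := q
    simp only [ghostTerm]
    by_cases h : m * k ≠ 0 ∧ m + k ≠ 0
    · have hm : m ≠ 0 := left_ne_zero_of_mul h.1
      have hk : k ≠ 0 := right_ne_zero_of_mul h.1
      rw [if_pos h, O.ct_of_ne (neg_ne_zero.2 hm), O.ct_of_ne (neg_ne_zero.2 hk),
        O.bt_of_ne h.2, ccb]
      split_ifs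
      · rfl
      · have h1 := O.b_c (m + k) (-m)
        have h2 := O.b_c (m + k) (-k)
        rw [if_neg (by omega), zero_smul] at h1 h2
        congr 1
        linear_combination (norm := skip) h1 * O.c (-k) - O.c (-m) * h2
        simp only [mul_add, add_mul, mul_assoc, mul_zero, zero_mul]
        module
    · rw [if_neg h]
      rw [not_and_or, not_not, not_not, mul_eq_zero] at h
      rcases h with (h | h) | h <;> simp [h, ct, bt]

theorem ct_apply_eq_zero {v : V} {R : ℕ} (hR : O.KilledAbove v R) {n : ℤ} (h : R < n) :
    O.ct n v = 0 := by
  rw [O.ct_of_ne (by omega), (hR n h).2.1]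

theorem locFin_matterTerm : LocFin O.matterTerm := by
  refine O.locFin_of_killedAbove fun v R hR =>
    ⟨Set.Icc (-R) (2 * R), Set.finite_Icc _ _, fun n hn => ?_⟩
  have hn : R < -n ∨ 2 * R < n := by
    by_contra h
    exact hn ⟨by omega, by omega⟩
  rw [matterTerm, Module.End.mul_apply]
  rcases hn with h | h
  · rw [O.ct_of_ne (by omega)]
    simpa [(hR _ h).2.1] using (apply_of_comm (O.L_c n (-n)) v).symm
  · rw [O.L_apply_eq_zero hR h, map_zero]

theorem locFin_ghostTerm : LocFin O.ghostTerm := by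
  refine O.locFin_of_killedAbove fun v R hR =>
    ⟨Set.Icc (-R : ℤ) (2 * R) ×ˢ Set.Icc (-R : ℤ) (2 * R),
      (Set.finite_Icc _ _).prod (Set.finite_Icc _ _), fun q hq => ?_⟩
  obtain ⟨m, k⟩ := q
  have hn : R < -m ∨ R < -k ∨ R < m + k := by
    by_contra h
    exact hq ⟨⟨by omega, by omega⟩, ⟨by omega, by omega⟩⟩
  simp only [ghostTerm]
  by_cases hm : m = 0
  · simp [hm, ct_zero]
  by_cases hk : k = 0
  · simp [hk, ct_zero]
  -- each of the three factors can be moved to the right, up to a sign, to act first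
  have h1 := O.ct_ct (-m) (-k)
  have h2 := O.ct_bt (m := -m) (n := m + k) (by omega)
  have h3 := O.ct_bt (m := -k) (n := m + k) (by omega)
  have e1 : O.ct (-m) * O.ct (-k) * O.bt (m + k) = -(O.ct (-m) * O.bt (m + k) * O.ct (-k)) := by
    linear_combination (norm := skip) O.ct (-m) * h3
    simp only [mul_add, mul_assoc, mul_zero]
    module
  have e2 : O.ct (-m) * O.ct (-k) * O.bt (m + k) = O.ct (-k) * O.bt (m + k) * O.ct (-m) := by
    linear_combination (norm := skip) h1 * O.bt (m + k) - O.ct (-k) * h2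
    simp only [mul_add, add_mul, mul_assoc, mul_zero, zero_mul]
    module
  rcases hn with h | h | h
  · rw [e2, LinearMap.smul_apply, Module.End.mul_apply, O.ct_apply_eq_zero hR h, map_zero,
      smul_zero]
  · rw [e1, LinearMap.smul_apply, LinearMap.neg_apply, Module.End.mul_apply,
      O.ct_apply_eq_zero hR h, map_zero, neg_zero, smul_zero]
  · rw [LinearMap.smul_apply, Module.End.mul_apply, O.bt_of_ne (by omega), (hR _ h).2.2, map_zero,
      smul_zero]

theorem Qt_comm (x : Module.End ℂ V) : O.Qt * x - x * O.Qt =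
    opSum (fun k => O.matterTerm k * x - x * O.matterTerm k) -
      (1 / 2 : ℂ) • opSum (fun q => O.ghostTerm q * x - x * O.ghostTerm q) := by
  rw [Qt_eq, ← opSum_comm O.locFin_matterTerm, ← opSum_comm O.locFin_ghostTerm]
  simp only [mul_sub, sub_mul, smul_mul_assoc, mul_smul_comm]
  module

theorem Qt_acomm (x : Module.End ℂ V) : O.Qt * x + x * O.Qt =
    opSum (fun k => O.matterTerm k * x + x * O.matterTerm k) -
      (1 / 2 : ℂ) • opSum (fun q => O.ghostTerm q * x + x * O.ghostTerm q) := by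
  rw [Qt_eq, ← opSum_acomm O.locFin_matterTerm, ← opSum_acomm O.locFin_ghostTerm]
  simp only [mul_sub, sub_mul, smul_mul_assoc, mul_smul_comm]
  module

theorem graded_Qt {D : Module.End ℂ V} {w : ℂ} (h1 : ∀ n, Graded D w (O.matterTerm n))
    (h2 : ∀ q, Graded D w (O.ghostTerm q)) : Graded D w O.Qt := by
  rw [Qt_eq]
  exact (Graded.opSum O.locFin_matterTerm h1).sub ((Graded.opSum O.locFin_ghostTerm h2).smul _)

theorem level_ct (n : ℤ) : Graded O.level (-n) (O.ct n) := by
  unfold ct; split_ifs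
  · exact Graded.zero
  · exact O.level_c n

theorem level_bt (n : ℤ) : Graded O.level (-n) (O.bt n) := by
  unfold bt; split_ifs
  · exact Graded.zero
  · exact O.level_b n

theorem ghostNumber_ct (n : ℤ) : Graded O.ghostNumber 1 (O.ct n) := by
  unfold ct; split_ifs with h
  · exact Graded.zero
  · exact O.ghostNumber_c h

theorem ghostNumber_bt (n : ℤ) : Graded O.ghostNumber (-1) (O.bt n) := by
  unfold bt; split_ifs with h
  · exact Graded.zero
  · exact O.ghostNumber_b h

theorem level_Qt : Graded O.level 0 O.Qt :=
  O.graded_Qt (fun n => ((O.level_ct _).mul (O.level_L n)).congr (by push_cast; ring))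
    fun q => (((O.level_ct _).mul (O.level_ct _)).mul (O.level_bt _)).smul _ |>.congr
      (by push_cast; ring)

theorem ghostNumber_Qt : Graded O.ghostNumber 1 O.Qt :=
  O.graded_Qt (fun n => ((O.ghostNumber_ct _).mul (O.ghostNumber_L n)).congr (by ring))
    fun q => (((O.ghostNumber_ct _).mul (O.ghostNumber_ct _)).mul (O.ghostNumber_bt _)).smul _
      |>.congr (by ring)

/-- An odd operator that commutes with the matter modes and anticommutes with the ghost modes other
than `b_0`, `c_0` anticommutes with `Q̃`. -/
theorem Qt_acomm_eq_zero {x : Module.End ℂ V} (hα : ∀ μ n, O.α μ n * x - x * O.α μ n = 0)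
    (hc : ∀ n, O.ct n * x + x * O.ct n = 0) (hb : ∀ n, O.bt n * x + x * O.bt n = 0) :
    O.Qt * x + x * O.Qt = 0 := by
  rw [Qt_eq]
  have h1 : opSum O.matterTerm * x + x * opSum O.matterTerm = 0 :=
    opSum_acomm_eq_zero O.locFin_matterTerm fun n => by
      unfold matterTerm
      linear_combination (norm := skip) O.ct (-n) * O.L_comm_eq_zero n hα + hc (-n) * O.L n
      simp only [mul_sub, add_mul, mul_assoc, mul_zero, zero_mul]
      module
  have h2 : opSum O.ghostTerm * x + x * opSum O.ghostTerm = 0 :=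
    opSum_acomm_eq_zero O.locFin_ghostTerm fun q => by
      unfold ghostTerm
      linear_combination (norm := skip) ((q.1 : ℂ) - q.2) •
        (O.ct (-q.1) * O.ct (-q.2) * hb (q.1 + q.2) - O.ct (-q.1) * hc (-q.2) * O.bt (q.1 + q.2)
          + hc (-q.1) * O.ct (-q.2) * O.bt (q.1 + q.2))
      simp only [mul_add, add_mul, mul_assoc, smul_mul_assoc, mul_smul_comm, mul_zero, zero_mul]
      module
  linear_combination (norm := skip) h1 - (1 / 2 : ℂ) • h2
  simp only [mul_sub, sub_mul, smul_mul_assoc, mul_smul_comm]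
  module

theorem Qt_c_zero : O.Qt * O.c 0 + O.c 0 * O.Qt = 0 :=
  O.Qt_acomm_eq_zero (fun μ n => O.α_c μ n 0) (fun n => O.ct_c n 0) fun n => by
    rw [O.bt_c, if_neg (by omega), zero_smul]

theorem Qt_b_zero : O.Qt * O.b 0 + O.b 0 * O.Qt = 0 :=
  O.Qt_acomm_eq_zero (fun μ n => O.α_b μ n 0) O.ct_b_zero fun n => O.bt_b n 0

/-! ### Commutators of `Q̃` with the modes -/

/-- The BRST variation `[Q̃, α_n^μ]`. -/
noncomputable def dα (μ : Fin 26) (n : ℤ) : Module.End ℂ V := O.Qt * O.α μ n - O.α μ n * O.Qt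

/-- The BRST variation `{Q̃, c_n}`. -/
noncomputable def dc (n : ℤ) : Module.End ℂ V := O.Qt * O.c n + O.c n * O.Qt

/-- The BRST variation `{Q̃, b_n}`; for `n ≠ 0` this is the total Virasoro operator without its
ghost zero modes. -/
noncomputable def db (n : ℤ) : Module.End ℂ V := O.Qt * O.b n + O.b n * O.Qt

theorem matterTerm_α (μ : Fin 26) (k n : ℤ) :
    O.matterTerm k * O.α μ n - O.α μ n * O.matterTerm k =
      (-n : ℂ) • (O.ct (-k) * O.α μ (k + n)) := by
  unfold matterTerm
  linear_combination (norm := skip) O.ct (-k) * O.L_α k μ n + O.ct_α μ (-k) n * O.L k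
  simp only [mul_sub, sub_mul, mul_assoc, zero_mul, mul_smul_comm]
  module

theorem ghostTerm_α (μ : Fin 26) (q : ℤ × ℤ) (n : ℤ) :
    O.ghostTerm q * O.α μ n - O.α μ n * O.ghostTerm q = 0 := by
  unfold ghostTerm
  rw [smul_comm_eq _ (mul_comm_of_comm (mul_comm_of_comm (O.ct_α _ _ _) (O.ct_α _ _ _))
    (O.bt_α _ _ _)), smul_zero]

theorem locFin_dα (μ : Fin 26) (n : ℤ) :
    LocFin fun k => (-n : ℂ) • (O.ct (-k) * O.α μ (k + n)) := by
  simp only [← matterTerm_α]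
  exact O.locFin_matterTerm.comm _

theorem dα_eq (μ : Fin 26) (n : ℤ) :
    O.dα μ n = opSum fun k => (-n : ℂ) • (O.ct (-k) * O.α μ (k + n)) := by
  rw [dα, Qt_comm]
  simp only [ghostTerm_α, matterTerm_α]
  rw [opSum_zero, smul_zero, sub_zero]

theorem dα_comm_eq_zero (μ : Fin 26) (n : ℤ) {x : Module.End ℂ V}
    (hc : ∀ k, O.ct k * x - x * O.ct k = 0) (hα : ∀ k, O.α μ k * x - x * O.α μ k = 0) :
    O.dα μ n * x - x * O.dα μ n = 0 := by
  rw [dα_eq]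
  exact opSum_comm_eq_zero (O.locFin_dα μ n) fun k => by
    rw [smul_comm_eq _ (mul_comm_of_comm (hc _) (hα _)), smul_zero]

theorem dα_α (μ ν : Fin 26) (n m : ℤ) : O.dα μ n * O.α ν m - O.α ν m * O.dα μ n =
    (if μ = ν then (n * m : ℂ) * eta μ else 0) • O.ct (n + m) := by
  rw [dα_eq, opSum_comm (O.locFin_dα μ n)]
  have h : ∀ k : ℤ, ((-n : ℂ) • (O.ct (-k) * O.α μ (k + n))) * O.α ν m -
      O.α ν m * ((-n : ℂ) • (O.ct (-k) * O.α μ (k + n))) =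
      if k = -n - m then (if μ = ν then (n * m : ℂ) * eta μ else 0) • O.ct (n + m) else 0 := by
    intro k
    have e : O.ct (-k) * O.α μ (k + n) * O.α ν m - O.α ν m * (O.ct (-k) * O.α μ (k + n)) =
        (if μ = ν ∧ k + n + m = 0 then ((k + n : ℤ) : ℂ) * eta μ else 0) • O.ct (-k) := by
      linear_combination (norm := skip) O.ct (-k) * O.α_comm μ ν (k + n) m
        + O.ct_α ν (-k) m * O.α μ (k + n)
      simp only [mul_sub, sub_mul, mul_assoc, zero_mul, mul_smul_comm, mul_one]
      module
    rw [smul_comm_eq _ e]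
    by_cases hk : k = -n - m
    · subst hk
      by_cases hμ : μ = ν
      · rw [if_pos ⟨hμ, by ring⟩, if_pos rfl, if_pos hμ, show -(-n - m) = n + m by ring]
        push_cast; module
      · rw [if_neg (fun h => hμ h.1), if_pos rfl, if_neg hμ]; simp
    · rw [if_neg (by omega), if_neg hk]; simp
  simp only [h]
  exact opSum_single _ (fun _ => _)

theorem dα_c (μ : Fin 26) (n m : ℤ) : O.dα μ n * O.c m + O.c m * O.dα μ n = 0 := by
  rw [dα_eq]
  exact opSum_acomm_eq_zero (O.locFin_dα μ n) fun k => by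
    linear_combination (norm := skip) (-n : ℂ) •
      (O.ct (-k) * O.α_c μ (k + n) m + O.ct_c (-k) m * O.α μ (k + n))
    simp only [mul_sub, add_mul, mul_assoc, mul_zero, zero_mul, mul_smul_comm, smul_mul_assoc]
    module

theorem dα_b (μ : Fin 26) (n : ℤ) {m : ℤ} (hm : m ≠ 0) :
    O.dα μ n * O.b m + O.b m * O.dα μ n = (-n : ℂ) • O.α μ (n + m) := by
  rw [dα_eq, opSum_acomm (O.locFin_dα μ n)]
  have h : ∀ k : ℤ, ((-n : ℂ) • (O.ct (-k) * O.α μ (k + n))) * O.b m +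
      O.b m * ((-n : ℂ) • (O.ct (-k) * O.α μ (k + n))) =
      if k = m then (-n : ℂ) • O.α μ (n + m) else 0 := by
    intro k
    have e : O.ct (-k) * O.α μ (k + n) * O.b m + O.b m * (O.ct (-k) * O.α μ (k + n)) =
        (if -k + m = 0 then (1 : ℂ) else 0) • O.α μ (k + n) := by
      linear_combination (norm := skip) O.ct (-k) * O.α_b μ (k + n) m
        + O.ct_b (-k) hm * O.α μ (k + n)
      simp only [mul_sub, add_mul, mul_assoc, mul_zero, smul_mul_assoc, one_mul]
      module
    rw [smul_mul_assoc, mul_smul_comm, ← smul_add, e]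
    by_cases hk : k = m
    · subst hk
      simp [add_comm]
    · rw [if_neg (by omega), if_neg hk]; simp
  simp only [h]
  exact opSum_single _ (fun _ => _)

theorem matterTerm_c (k n : ℤ) : O.matterTerm k * O.c n + O.c n * O.matterTerm k = 0 := by
  unfold matterTerm
  linear_combination (norm := skip) O.ct (-k) * O.L_c k n + O.ct_c (-k) n * O.L k
  simp only [mul_sub, add_mul, mul_assoc, mul_zero, zero_mul]
  module

theorem ghostTerm_c (q : ℤ × ℤ) (n : ℤ) : O.ghostTerm q * O.c n + O.c n * O.ghostTerm q =
    (((q.1 : ℂ) - q.2) * (if q.1 + q.2 + n = 0 ∧ q.1 + q.2 ≠ 0 then 1 else 0)) •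
      (O.ct (-q.1) * O.ct (-q.2)) := by
  unfold ghostTerm
  linear_combination (norm := skip) ((q.1 : ℂ) - q.2) •
    (O.ct (-q.1) * O.ct (-q.2) * O.bt_c (q.1 + q.2) n
      - O.ct (-q.1) * O.ct_c (-q.2) n * O.bt (q.1 + q.2)
      + O.ct_c (-q.1) n * O.ct (-q.2) * O.bt (q.1 + q.2))
  simp only [mul_add, add_mul, mul_assoc, mul_zero, zero_mul, smul_mul_assoc, mul_smul_comm,
    mul_one]
  module

theorem locFin_dc (n : ℤ) : LocFin fun q : ℤ × ℤ =>
    (((q.1 : ℂ) - q.2) * (if q.1 + q.2 + n = 0 ∧ q.1 + q.2 ≠ 0 then 1 else 0)) •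
      (O.ct (-q.1) * O.ct (-q.2)) := by
  simp only [← ghostTerm_c]
  exact O.locFin_ghostTerm.acomm _

theorem dc_eq (n : ℤ) : O.dc n = (-(1 / 2) : ℂ) • opSum fun q : ℤ × ℤ =>
    (((q.1 : ℂ) - q.2) * (if q.1 + q.2 + n = 0 ∧ q.1 + q.2 ≠ 0 then 1 else 0)) •
      (O.ct (-q.1) * O.ct (-q.2)) := by
  rw [dc, Qt_acomm]
  simp only [ghostTerm_c, matterTerm_c]
  rw [opSum_zero, zero_sub, neg_smul]

theorem dc_zero : O.dc 0 = 0 := O.Qt_c_zero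

theorem dc_comm_eq_zero (n : ℤ) {x : Module.End ℂ V}
    (hc : ∀ k l, O.ct k * O.ct l * x - x * (O.ct k * O.ct l) = 0) :
    O.dc n * x - x * O.dc n = 0 := by
  rw [dc_eq, smul_comm_eq _ (opSum_comm_eq_zero (O.locFin_dc n) fun q => ?_), smul_zero]
  rw [smul_comm_eq _ (hc _ _), smul_zero]

theorem dc_c (n m : ℤ) : O.dc n * O.c m - O.c m * O.dc n = 0 :=
  O.dc_comm_eq_zero n fun k l => by
    rw [mul_comm_of_acomm (β := 0) (γ := 0) (by rw [O.ct_c, zero_smul])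
      (by rw [O.ct_c, zero_smul])]
    simp

theorem dc_α (n : ℤ) (μ : Fin 26) (m : ℤ) : O.dc n * O.α μ m - O.α μ m * O.dc n = 0 :=
  O.dc_comm_eq_zero n fun _ _ => mul_comm_of_comm (O.ct_α _ _ _) (O.ct_α _ _ _)

theorem comm_ct_of_c {X : Module.End ℂ V} (h : ∀ m, X * O.c m - O.c m * X = 0) (m : ℤ) :
    O.ct m * X - X * O.ct m = 0 := by
  unfold ct; split_ifs
  · simp
  · rw [← neg_sub, h, neg_zero]

theorem dα_dc (μ : Fin 26) (n m : ℤ) : O.dα μ n * O.dc m - O.dc m * O.dα μ n = 0 :=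
  O.dα_comm_eq_zero μ n (O.comm_ct_of_c (O.dc_c m)) fun k => by
    rw [← neg_sub, O.dc_α, neg_zero]

theorem dα_M (μ : Fin 26) (n : ℤ) : O.dα μ n * O.M - O.M * O.dα μ n = 0 :=
  O.dα_comm_eq_zero μ n (O.comm_ct_of_c O.M_c) fun k => by
    rw [← neg_sub, O.M_α, neg_zero]

theorem dc_dc (n m : ℤ) : O.dc n * O.dc m - O.dc m * O.dc n = 0 :=
  O.dc_comm_eq_zero n fun _ _ => mul_comm_of_comm (O.comm_ct_of_c (O.dc_c m) _)
    (O.comm_ct_of_c (O.dc_c m) _)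

theorem dc_M (n : ℤ) : O.dc n * O.M - O.M * O.dc n = 0 :=
  O.dc_comm_eq_zero n fun _ _ => mul_comm_of_comm (O.comm_ct_of_c O.M_c _)
    (O.comm_ct_of_c O.M_c _)

theorem dc_b {n m : ℤ} (hn : n ≠ 0) (hm : m ≠ 0) :
    O.dc n * O.b m - O.b m * O.dc n = (n + 2 * m : ℂ) • O.ct (n + m) := by
  rw [dc_eq, smul_comm_eq _ (opSum_comm (O.locFin_dc n) _)]
  have h : ∀ q : ℤ × ℤ,
      ((((q.1 : ℂ) - q.2) * (if q.1 + q.2 + n = 0 ∧ q.1 + q.2 ≠ 0 then 1 else 0)) •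
        (O.ct (-q.1) * O.ct (-q.2))) * O.b m - O.b m *
      ((((q.1 : ℂ) - q.2) * (if q.1 + q.2 + n = 0 ∧ q.1 + q.2 ≠ 0 then 1 else 0)) •
        (O.ct (-q.1) * O.ct (-q.2))) =
      (if q = (-n - m, m) then (-n - 2 * m : ℂ) • O.ct (n + m) else 0) -
        (if q = (m, -n - m) then (n + 2 * m : ℂ) • O.ct (n + m) else 0) := by
    rintro ⟨i, j⟩
    rw [smul_comm_eq _ (mul_comm_of_acomm (O.ct_b _ hm) (O.ct_b _ hm))]
    simp only [Prod.mk.injEq]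
    by_cases hij : i + j + n = 0
    · obtain rfl : j = -n - i := by omega
      rw [if_pos (by omega), smul_sub]
      congr 1
      · by_cases hi : i = -n - m
        · subst hi
          rw [if_pos (by omega), if_pos (by omega), show -(-n - m) = n + m by ring]
          push_cast; module
        · rw [if_neg (by omega), if_neg (by omega)]; simp
      · by_cases hi : i = m
        · subst hi
          rw [if_pos (by omega), if_pos (by omega), show -(-n - i) = n + i by ring]
          push_cast; module
        · rw [if_neg (by omega), if_neg (by omega)]; simp
    · rw [if_neg (fun h => hij h.1), mul_zero, zero_smul, if_neg (by omega), if_neg (by omega),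
        sub_zero]
  simp only [h]
  rw [opSum_sub (locFin_single _ (fun _ => _)) (locFin_single _ (fun _ => _)),
    opSum_single _ (fun _ => _), opSum_single _ (fun _ => _)]
  module

theorem ghostNumber_dα (μ : Fin 26) (n : ℤ) : Graded O.ghostNumber 1 (O.dα μ n) :=
  (O.ghostNumber_Qt.comm (O.ghostNumber_α μ n)).congr (by ring)

theorem ghostNumber_dc (n : ℤ) : Graded O.ghostNumber 2 (O.dc n) := by
  by_cases h : n = 0
  · rw [h, dc_zero]; exact Graded.zero
  · exact (O.ghostNumber_Qt.acomm (O.ghostNumber_c h)).congr (by ring)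

theorem ghostNumber_db {n : ℤ} (h : n ≠ 0) : Graded O.ghostNumber 0 (O.db n) :=
  (O.ghostNumber_Qt.acomm (O.ghostNumber_b h)).congr (by ring)

theorem level_db (n : ℤ) : Graded O.level (-n) (O.db n) :=
  (O.level_Qt.acomm (O.level_b n)).congr (by ring)

/-- The variation `{Q̃, b_n}` acts on the matter modes as the Virasoro operator `L_n`. -/
theorem db_α {n : ℤ} (hn : n ≠ 0) (μ : Fin 26) (m : ℤ) :
    O.db n * O.α μ m - O.α μ m * O.db n = (-m : ℂ) • O.α μ (m + n) := by
  rw [← O.dα_b μ m hn, dα, db]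
  linear_combination (norm := skip) O.Qt * O.b_α μ n m + O.b_α μ n m * O.Qt
  simp only [mul_sub, sub_mul, mul_add, add_mul, mul_assoc, mul_zero, zero_mul]
  module

theorem db_c_eq (n m : ℤ) : O.db n * O.c m - O.c m * O.db n =
    -(O.dc m * O.b n - O.b n * O.dc m) := by
  rw [dc, db]
  linear_combination (norm := skip) O.Qt * O.b_c n m - O.b_c n m * O.Qt
  simp only [mul_add, add_mul, mul_assoc, mul_smul_comm, smul_mul_assoc, mul_one,
    one_mul]
  module

theorem db_c {n m : ℤ} (hn : n ≠ 0) (hm : m ≠ 0) : O.db n * O.c m - O.c m * O.db n =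
    (-(m + 2 * n) : ℂ) • O.ct (m + n) := by
  rw [db_c_eq, O.dc_b hm hn, neg_smul]

theorem db_c_zero (n : ℤ) : O.db n * O.c 0 - O.c 0 * O.db n = 0 := by
  rw [db_c_eq, dc_zero]; simp

/-- The commutator `[{Q̃, b_n}, b_m]` is linear in the `b` modes, so it anticommutes with all of them.
This is read off from the defining sum of `Q̃`; the value in `db_b` then follows from commutators with
the other modes. -/
theorem db_b_b {n m : ℤ} (hn : n ≠ 0) (hm : m ≠ 0) (l : ℤ) :
    (O.db n * O.b m - O.b m * O.db n) * O.b l + O.b l * (O.db n * O.b m - O.b m * O.db n) = 0 := by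
  have h1 : ∀ k, O.matterTerm k * O.b n + O.b n * O.matterTerm k =
      (if -k + n = 0 then (1 : ℂ) else 0) • O.L k := fun k => by
    unfold matterTerm
    linear_combination (norm := skip) O.ct (-k) * O.L_b k n + O.ct_b (-k) hn * O.L k
    simp only [mul_sub, add_mul, mul_assoc, mul_zero, smul_mul_assoc, one_mul]
    module
  have h2 : ∀ q : ℤ × ℤ, O.ghostTerm q * O.b n + O.b n * O.ghostTerm q = ((q.1 : ℂ) - q.2) •
      ((if -q.1 + n = 0 then (1 : ℂ) else 0) • (O.ct (-q.2) * O.bt (q.1 + q.2)) -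
        (if -q.2 + n = 0 then (1 : ℂ) else 0) • (O.ct (-q.1) * O.bt (q.1 + q.2))) := fun q => by
    unfold ghostTerm
    linear_combination (norm := skip) ((q.1 : ℂ) - q.2) •
      (O.ct (-q.1) * O.ct (-q.2) * O.bt_b (q.1 + q.2) n
        - O.ct (-q.1) * O.ct_b (-q.2) hn * O.bt (q.1 + q.2)
        + O.ct_b (-q.1) hn * O.ct (-q.2) * O.bt (q.1 + q.2))
    simp only [mul_add, add_mul, mul_assoc, mul_zero, smul_mul_assoc, mul_smul_comm,
      mul_one, one_mul]
    module
  have h3 : ∀ i j, O.ct i * O.bt j * O.b m - O.b m * (O.ct i * O.bt j) =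
      (-(if i + m = 0 then (1 : ℂ) else 0)) • O.bt j := fun i j => by
    rw [mul_comm_of_acomm (β := 0) (by rw [O.bt_b, zero_smul]) (O.ct_b i hm)]
    module
  have h4 : ∀ q : ℤ × ℤ, ∃ z : ℂ, (O.ghostTerm q * O.b n + O.b n * O.ghostTerm q) * O.b m -
      O.b m * (O.ghostTerm q * O.b n + O.b n * O.ghostTerm q) = z • O.bt (q.1 + q.2) := fun q => by
    have e := smul_comm_eq ((q.1 : ℂ) - q.2) (sub_comm_eq
      (smul_comm_eq (if -q.1 + n = 0 then (1 : ℂ) else 0) (h3 (-q.2) (q.1 + q.2)))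
      (smul_comm_eq (if -q.2 + n = 0 then (1 : ℂ) else 0) (h3 (-q.1) (q.1 + q.2))))
    rw [smul_smul, smul_smul, ← sub_smul, smul_smul, ← h2] at e
    exact ⟨_, e⟩
  have h5 : O.db n * O.b m - O.b m * O.db n = (-(1 / 2) : ℂ) • opSum fun q =>
      (O.ghostTerm q * O.b n + O.b n * O.ghostTerm q) * O.b m -
      O.b m * (O.ghostTerm q * O.b n + O.b n * O.ghostTerm q) := by
    rw [db, Qt_acomm, sub_comm_eq (opSum_comm_eq_zero (O.locFin_matterTerm.acomm _) fun k => ?_)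
      (smul_comm_eq _ (opSum_comm (O.locFin_ghostTerm.acomm _) _)), zero_sub, neg_smul]
    rw [h1, smul_comm_eq _ (O.L_b _ _), smul_zero]
  rw [h5, smul_mul_assoc, mul_smul_comm, ← smul_add,
    opSum_acomm_eq_zero ((O.locFin_ghostTerm.acomm _).comm _), smul_zero]
  intro q
  obtain ⟨z, hz⟩ := h4 q
  rw [hz, smul_mul_assoc, mul_smul_comm, ← smul_add, O.bt_b, smul_zero]

/-- The modes `b_m` transform as a field of conformal weight `2`. -/
theorem db_b {n m : ℤ} (hn : n ≠ 0) (hm : m ≠ 0) :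
    O.db n * O.b m - O.b m * O.db n = (n - m : ℂ) • O.bt (n + m) := by
  rw [← sub_eq_zero]
  refine O.eq_zero_of_acomm O.isNumberOp_ghostNumber (w := -1) (by norm_num) ?_ (fun μ l => ?_)
    (fun l => ?_) (fun l _ => ?_)
  · exact (((O.ghostNumber_db hn).comm (O.ghostNumber_b hm)).congr (by ring)).sub
      ((O.ghostNumber_bt _).smul _)
  · linear_combination (norm := skip) O.db n * O.b_α μ m l + O.db_α hn μ l * O.b m
      - O.b m * O.db_α hn μ l - O.b_α μ m l * O.db n - (n - m : ℂ) • O.bt_α μ (n + m) l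
      + (l : ℂ) • O.b_α μ m (l + n)
    simp only [mul_sub, sub_mul, mul_assoc, mul_zero, zero_mul, smul_mul_assoc, mul_smul_comm]
    module
  · by_cases hl : l = 0
    · subst hl
      have h1 := O.bt_c (n + m) 0
      have h2 := O.b_c m 0
      rw [if_neg (by omega), zero_smul] at h1 h2
      linear_combination (norm := skip) O.db n * h2 - O.db_c_zero n * O.b m
        - O.b m * O.db_c_zero n - h2 * O.db n - (n - m : ℂ) • h1
      simp only [mul_sub, sub_mul, mul_add, add_mul, mul_assoc, mul_zero, zero_mul, smul_mul_assoc,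
        mul_smul_comm]
      module
    · have h1 := O.bt_c (n + m) l
      have h2 := O.b_c m l
      have h3 := O.ct_b (l + n) hm
      have h4 : ((n - m : ℂ) * if n + m + l = 0 ∧ n + m ≠ 0 then (1 : ℂ) else 0) =
          (l + 2 * n : ℂ) * if l + n + m = 0 then (1 : ℂ) else 0 := by
        by_cases h : l + n + m = 0
        · rw [if_pos h, if_pos (by omega)]
          obtain rfl : l = -n - m := by omega
          push_cast; ring
        · rw [if_neg h, if_neg (by omega), mul_zero, mul_zero]
      have h5 := congrArg (fun z : ℂ => z • (1 : Module.End ℂ V)) h4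
      simp only [mul_smul] at h5
      linear_combination (norm := skip) O.db n * h2 - O.db_c hn hl * O.b m
        - O.b m * O.db_c hn hl - h2 * O.db n - (n - m : ℂ) • h1 + (l + 2 * n : ℂ) • h3 - h5
      simp only [mul_sub, sub_mul, mul_add, add_mul, mul_assoc, mul_one, one_mul, smul_mul_assoc,
        mul_smul_comm]
      module
  · linear_combination (norm := skip) O.db_b_b hn hm l - (n - m : ℂ) • O.bt_b (n + m) l
    simp only [mul_sub, sub_mul, mul_assoc, smul_mul_assoc, mul_smul_comm]
    module

/-! ### Second variations -/

theorem Qt_ct (k : ℤ) : O.Qt * O.ct k + O.ct k * O.Qt = O.dc k := by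
  by_cases h : k = 0
  · rw [h, ct_zero, dc_zero]; simp
  · rw [O.ct_of_ne h, dc]

theorem M_bt (k : ℤ) : O.M * O.bt k - O.bt k * O.M = (2 * k : ℂ) • O.ct k := by
  by_cases h : k = 0
  · simp [h, bt]
  · rw [O.ct_of_ne h, O.bt_of_ne h, O.M_b]

theorem dα_ct (μ : Fin 26) (n k : ℤ) : O.dα μ n * O.ct k + O.ct k * O.dα μ n = 0 := by
  unfold ct; split_ifs
  · simp
  · exact O.dα_c μ n k

theorem db_ct {m : ℤ} (hm : m ≠ 0) (k : ℤ) : O.db m * O.ct k - O.ct k * O.db m =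
    (if k = 0 then 0 else -(k + 2 * m : ℂ)) • O.ct (k + m) := by
  by_cases h : k = 0
  · simp [h, ct_zero]
  · rw [if_neg h, O.ct_of_ne h, O.db_c hm h]

theorem db_c' {m : ℤ} (hm : m ≠ 0) (k : ℤ) : O.db m * O.c k - O.c k * O.db m =
    (if k = 0 then 0 else -(k + 2 * m : ℂ)) • O.ct (k + m) := by
  by_cases h : k = 0
  · rw [h, O.db_c_zero]; simp
  · rw [if_neg h, O.db_c hm h]

theorem dα_bt (μ : Fin 26) (n k : ℤ) : O.dα μ n * O.bt k + O.bt k * O.dα μ n =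
    (if k = 0 then 0 else -n : ℂ) • O.α μ (n + k) := by
  by_cases h : k = 0
  · simp [h, bt]
  · rw [if_neg h, O.bt_of_ne h, O.dα_b μ n h]

theorem dc_bt {n : ℤ} (hn : n ≠ 0) (k : ℤ) : O.dc n * O.bt k - O.bt k * O.dc n =
    (if k = 0 then 0 else n + 2 * k : ℂ) • O.ct (n + k) := by
  by_cases h : k = 0
  · simp [h, bt]
  · rw [if_neg h, O.bt_of_ne h, O.dc_b hn h]

theorem db_bt {n : ℤ} (hn : n ≠ 0) (k : ℤ) : O.db n * O.bt k - O.bt k * O.db n =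
    (if k = 0 then 0 else n - k : ℂ) • O.bt (n + k) := by
  by_cases h : k = 0
  · simp [h, bt]
  · rw [if_neg h, O.bt_of_ne h, O.db_b hn h]

theorem db_M {n : ℤ} (hn : n ≠ 0) : O.db n * O.M - O.M * O.db n = (-2 * n : ℂ) • O.dc n := by
  rw [← sub_eq_zero]
  refine O.eq_zero_of_comm O.isNumberOp_ghostNumber (w := 2) (by norm_num) ?_ (fun μ l => ?_)
    (fun l => ?_) (fun l hl => ?_)
  · exact (((O.ghostNumber_db hn).comm O.ghostNumber_M).congr (by ring)).sub
      ((O.ghostNumber_dc n).smul _)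
  · linear_combination (norm := skip) O.db n * O.M_α μ l + O.db_α hn μ l * O.M
      - O.M * O.db_α hn μ l - O.M_α μ l * O.db n - (l : ℂ) • (-O.M_α μ (l + n))
      - (-2 * n : ℂ) • O.dc_α n μ l
    simp only [mul_sub, sub_mul, mul_assoc, mul_zero, zero_mul, smul_mul_assoc,
      mul_smul_comm]
    module
  · have h := O.db_c' hn l
    linear_combination (norm := skip) O.db n * O.M_c l + h * O.M - O.M * h - O.M_c l * O.db n
      - (-2 * n : ℂ) • O.dc_c n l
      + (if l = 0 then 0 else -(l + 2 * n : ℂ)) • O.comm_ct_of_c O.M_c (l + n)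
    simp only [mul_sub, sub_mul, mul_assoc, mul_zero, zero_mul, smul_mul_assoc,
      mul_smul_comm]
    module
  · have h := O.db_c hn hl
    rw [add_comm l n] at h
    have h' := O.M_bt (n + l)
    push_cast at h'
    linear_combination (norm := skip) O.db n * O.M_b l + O.db_b hn hl * O.M - O.M * O.db_b hn hl
      - O.M_b l * O.db n - (-2 * n : ℂ) • O.dc_b hn hl + (2 * l : ℂ) • h - (n - l : ℂ) • h'
    simp only [mul_sub, sub_mul, mul_add, mul_assoc, smul_mul_assoc,
      mul_smul_comm]
    module

/-- Together with `Qt_Qt` this is the nilpotency of the BRST operator. -/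
theorem Qt_M : O.Qt * O.M - O.M * O.Qt = 0 := by
  refine O.eq_zero_of_acomm O.isNumberOp_ghostNumber (w := 3) (by norm_num) ?_ (fun μ l => ?_)
    (fun l => ?_) (fun l hl => ?_)
  · exact (O.ghostNumber_Qt.comm O.ghostNumber_M).congr (by norm_num)
  · have h := O.dα_M μ l
    rw [dα] at h
    linear_combination (norm := skip) O.Qt * O.M_α μ l + h - O.M_α μ l * O.Qt
    simp only [mul_sub, sub_mul, mul_assoc, mul_zero, zero_mul]
    module
  · have h := O.dc_M l
    rw [dc] at h
    linear_combination (norm := skip) O.Qt * O.M_c l + h + O.M_c l * O.Qt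
    simp only [mul_sub, sub_mul, mul_add, add_mul, mul_assoc, mul_zero, zero_mul]
    module
  · have h := O.db_M hl
    rw [db, dc] at h
    linear_combination (norm := skip) O.Qt * O.M_b l + h + O.M_b l * O.Qt
    simp only [mul_sub, sub_mul, mul_add, add_mul, mul_assoc, smul_mul_assoc, mul_smul_comm]
    module

/-- The bilinear `½ ∑_{i+j=k} (i - j) c_i c_j` without ghost zero modes. It is the variation of
`c_k` under `Q̃` for `k ≠ 0`, and `M` for `k = 0`. -/
noncomputable def cc (k : ℤ) : Module.End ℂ V := O.dc k + if k = 0 then O.M else 0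

theorem cc_α (k : ℤ) (μ : Fin 26) (n : ℤ) : O.cc k * O.α μ n - O.α μ n * O.cc k = 0 := by
  unfold cc; split_ifs
  · rw [add_comm_eq (O.dc_α _ _ _) (O.M_α _ _), add_zero]
  · rw [add_zero, O.dc_α]

theorem cc_c (k n : ℤ) : O.cc k * O.c n - O.c n * O.cc k = 0 := by
  unfold cc; split_ifs
  · rw [add_comm_eq (O.dc_c _ _) (O.M_c _), add_zero]
  · rw [add_zero, O.dc_c]

theorem cc_b (k : ℤ) {n : ℤ} (hn : n ≠ 0) :
    O.cc k * O.b n - O.b n * O.cc k = (k + 2 * n : ℂ) • O.ct (k + n) := by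
  unfold cc
  by_cases hk : k = 0
  · subst hk
    rw [if_pos rfl, dc_zero, zero_add, O.M_b, zero_add, O.ct_of_ne hn]
    simp
  · rw [if_neg hk, add_zero, O.dc_b hk hn]

theorem ghostNumber_cc (k : ℤ) : Graded O.ghostNumber 2 (O.cc k) := by
  unfold cc; split_ifs
  · exact (O.ghostNumber_dc k).add O.ghostNumber_M
  · exact (O.ghostNumber_dc k).add Graded.zero

/-- The (anti-)commutators of two variations are determined, like the first variations, by their
commutators with the modes. -/
theorem dα_dα (μ ν : Fin 26) (n m : ℤ) : O.dα μ n * O.dα ν m + O.dα ν m * O.dα μ n =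
    -((if μ = ν then (n * m : ℂ) * eta μ else 0) • O.cc (n + m)) := by
  rw [← sub_eq_zero]
  refine O.eq_zero_of_comm O.isNumberOp_ghostNumber (w := 2) (by norm_num) ?_ (fun ρ l => ?_)
    (fun l => ?_) (fun l hl => ?_)
  · rw [sub_neg_eq_add]
    exact (((O.ghostNumber_dα μ n).acomm (O.ghostNumber_dα ν m)).congr (by norm_num)).add
      ((O.ghostNumber_cc _).smul _)
  · have h1 := O.dα_α μ ρ n l
    have h2 := O.dα_α ν ρ m l
    linear_combination (norm := skip) O.dα μ n * h2 + h1 * O.dα ν m + O.dα ν m * h1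
      + h2 * O.dα μ n
      + (if μ = ρ then (n * l : ℂ) * eta μ else 0) • O.dα_ct ν m (n + l)
      + (if ν = ρ then (m * l : ℂ) * eta ν else 0) • O.dα_ct μ n (m + l)
      + (if μ = ν then (n * m : ℂ) * eta μ else 0) • O.cc_α (n + m) ρ l
    simp only [mul_sub, sub_mul, mul_add, add_mul, mul_assoc, smul_mul_assoc, mul_smul_comm, neg_mul,
      mul_neg]
    module
  · linear_combination (norm := skip) O.dα μ n * O.dα_c ν m l - O.dα_c μ n l * O.dα ν m
      + O.dα ν m * O.dα_c μ n l - O.dα_c ν m l * O.dα μ n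
      + (if μ = ν then (n * m : ℂ) * eta μ else 0) • O.cc_c (n + m) l
    simp only [mul_sub, sub_mul, mul_add, add_mul, mul_assoc, smul_mul_assoc, mul_smul_comm, neg_mul,
      mul_neg, mul_zero, zero_mul]
    module
  · have h1 := O.dα_b μ n hl
    have h2 := O.dα_b ν m hl
    have h3 := O.dα_α μ ν n (m + l)
    have h4 := O.dα_α ν μ m (n + l)
    have h5 := O.cc_b (n + m) hl
    rw [show n + (m + l) = n + m + l by ring] at h3
    rw [show m + (n + l) = n + m + l by ring] at h4
    by_cases hμ : μ = ν
    · subst hμ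
      simp only [if_true] at h3 h4 ⊢
      push_cast at h3 h4 h5
      linear_combination (norm := skip) O.dα μ n * h2 - h1 * O.dα μ m + O.dα μ m * h1
        - h2 * O.dα μ n - (m : ℂ) • h3 - (n : ℂ) • h4 + ((n * m : ℂ) * eta μ) • h5
      simp only [mul_sub, sub_mul, mul_add, add_mul, mul_assoc, smul_mul_assoc, mul_smul_comm,
        neg_mul, mul_neg]
      module
    · rw [if_neg hμ] at h3 ⊢
      rw [if_neg (Ne.symm hμ)] at h4
      linear_combination (norm := skip) O.dα μ n * h2 - h1 * O.dα ν m + O.dα ν m * h1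
        - h2 * O.dα μ n - (m : ℂ) • h3 - (n : ℂ) • h4
      simp only [mul_sub, sub_mul, mul_add, add_mul, mul_assoc, smul_mul_assoc, mul_smul_comm,
        neg_mul, mul_neg]
      module

theorem dα_db (μ : Fin 26) (n : ℤ) {m : ℤ} (hm : m ≠ 0) :
    O.dα μ n * O.db m - O.db m * O.dα μ n =
      (n : ℂ) • O.dα μ (n + m) + (2 * n * m : ℂ) • (O.α μ n * O.c m) := by
  rw [← sub_eq_zero]
  refine O.eq_zero_of_acomm O.isNumberOp_ghostNumber (w := 1) (by norm_num) ?_ (fun ν l => ?_)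
    (fun l => ?_) (fun l hl => ?_)
  · exact (((O.ghostNumber_dα μ n).comm (O.ghostNumber_db hm)).congr (by ring)).sub
      (((O.ghostNumber_dα μ _).smul _).add
      ((((O.ghostNumber_α μ n).mul (O.ghostNumber_c hm)).congr (by ring)).smul _))
  · have h1 := O.dα_α μ ν n l
    have h2 := O.db_α hm ν l
    have h3 := O.dα_α μ ν n (l + m)
    have h4 := O.dα_α μ ν (n + m) l
    have h5 := O.db_ct hm (n + l)
    have h6 := O.α_comm μ ν n l
    have h7 := O.α_c ν l m
    rw [show n + (l + m) = n + l + m by ring] at h3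
    rw [show n + m + l = n + l + m by ring] at h4
    push_cast at h3 h4 h5
    have key : (if μ = ν then (n * l : ℂ) * eta μ else 0) •
          (if n + l = 0 then 0 else -(n + l + 2 * m : ℂ)) • O.ct (n + l + m) +
        (l : ℂ) • (if μ = ν then (n * (l + m) : ℂ) * eta μ else 0) • O.ct (n + l + m) +
        (n : ℂ) • (if μ = ν then ((n + m) * l : ℂ) * eta μ else 0) • O.ct (n + l + m) +
        (2 * n * m : ℂ) • (if μ = ν ∧ n + l = 0 then (n : ℂ) * eta μ else 0) • O.c m = 0 := by
      by_cases hμ : μ = ν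
      · by_cases hl : n + l = 0
        · obtain rfl : l = -n := by omega
          rw [add_neg_cancel, zero_add, O.ct_of_ne hm]
          simp only [hμ, true_and, if_true]
          push_cast; module
        · simp only [hμ, hl, if_true, if_false, and_false]
          module
      · simp [hμ]
    linear_combination (norm := skip) O.dα μ n * h2 + h1 * O.db m - O.db m * h1 - h2 * O.dα μ n
      - (l : ℂ) • h3 - (n : ℂ) • h4 - (if μ = ν then (n * l : ℂ) * eta μ else 0) • h5
      - (2 * n * m : ℂ) • (h6 * O.c m - O.α μ n * h7) - key
    simp only [mul_sub, sub_mul, mul_add, add_mul, mul_assoc, smul_mul_assoc, mul_smul_comm,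
      one_mul, mul_zero]
    module
  · have h := O.db_c' hm l
    linear_combination (norm := skip) O.dα μ n * h + O.dα_c μ n l * O.db m - O.db m * O.dα_c μ n l
      + h * O.dα μ n - (n : ℂ) • O.dα_c μ (n + m) l
      - (2 * n * m : ℂ) • (O.α μ n * O.c_acomm m l - O.α_c μ n l * O.c m)
      + (if l = 0 then 0 else -(l + 2 * m : ℂ)) • O.dα_ct μ n (l + m)
    simp only [mul_sub, sub_mul, mul_add, add_mul, mul_assoc, smul_mul_assoc, mul_smul_comm,
      mul_zero, zero_mul]
    module
  · have h1 := O.dα_b μ n hl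
    have h2 := O.db_b hm hl
    have h3 := O.db_α hm μ (n + l)
    have h4 := O.dα_bt μ n (m + l)
    have h5 := O.dα_b μ (n + m) hl
    have h6 := O.c_b m l
    rw [show n + l + m = n + m + l by ring] at h3
    rw [show n + (m + l) = n + m + l by ring] at h4
    push_cast at h3 h4 h5
    have key : (n : ℂ) • (-(n + l) : ℂ) • O.α μ (n + m + l) +
        (m - l : ℂ) • (if m + l = 0 then 0 else -n : ℂ) • O.α μ (n + m + l) -
        (n : ℂ) • (-(n + m) : ℂ) • O.α μ (n + m + l) -
        (2 * n * m : ℂ) • (if m + l = 0 then (1 : ℂ) else 0) • O.α μ n = 0 := by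
      by_cases h : m + l = 0
      · obtain rfl : l = -m := by omega
        rw [show n + m + -m = n by ring]
        simp only [add_neg_cancel, if_true]
        push_cast; module
      · simp only [h, if_false]
        module
    linear_combination (norm := skip) O.dα μ n * h2 + h1 * O.db m - O.db m * h1 + h2 * O.dα μ n
      + (n : ℂ) • h3 + (m - l : ℂ) • h4 - (n : ℂ) • h5
      - (2 * n * m : ℂ) • (O.α μ n * h6 - O.α_b μ n l * O.c m) + key
    simp only [mul_sub, sub_mul, mul_add, add_mul, mul_assoc, smul_mul_assoc, mul_smul_comm,
      mul_one, zero_mul]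
    module

theorem db_dc {n m : ℤ} (hn : n ≠ 0) (hm : m ≠ 0) : O.db m * O.dc n - O.dc n * O.db m =
    (2 * n * m : ℂ) • (O.c n * O.c m) - (n + 2 * m : ℂ) • O.cc (n + m) := by
  rw [← sub_eq_zero]
  refine O.eq_zero_of_comm O.isNumberOp_ghostNumber (w := 2) (by norm_num) ?_ (fun μ l => ?_)
    (fun l => ?_) (fun l hl => ?_)
  · exact (((O.ghostNumber_db hm).comm (O.ghostNumber_dc n)).congr (by ring)).sub
      (((((O.ghostNumber_c hn).mul (O.ghostNumber_c hm)).congr (by norm_num)).smul _).sub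
      ((O.ghostNumber_cc _).smul _))
  · have h1 := O.db_α hm μ l
    linear_combination (norm := skip) O.db m * O.dc_α n μ l + h1 * O.dc n - O.dc n * h1
      - O.dc_α n μ l * O.db m + (l : ℂ) • O.dc_α n μ (l + m)
      + (n + 2 * m : ℂ) • O.cc_α (n + m) μ l
      - (2 * n * m : ℂ) • (O.c n * O.c_α μ m l + O.c_α μ n l * O.c m)
    simp only [mul_sub, sub_mul, mul_assoc, smul_mul_assoc, mul_smul_comm, mul_zero, zero_mul]
    module
  · have h := O.db_c' hm l
    linear_combination (norm := skip) O.db m * O.dc_c n l + h * O.dc n - O.dc n * h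
      - O.dc_c n l * O.db m
      + (if l = 0 then 0 else -(l + 2 * m : ℂ)) • O.comm_ct_of_c (O.dc_c n) (l + m)
      + (n + 2 * m : ℂ) • O.cc_c (n + m) l
      - (2 * n * m : ℂ) • (O.c n * O.c_acomm m l - O.c_acomm n l * O.c m)
    simp only [mul_sub, sub_mul, mul_add, add_mul, mul_assoc, smul_mul_assoc, mul_smul_comm,
      mul_zero, zero_mul]
    module
  · have h1 := O.db_b hm hl
    have h2 := O.dc_b hn hl
    have h3 := O.dc_bt hn (m + l)
    have h4 := O.db_ct hm (n + l)
    have h5 := O.cc_b (n + m) hl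
    have h6 := O.c_b m l
    have h7 := O.c_b n l
    rw [show n + (m + l) = n + m + l by ring] at h3
    rw [show n + l + m = n + m + l by ring] at h4
    push_cast at h3 h4 h5
    have key : (-(m - l) : ℂ) • (if m + l = 0 then 0 else n + 2 * (m + l) : ℂ) • O.ct (n + m + l) +
        (n + 2 * l : ℂ) • (if n + l = 0 then 0 else -(n + l + 2 * m) : ℂ) • O.ct (n + m + l) +
        (n + 2 * m : ℂ) • (n + m + 2 * l : ℂ) • O.ct (n + m + l) -
        (2 * n * m : ℂ) • ((if m + l = 0 then (1 : ℂ) else 0) • O.c n -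
          (if n + l = 0 then (1 : ℂ) else 0) • O.c m) = 0 := by
      by_cases h : m + l = 0
      · obtain rfl : m = -l := by omega
        by_cases h' : n + l = 0
        · obtain rfl : n = -l := by omega
          rw [show -l + -l + l = -l by ring, O.ct_of_ne hn]
          simp only [neg_add_cancel, if_true]
          push_cast; module
        · rw [show n + -l + l = n by ring, O.ct_of_ne hn]
          simp only [neg_add_cancel, if_true, h', if_false]
          push_cast; module
      · by_cases h' : n + l = 0
        · obtain rfl : n = -l := by omega
          rw [show -l + m + l = m by ring, O.ct_of_ne hm]
          simp only [neg_add_cancel, if_true, h, if_false]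
          push_cast; module
        · simp only [h, h', if_false]
          module
    linear_combination (norm := skip) O.db m * h2 + h1 * O.dc n - O.dc n * h1 - h2 * O.db m
      - (m - l : ℂ) • h3 + (n + 2 * l : ℂ) • h4 + (n + 2 * m : ℂ) • h5
      - (2 * n * m : ℂ) • (O.c n * h6 - h7 * O.c m) + key
    simp only [mul_sub, sub_mul, mul_add, add_mul, mul_assoc, smul_mul_assoc, mul_smul_comm,
      mul_one, one_mul]
    module

/-! ### The anomaly commutes with the matter modes and the `c` modes -/

/-- The operator `Q̃² + L_0 M`, whose vanishing is the nilpotency of the BRST operator. -/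
noncomputable def anomaly : Module.End ℂ V := O.Qt * O.Qt + O.L0 * O.M

theorem ghostNumber_L0 : Graded O.ghostNumber 0 O.L0 := by
  have h : Graded O.ghostNumber 0 O.ghostLevel :=
    Graded.opSum O.locFin_ghostLevel fun k => Graded.smul _ <|
      (((O.ghostNumber_c (by omega)).mul (O.ghostNumber_b (by omega))).congr (add_neg_cancel 1)).add
      (((O.ghostNumber_b (by omega)).mul (O.ghostNumber_c (by omega))).congr (neg_add_cancel 1))
  exact (O.ghostNumber_L 0).add (h.sub Graded.one)

theorem ghostNumber_anomaly : Graded O.ghostNumber 2 O.anomaly :=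
  ((O.ghostNumber_Qt.mul O.ghostNumber_Qt).congr (by norm_num)).add
    ((O.ghostNumber_L0.mul O.ghostNumber_M).congr (by norm_num))

theorem level_anomaly : Graded O.level 0 O.anomaly := by
  have h : Graded O.level 0 O.L0 := by
    rw [L0_eq]
    have h1 : Graded O.level 0 O.level := by simp [Graded]
    exact h1.add (Graded.one.smul _)
  exact ((O.level_Qt.mul O.level_Qt).congr (add_zero _)).add
    ((h.mul O.level_M).congr (add_zero _))

/-- By the Jacobi identity the commutator of `Q̃²` with a mode is the variation of its variation. -/
theorem anomaly_α (μ : Fin 26) (n : ℤ) : O.anomaly * O.α μ n - O.α μ n * O.anomaly = 0 := by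
  have hT : O.Qt * O.dα μ n + O.dα μ n * O.Qt - (n : ℂ) • (O.α μ n * O.M) = 0 := by
    refine O.eq_zero_of_comm O.isNumberOp_ghostNumber (w := 2) (by norm_num) ?_ (fun ν l => ?_)
      (fun l => ?_) (fun l hl => ?_)
    · exact ((O.ghostNumber_Qt.acomm (O.ghostNumber_dα μ n)).congr (by norm_num)).sub
        ((((O.ghostNumber_α μ n).mul O.ghostNumber_M).congr (by norm_num)).smul _)
    · have h1 := O.dα_α μ ν n l
      have h2 := O.dα_dα μ ν n l
      have h3 := O.Qt_ct (n + l)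
      have h4 := O.α_comm μ ν n l
      have h5 : O.Qt * O.α ν l - O.α ν l * O.Qt = O.dα ν l := rfl
      have h6 : O.cc (n + l) = O.dc (n + l) + if n + l = 0 then O.M else 0 := rfl
      have key : (if μ = ν then (n * l : ℂ) * eta μ else 0) • (if n + l = 0 then O.M else 0) +
          (n : ℂ) • (if μ = ν ∧ n + l = 0 then (n : ℂ) * eta μ else 0) • O.M = 0 := by
        by_cases hμ : μ = ν
        · by_cases h : n + l = 0
          · obtain rfl : l = -n := by omega
            simp only [hμ, add_neg_cancel, and_self, if_true]
            push_cast; module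
          · simp [h]
        · simp [hμ]
      linear_combination (norm := skip) O.Qt * h1 + h5 * O.dα μ n + O.dα μ n * h5 + h1 * O.Qt + h2
        + (if μ = ν then (n * l : ℂ) * eta μ else 0) • (h3 - h6)
        - (n : ℂ) • (O.α μ n * O.M_α ν l + h4 * O.M) - key
      simp only [mul_sub, sub_mul, mul_add, add_mul, mul_assoc, smul_mul_assoc, mul_smul_comm,
        one_mul, mul_zero]
      module
    · have h1 := O.dα_c μ n l
      have h2 : O.Qt * O.c l + O.c l * O.Qt = O.dc l := rfl
      linear_combination (norm := skip) O.Qt * h1 - h2 * O.dα μ n + O.dα μ n * h2 - h1 * O.Qt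
        + O.dα_dc μ n l - (n : ℂ) • (O.α μ n * O.M_c l + O.α_c μ n l * O.M)
      simp only [mul_sub, sub_mul, mul_add, add_mul, mul_assoc, mul_zero, zero_mul, smul_mul_assoc,
        mul_smul_comm]
      module
    · have h1 := O.dα_b μ n hl
      have h2 : O.Qt * O.b l + O.b l * O.Qt = O.db l := rfl
      have h3 : O.Qt * O.α μ (n + l) - O.α μ (n + l) * O.Qt = O.dα μ (n + l) := rfl
      linear_combination (norm := skip) O.Qt * h1 - h2 * O.dα μ n + O.dα μ n * h2 - h1 * O.Qt
        + O.dα_db μ n hl - (n : ℂ) • (O.α μ n * O.M_b l + O.α_b μ n l * O.M) - (n : ℂ) • h3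
      simp only [mul_sub, sub_mul, mul_add, add_mul, mul_assoc, zero_mul, smul_mul_assoc,
        mul_smul_comm]
      module
  have h0 : O.L0 * O.α μ n - O.α μ n * O.L0 = (-n : ℂ) • O.α μ n := (O.level_α μ n).L0
  unfold dα at hT
  unfold anomaly
  linear_combination (norm := skip) hT + O.L0 * O.M_α μ n + h0 * O.M
  simp only [mul_sub, sub_mul, mul_add, add_mul, mul_assoc, mul_zero, smul_mul_assoc]
  module

theorem anomaly_c (n : ℤ) : O.anomaly * O.c n - O.c n * O.anomaly = 0 := by
  have hT : O.Qt * O.dc n - O.dc n * O.Qt - (n : ℂ) • (O.c n * O.M) = 0 := by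
    by_cases hn : n = 0
    · rw [hn, dc_zero]; simp
    refine O.eq_zero_of_acomm O.isNumberOp_ghostNumber (w := 3) (by norm_num) ?_ (fun ν l => ?_)
      (fun l => ?_) (fun l hl => ?_)
    · exact ((O.ghostNumber_Qt.comm (O.ghostNumber_dc n)).congr (by norm_num)).sub
        ((((O.ghostNumber_c hn).mul O.ghostNumber_M).congr (by norm_num)).smul _)
    · have h5 : O.Qt * O.α ν l - O.α ν l * O.Qt = O.dα ν l := rfl
      linear_combination (norm := skip) O.Qt * O.dc_α n ν l + h5 * O.dc n - O.dc n * h5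
        - O.dc_α n ν l * O.Qt + O.dα_dc ν l n
        - (n : ℂ) • (O.c n * O.M_α ν l + O.c_α ν n l * O.M)
      simp only [mul_sub, sub_mul, mul_assoc, smul_mul_assoc, mul_smul_comm, mul_zero, zero_mul]
      module
    · have h2 : O.Qt * O.c l + O.c l * O.Qt = O.dc l := rfl
      linear_combination (norm := skip) O.Qt * O.dc_c n l + h2 * O.dc n - O.dc n * h2
        + O.dc_c n l * O.Qt + O.dc_dc l n
        - (n : ℂ) • (O.c n * O.M_c l + O.c_acomm n l * O.M)
      simp only [mul_sub, sub_mul, mul_add, add_mul, mul_assoc, smul_mul_assoc, mul_smul_comm,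
        mul_zero, zero_mul]
      module
    · have h1 := O.dc_b hn hl
      have h2 : O.Qt * O.b l + O.b l * O.Qt = O.db l := rfl
      have h3 := O.c_b n l
      have h4 := O.Qt_ct (n + l)
      have h5 : O.cc (n + l) = O.dc (n + l) + if n + l = 0 then O.M else 0 := rfl
      have key : (n + 2 * l : ℂ) • (if n + l = 0 then O.M else 0) +
          (n : ℂ) • (if n + l = 0 then (1 : ℂ) else 0) • O.M = 0 := by
        by_cases h : n + l = 0
        · obtain rfl : l = -n := by omega
          simp only [add_neg_cancel, if_true]
          push_cast; module
        · simp [h]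
      linear_combination (norm := skip) O.Qt * h1 + h2 * O.dc n - O.dc n * h2 + h1 * O.Qt
        + O.db_dc hn hl + (n + 2 * l : ℂ) • (h4 - h5)
        - (n : ℂ) • (O.c n * O.M_b l + h3 * O.M) - key
      simp only [mul_sub, sub_mul, mul_add, add_mul, mul_assoc, smul_mul_assoc, mul_smul_comm,
        one_mul]
      module
  have h0 : O.L0 * O.c n - O.c n * O.L0 = (-n : ℂ) • O.c n := (O.level_c n).L0
  unfold dc at hT
  unfold anomaly
  linear_combination (norm := skip) hT + O.L0 * O.M_c n + h0 * O.M
  simp only [mul_sub, sub_mul, mul_add, add_mul, mul_assoc, mul_zero, smul_mul_assoc]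
  module

/-! ### The Virasoro algebra and the critical dimension -/

/-- The commutator of the anomaly with `b_n`. -/
noncomputable def anomalyB (n : ℤ) : Module.End ℂ V := O.anomaly * O.b n - O.b n * O.anomaly

/-- The anticommutator of `anomalyB n` with `b_m`; it measures the failure of the total Virasoro
operators `{Q̃, b_n}` to close. -/
noncomputable def anomalyBB (n m : ℤ) : Module.End ℂ V :=
  O.anomalyB n * O.b m + O.b m * O.anomalyB n

theorem anomalyB_α (n : ℤ) (μ : Fin 26) (l : ℤ) :
    O.anomalyB n * O.α μ l - O.α μ l * O.anomalyB n = 0 := by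
  unfold anomalyB
  linear_combination (norm := skip) O.anomaly * O.b_α μ n l + O.anomaly_α μ l * O.b n
    - O.b n * O.anomaly_α μ l - O.b_α μ n l * O.anomaly
  simp only [mul_sub, sub_mul, mul_assoc, mul_zero, zero_mul]
  module

theorem anomalyB_c (n l : ℤ) : O.anomalyB n * O.c l + O.c l * O.anomalyB n = 0 := by
  unfold anomalyB
  linear_combination (norm := skip) O.anomaly * O.b_c n l - O.anomaly_c l * O.b n
    - O.b_c n l * O.anomaly - O.b n * O.anomaly_c l
  simp only [mul_add, add_mul, mul_sub, sub_mul, mul_assoc, mul_zero, zero_mul, smul_mul_assoc,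
    mul_smul_comm, mul_one, one_mul]
  module

theorem anomalyBB_α (n m : ℤ) (μ : Fin 26) (l : ℤ) :
    O.anomalyBB n m * O.α μ l - O.α μ l * O.anomalyBB n m = 0 := by
  unfold anomalyBB
  linear_combination (norm := skip) O.anomalyB n * O.b_α μ m l + O.anomalyB_α n μ l * O.b m
    + O.b m * O.anomalyB_α n μ l + O.b_α μ m l * O.anomalyB n
  simp only [mul_add, add_mul, mul_sub, sub_mul, mul_assoc, mul_zero, zero_mul]
  module

theorem anomalyBB_c (n m l : ℤ) :
    O.anomalyBB n m * O.c l - O.c l * O.anomalyBB n m = 0 := by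
  unfold anomalyBB
  linear_combination (norm := skip) O.anomalyB n * O.b_c m l - O.anomalyB_c n l * O.b m
    + O.b m * O.anomalyB_c n l - O.b_c m l * O.anomalyB n
  simp only [mul_add, add_mul, mul_assoc, mul_zero, zero_mul, smul_mul_assoc,
    mul_smul_comm, mul_one, one_mul]
  module

theorem anomalyB_eq (n : ℤ) : O.anomalyB n = O.Qt * O.db n - O.db n * O.Qt +
    (2 * n : ℂ) • (O.L0 * O.c n) - (n : ℂ) • (O.b n * O.M) := by
  have h0 : O.L0 * O.b n - O.b n * O.L0 = (-n : ℂ) • O.b n := (O.level_b n).L0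
  unfold anomalyB anomaly db
  linear_combination (norm := skip) O.L0 * O.M_b n + h0 * O.M
  simp only [mul_add, add_mul, mul_sub, sub_mul, mul_assoc, smul_mul_assoc, mul_smul_comm]
  module

theorem anomalyBB_eq {n m : ℤ} (hn : n ≠ 0) (hm : m ≠ 0) : O.anomalyBB n m =
    (n - m : ℂ) • (if n + m = 0 then 0 else O.db (n + m)) - (O.db n * O.db m - O.db m * O.db n) +
    (2 * n * (if n + m = 0 then 1 else 0) : ℂ) • O.L0 +
    (2 * n * m : ℂ) • (O.b m * O.c n - O.b n * O.c m) := by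
  have h0 : O.L0 * O.b m - O.b m * O.L0 = (-m : ℂ) • O.b m := (O.level_b m).L0
  have h1 := O.db_b hn hm
  have h2 : O.Qt * O.b m + O.b m * O.Qt = O.db m := rfl
  have h3 : O.Qt * O.bt (n + m) + O.bt (n + m) * O.Qt =
      if n + m = 0 then 0 else O.db (n + m) := by
    split_ifs with h
    · rw [h, bt, if_pos rfl]; simp
    · rw [O.bt_of_ne h, db]
  have h4 := O.c_b n m
  rw [anomalyBB, anomalyB_eq, ← h3, mul_smul]
  linear_combination (norm := skip) O.Qt * h1 + h1 * O.Qt + h2 * O.db n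
    - O.db n * h2
    + (2 * n : ℂ) • (O.L0 * h4 - h0 * O.c n) - (n : ℂ) • (O.b n * O.M_b m + O.b_acomm n m * O.M)
  simp only [mul_add, add_mul, mul_sub, sub_mul, mul_assoc, smul_mul_assoc, mul_smul_comm, mul_one,
    zero_mul]
  module

/-- The commutator is a multiple of `b_{n+m+l}`. The cases in which one of the sums `n + m`, `n + l`,
`m + l` vanishes are exceptional, because `Q̃` contains no ghost zero modes. -/
theorem anomalyBB_b {n m : ℤ} (hn : n ≠ 0) (hm : m ≠ 0) {l : ℤ} (hl : l ≠ 0) :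
    O.anomalyBB n m * O.b l - O.b l * O.anomalyBB n m = 0 := by
  have h0 : O.L0 * O.b l - O.b l * O.L0 = (-l : ℂ) • O.b l := (O.level_b l).L0
  have h1 : (if n + m = 0 then 0 else O.db (n + m)) * O.b l -
      O.b l * (if n + m = 0 then 0 else O.db (n + m)) =
      (if n + m = 0 then 0 else (n + m - l : ℂ)) • O.bt (n + m + l) := by
    split_ifs with h
    · simp
    · rw [O.db_b h hl]; push_cast; rfl
  have h2 := O.db_b hn hl
  have h3 := O.db_b hm hl
  have h4 := O.db_bt hn (m + l)
  have h5 := O.db_bt hm (n + l)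
  rw [show n + (m + l) = n + m + l by ring] at h4
  rw [show m + (n + l) = n + m + l by ring] at h5
  push_cast at h4 h5
  have key : (n - m : ℂ) • (if n + m = 0 then 0 else (n + m - l : ℂ)) • O.bt (n + m + l) -
      ((m - l : ℂ) • (if m + l = 0 then 0 else n - (m + l) : ℂ) • O.bt (n + m + l) -
        (n - l : ℂ) • (if n + l = 0 then 0 else m - (n + l) : ℂ) • O.bt (n + m + l)) +
      (2 * n * (if n + m = 0 then 1 else 0) : ℂ) • (-l : ℂ) • O.b l +
      (2 * n * m : ℂ) • ((if n + l = 0 then (1 : ℂ) else 0) • O.b m -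
        (if m + l = 0 then (1 : ℂ) else 0) • O.b n) = 0 := by
    by_cases h : n + m = 0
    · obtain rfl : m = -n := by omega
      have e : n + -n + l = l := by ring
      simp only [e, O.bt_of_ne hl]
      by_cases h' : n + l = 0
      · obtain rfl : l = -n := by omega
        by_cases h'' : -n + -n = 0
        · omega
        · simp only [h, h'', if_true, if_false]
          push_cast; module
      · by_cases h'' : -n + l = 0
        · obtain rfl : l = n := by omega
          simp only [h, h', h'', if_true, if_false]
          push_cast; module
        · simp only [h, h', h'', if_true, if_false]
          push_cast; module
    · by_cases h' : n + l = 0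
      · obtain rfl : n = -l := by omega
        have e : -l + m + l = m := by ring
        simp only [e, O.bt_of_ne hm]
        by_cases h'' : m + l = 0
        · obtain rfl : m = -l := by omega
          simp only [h, h', if_true, if_false]
          push_cast; module
        · simp only [h, h', h'', if_true, if_false]
          push_cast; module
      · by_cases h'' : m + l = 0
        · obtain rfl : m = -l := by omega
          have e : n + -l + l = n := by ring
          simp only [e, O.bt_of_ne hn]
          simp only [h, h', h'', if_true, if_false]
          push_cast; module
        · simp only [h, h', h'', if_false]
          module
  rw [anomalyBB_eq O hn hm]
  linear_combination (norm := skip) (n - m : ℂ) • h1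
    - (O.db n * h3 + h2 * O.db m - O.db m * h2 - h3 * O.db n
      + (m - l : ℂ) • h4 - (n - l : ℂ) • h5)
    + (2 * n * (if n + m = 0 then 1 else 0) : ℂ) • h0
    + (2 * n * m : ℂ) • (O.b m * O.c_b n l - O.b_acomm m l * O.c n
      - O.b n * O.c_b m l + O.b_acomm n l * O.c m) + key
  simp only [mul_add, add_mul, mul_sub, sub_mul, mul_assoc, smul_mul_assoc, mul_smul_comm, mul_one,
    zero_mul]
  module

theorem level_anomalyBB (n m : ℤ) : Graded O.level (-(n + m)) (O.anomalyBB n m) :=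
  ((O.level_anomaly.comm (O.level_b n)).acomm (O.level_b m)).congr (by ring)

theorem anomalyBB_of_ne {n m : ℤ} (hn : n ≠ 0) (hm : m ≠ 0) (h : n + m ≠ 0) :
    O.anomalyBB n m = 0 := by
  have h' : (-(n + m) : ℂ) ≠ 0 := by exact_mod_cast neg_ne_zero.2 h
  exact O.eq_zero_of_comm O.isNumberOp_level h' (O.level_anomalyBB n m) (O.anomalyBB_α n m)
    (O.anomalyBB_c n m) fun l hl => O.anomalyBB_b hn hm hl

theorem Graded.annihilates {w : ℂ} (hw : w ≠ 0) {T : Module.End ℂ V} (hT : Graded O.level w T)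
    (h : O.Annihilated (T O.vac)) : T O.vac = 0 :=
  O.isNumberOp_level.eq_zero O hw h
    ((hT.apply (x := 0) (by rw [O.isNumberOp_level _ O.annihilated_vac, zero_smul])).trans
      (by rw [add_zero]))

theorem db_vac {n : ℤ} (hn : 0 < n) : O.db n O.vac = 0 := by
  have h' : (-n : ℂ) ≠ 0 := by exact_mod_cast neg_ne_zero.2 hn.ne'
  refine Graded.annihilates O h' (O.level_db n) fun k hk => ⟨fun μ => ?_, ?_, ?_⟩
  · have := apply_of_comm (O.db_α hn.ne' μ k) O.vac
    simpa [O.α_vac μ k hk, O.α_vac μ (k + n) (by omega)] using this.symm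
  · have := apply_of_comm (O.db_c hn.ne' hk.ne') O.vac
    simpa [O.c_vac k hk, O.ct_of_ne (show k + n ≠ 0 by omega), O.c_vac (k + n) (by omega)]
      using this.symm
  · have := apply_of_comm (O.db_b hn.ne' hk.ne') O.vac
    simpa [O.b_vac k hk.le, O.bt_of_ne (show n + k ≠ 0 by omega), O.b_vac (n + k) (by omega)]
      using this.symm

theorem α_db_neg_vac {n : ℤ} (hn : 0 < n) (μ : Fin 26) (k : ℤ) (hk : 0 < k) :
    O.α μ k (O.db (-n) O.vac) = (k : ℂ) • O.α μ (k - n) O.vac := by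
  have := apply_of_comm (O.db_α (neg_ne_zero.2 hn.ne') μ k) O.vac
  rw [O.α_vac μ k hk, map_zero, LinearMap.smul_apply] at this
  rw [eq_neg_of_add_eq_zero_left this.symm, sub_eq_add_neg]
  module

theorem c_db_neg_vac {n : ℤ} (hn : 0 < n) (k : ℤ) (hk : 0 < k) :
    O.c k (O.db (-n) O.vac) = (k - 2 * n : ℂ) • O.ct (k - n) O.vac := by
  have := apply_of_comm (O.db_c (neg_ne_zero.2 hn.ne') hk.ne') O.vac
  rw [O.c_vac k hk, map_zero, LinearMap.smul_apply] at this
  rw [eq_neg_of_add_eq_zero_left this.symm, show k - n = k + -n from sub_eq_add_neg k n]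
  push_cast; module

theorem b_db_neg_vac {n : ℤ} (hn : 0 < n) (k : ℤ) (hk : 0 < k) :
    O.b k (O.db (-n) O.vac) = (k + n : ℂ) • O.bt (k - n) O.vac := by
  have := apply_of_comm (O.db_b (neg_ne_zero.2 hn.ne') hk.ne') O.vac
  rw [O.b_vac k hk.le, map_zero, LinearMap.smul_apply] at this
  rw [eq_neg_of_add_eq_zero_left this.symm, show k - n = -n + k by ring]
  push_cast; module

theorem db_α_α_vac {n : ℤ} (hn : 0 < n) (μ : Fin 26) {k : ℤ} (hk : 0 < k) :
    O.db n (O.α μ (-k) (O.α μ (k - n) O.vac)) =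
      (k : ℂ) • O.α μ (n - k) (O.α μ (k - n) O.vac) := by
  rw [apply_of_comm (O.db_α hn.ne' μ (-k)), apply_of_comm (O.db_α hn.ne' μ (k - n)),
    O.db_vac hn, map_zero, zero_add, LinearMap.smul_apply, sub_add_cancel, O.α_vac μ k hk,
    smul_zero, map_zero, zero_add, LinearMap.smul_apply, neg_add_eq_sub]
  push_cast; module

theorem db_c_b_vac {n : ℤ} (hn : 0 < n) {k : ℤ} (hk : 0 < k) :
    O.db n (O.c (-k) (O.bt (k - n) O.vac)) =
      (k - 2 * n : ℂ) • O.ct (n - k) (O.bt (k - n) O.vac) := by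
  rw [apply_of_comm (O.db_c hn.ne' (neg_ne_zero.2 hk.ne')), apply_of_comm (O.db_bt hn.ne' (k - n)),
    O.db_vac hn, map_zero, zero_add, LinearMap.smul_apply, add_sub_cancel, O.bt_of_ne hk.ne',
    O.b_vac k hk.le, smul_zero, map_zero, zero_add, LinearMap.smul_apply, neg_add_eq_sub]
  push_cast; module

theorem db_b_c_vac {n : ℤ} (hn : 0 < n) {k : ℤ} (hk : 0 < k) :
    O.db n (O.b (-k) (O.ct (k - n) O.vac)) =
      (n + k : ℂ) • O.bt (n - k) (O.ct (k - n) O.vac) := by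
  rw [apply_of_comm (O.db_b hn.ne' (neg_ne_zero.2 hk.ne')), apply_of_comm (O.db_ct hn.ne' (k - n)),
    O.db_vac hn, map_zero, zero_add, LinearMap.smul_apply, sub_add_cancel, O.ct_of_ne hk.ne',
    O.c_vac k hk, smul_zero, map_zero, zero_add, LinearMap.smul_apply, ← sub_eq_add_neg]
  push_cast; module

/-- The summand of the level operator that counts the quanta of frequency `k`. -/
noncomputable def levelTerm (k : ℤ) : Module.End ℂ V :=
  (∑ μ : Fin 26, eta μ • (O.α μ (-k) * O.α μ k)) +
    (k : ℂ) • (O.c (-k) * O.b k + O.b (-k) * O.c k)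

theorem locFin_levelTerm : LocFin fun k : ℕ => O.levelTerm (k + 1) := by
  have := O.locFin_matterLevel.add O.locFin_ghostLevel
  simpa [levelTerm] using this

theorem level_eq : O.level = opSum fun k : ℕ => O.levelTerm (k + 1) := by
  rw [level, matterLevel, ghostLevel, ← opSum_add O.locFin_matterLevel O.locFin_ghostLevel]
  simp [levelTerm]

theorem levelTerm_db_vac {n : ℤ} (hn : 0 < n) {k : ℤ} (hk : 0 < k) :
    O.levelTerm k (O.db (-n) O.vac) =
      (∑ μ : Fin 26, (eta μ * k) • O.α μ (-k) (O.α μ (k - n) O.vac)) +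
      ((k * (k + n) : ℂ) • O.c (-k) (O.bt (k - n) O.vac) +
        (k * (k - 2 * n) : ℂ) • O.b (-k) (O.ct (k - n) O.vac)) := by
  simp only [levelTerm, LinearMap.add_apply, LinearMap.sum_apply, LinearMap.smul_apply,
    Module.End.mul_apply, O.α_db_neg_vac hn _ k hk, O.c_db_neg_vac hn k hk,
    O.b_db_neg_vac hn k hk, map_smul, smul_smul, smul_add]

theorem levelTerm_db_vac_eq_zero {n : ℤ} (hn : 0 < n) {k : ℤ} (hk : n < k) :
    O.levelTerm k (O.db (-n) O.vac) = 0 := by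
  have hk' : 0 < k - n := by omega
  rw [O.levelTerm_db_vac hn (hn.trans hk), O.ct_of_ne hk'.ne', O.bt_of_ne hk'.ne',
    O.c_vac _ hk', O.b_vac _ hk'.le]
  simp [O.α_vac _ _ hk']

theorem eta_sum_smul (z : ℂ) (v : V) : ∑ μ : Fin 26, (eta μ * (z * eta μ)) • v =
    (26 * z) • v := by
  have : ∀ μ, eta μ * (z * eta μ) = z := fun μ => by
    rw [mul_left_comm, eta_mul_eta, mul_one]
  simp only [this, Finset.sum_const, Finset.card_univ, Fintype.card_fin]
  module

/-- The contribution of the quanta of frequency `k < n` to `{Q̃, b_n} N {Q̃, b_{-n}}` on the vacuum.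
The coefficient `26` is the number of space-time dimensions. -/
theorem db_levelTerm_of_lt {n : ℤ} {k : ℤ} (hk : 0 < k) (hkn : k < n) :
    O.db n (O.levelTerm k (O.db (-n) O.vac)) =
      (26 * (k * k * (n - k)) + 2 * k * (k + n) * (k - 2 * n) : ℂ) • O.vac := by
  have hn : 0 < n := hk.trans hkn
  have hα : ∀ μ, O.α μ (n - k) (O.α μ (k - n) O.vac) = ((n - k : ℂ) * eta μ) • O.vac := fun μ => by
    rw [apply_of_comm (O.α_comm μ μ _ _), O.α_vac μ (n - k) (by omega), map_zero, zero_add,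
      if_pos ⟨rfl, by ring⟩]
    push_cast; simp
  have hc : O.ct (n - k) (O.bt (k - n) O.vac) = O.vac := by
    rw [O.ct_of_ne (by omega), O.bt_of_ne (by omega), apply_of_acomm (O.c_b _ _),
      O.c_vac (n - k) (by omega), map_zero, sub_zero, if_pos (by ring)]
    simp
  have hb : O.bt (n - k) (O.ct (k - n) O.vac) = O.vac := by
    rw [O.ct_of_ne (by omega), O.bt_of_ne (by omega), apply_of_acomm (O.b_c _ _),
      O.b_vac (n - k) (by omega), map_zero, sub_zero, if_pos (by ring)]
    simp
  rw [O.levelTerm_db_vac hn hk, map_add, map_add, map_sum]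
  simp only [map_smul, O.db_α_α_vac hn _ hk, O.db_c_b_vac hn hk, O.db_b_c_vac hn hk, hα, hb, hc,
    smul_smul]
  have e : ∀ μ, eta μ * k * (k * ((n - k) * eta μ)) =
      eta μ * (k * k * (n - k) * eta μ : ℂ) := fun μ => by ring
  simp only [e, eta_sum_smul]
  module

theorem db_levelTerm_self {n : ℤ} (hn : 0 < n) :
    O.db n (O.levelTerm n (O.db (-n) O.vac)) = (2 * n * n * (O.intercept + 1) : ℂ) • O.vac := by
  rw [O.levelTerm_db_vac hn hn, map_add, map_add, map_sum]
  simp only [map_smul, O.db_α_α_vac hn _ hn, O.db_c_b_vac hn hn, O.db_b_c_vac hn hn]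
  simp only [sub_self, bt, O.ct_zero, if_true, LinearMap.zero_apply, map_zero, smul_zero, add_zero,
    α_zero, LinearMap.smul_apply, Module.End.one_apply, smul_smul]
  rw [← Finset.sum_smul, intercept, sub_add_cancel, halfMomentumSq]
  congr 1
  rw [Finset.mul_sum, Finset.mul_sum]
  exact Finset.sum_congr rfl fun μ _ => by ring

/-- For `N = n - 1` the right-hand side is `2 n² (n - 1)`. -/
theorem sum_central (n : ℂ) (N : ℕ) :
    ∑ k ∈ Finset.range N, (26 * ((k + 1) * (k + 1) * (n - (k + 1))) +
      2 * (k + 1) * (k + 1 + n) * (k + 1 - 2 * n) : ℂ) =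
    -6 * N ^ 2 * (N + 1) ^ 2 + 4 * n * N * (N + 1) * (2 * N + 1) - 2 * n ^ 2 * N * (N + 1) := by
  induction N with
  | zero => simp
  | succ N ih =>
    rw [Finset.sum_range_succ, ih]
    push_cast; ring

/-- The central terms of the matter and the ghost Virasoro algebras, which cancel against each
other up to the shift of `L_0` by `-1`. This is where the dimension `26` enters. -/
theorem db_db_vac {n : ℤ} (hn : 0 < n) :
    O.db n (O.db (-n) O.vac) = (2 * n * O.intercept + 2 * n * n : ℂ) • O.vac := by
  obtain ⟨N, rfl⟩ : ∃ N : ℕ, n = N + 1 := ⟨(n - 1).toNat, by omega⟩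
  set n : ℤ := N + 1 with hN
  have hn0 : (n : ℂ) ≠ 0 := by exact_mod_cast hn.ne'
  -- `db (-n) vac` has level `n`; writing the level as a sum over quanta evaluates `n` times the claim
  have h1 : O.level (O.db (-n) O.vac) = (n : ℂ) • O.db (-n) O.vac := by
    have := (O.level_db (-n)).apply (x := 0) (v := O.vac)
      (by rw [O.isNumberOp_level _ O.annihilated_vac, zero_smul])
    simpa using this
  have h2 : O.level (O.db (-n) O.vac) =
      ∑ k ∈ Finset.range (N + 1), O.levelTerm (k + 1) (O.db (-n) O.vac) := by
    rw [level_eq, opSum_apply O.locFin_levelTerm]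
    refine finsum_eq_sum_of_support_subset _ fun k hk => ?_
    by_contra h
    simp only [Finset.coe_range, Set.mem_Iio, not_lt] at h
    exact hk (O.levelTerm_db_vac_eq_zero hn (by omega))
  have h3 : (n : ℂ) • O.db n (O.db (-n) O.vac) =
      (n : ℂ) • (2 * n * O.intercept + 2 * n * n : ℂ) • O.vac := by
    rw [← map_smul, ← h1, h2, map_sum, Finset.sum_range_succ, ← hN, O.db_levelTerm_self hn]
    have h4 : ∀ k ∈ Finset.range N, O.db n (O.levelTerm (k + 1) (O.db (-n) O.vac)) = _ :=
      fun k hk => O.db_levelTerm_of_lt (k := k + 1) (by omega)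
        (by have := Finset.mem_range.1 hk; omega)
    rw [Finset.sum_congr rfl h4, ← Finset.sum_smul, ← add_smul, smul_smul]
    congr 1
    have := sum_central n N
    push_cast at this ⊢
    rw [this]
    have e : (n : ℂ) = N + 1 := by rw [hN]; push_cast; ring
    rw [e]
    ring
  exact smul_right_injective V hn0 h3

theorem L0_vac : O.L0 O.vac = O.intercept • O.vac := by
  rw [L0_eq, LinearMap.add_apply, O.isNumberOp_level _ O.annihilated_vac, zero_add]
  rfl

/-- Here the level is zero and gives no information, so the value on the vacuum has to be computed. -/
theorem anomalyBB_neg {n : ℤ} (hn : 0 < n) : O.anomalyBB n (-n) = 0 := by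
  have hn' : -n ≠ 0 := neg_ne_zero.2 hn.ne'
  refine O.eq_zero_of_vac 1 ?_ (fun μ k _ => sub_eq_zero.1 (O.anomalyBB_α n (-n) μ k))
    (fun k _ => by rw [one_smul]; exact sub_eq_zero.1 (O.anomalyBB_c n (-n) k))
    (fun k hk => by rw [one_smul]; exact sub_eq_zero.1 (O.anomalyBB_b hn.ne' hn' hk.ne))
  have h := apply_of_acomm (O.b_c n (-n)) O.vac
  rw [if_pos (add_neg_cancel n), O.b_vac n hn.le, map_zero, sub_zero, LinearMap.smul_apply,
    Module.End.one_apply, one_smul] at h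
  rw [anomalyBB_eq O hn.ne' hn']
  simp only [add_neg_cancel, if_true, smul_zero, zero_sub, mul_one, LinearMap.add_apply,
    LinearMap.neg_apply, LinearMap.sub_apply, LinearMap.smul_apply, Module.End.mul_apply,
    O.db_db_vac hn, O.db_vac hn, O.L0_vac, O.c_vac n hn, h, map_zero]
  push_cast
  module

theorem anomalyBB_eq_zero {n m : ℤ} (hn : n ≠ 0) (hm : m ≠ 0) : O.anomalyBB n m = 0 := by
  by_cases h : n + m = 0
  · obtain rfl : m = -n := by omega
    rcases lt_or_gt_of_ne hn with h' | h'
    · have e : O.anomalyBB n (-n) = -O.anomalyBB (-n) n := by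
        have e1 : O.anomalyBB n (-n) + O.anomalyBB (-n) n = 0 := by
          unfold anomalyBB anomalyB
          linear_combination (norm := skip) O.anomaly * O.b_acomm n (-n)
            - O.b_acomm n (-n) * O.anomaly
          simp only [mul_add, add_mul, mul_sub, sub_mul, mul_assoc, mul_zero, zero_mul]
          module
        exact eq_neg_of_add_eq_zero_left e1
      have := O.anomalyBB_neg (n := -n) (by omega)
      rw [neg_neg] at this
      rw [e, this, neg_zero]
    · exact O.anomalyBB_neg h'
  · exact O.anomalyBB_of_ne hn hm h

theorem anomalyB_eq_zero {n : ℤ} (hn : n ≠ 0) : O.anomalyB n = 0 :=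
  O.eq_zero_of_acomm O.isNumberOp_ghostNumber (w := 1) one_ne_zero
    ((O.ghostNumber_anomaly.comm (O.ghostNumber_b hn)).congr (by norm_num)) (O.anomalyB_α n)
    (O.anomalyB_c n) fun _ hm => O.anomalyBB_eq_zero hn hm

/-- Nilpotency of the BRST operator in `26` dimensions, in terms of `Q̃`. -/
theorem Qt_Qt : O.Qt * O.Qt + O.L0 * O.M = 0 :=
  O.eq_zero_of_comm O.isNumberOp_ghostNumber (w := 2) two_ne_zero O.ghostNumber_anomaly
    O.anomaly_α O.anomaly_c fun _ hn => O.anomalyB_eq_zero hn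

theorem L0_Qt : O.L0 * O.Qt - O.Qt * O.L0 = 0 := by
  have h := O.level_Qt.L0
  unfold Graded at h
  rw [h, zero_smul]

theorem L0_M : O.L0 * O.M - O.M * O.L0 = 0 := by
  have h := O.level_M.L0
  unfold Graded at h
  rw [h, zero_smul]

end Oscillators

/-! ### Locally nilpotent representations of `sl₂` -/

section SlTwo

variable {V : Type*} [AddCommGroup V] [Module ℂ V] {e f h : Module.End ℂ V}

theorem pow_apply_weight {T : Module.End ℂ V} {w : ℂ} (hT : Oscillators.Graded h w T) {v : V} {m : ℂ}
    (hv : h v = m • v) (k : ℕ) : h ((T ^ k) v) = (m + k * w) • (T ^ k) v := by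
  induction k with
  | zero => simp [hv]
  | succ k ih =>
    rw [pow_succ', Module.End.mul_apply, hT.apply ih]
    push_cast
    congr 1
    ring

/-- If `[e, f] = h` and `[h, f] = w f`, moving `e` past a power of `f`. -/
theorem apply_pow_succ {w : ℂ} (hf : Oscillators.Graded h w f) (hef : e * f - f * e = h) {v : V}
    {m : ℂ} (hv : h v = m • v) (k : ℕ) :
    e ((f ^ (k + 1)) v) = (f ^ (k + 1)) (e v) + ((k + 1) * (m + k * w / 2)) • (f ^ k) v := by
  induction k with
  | zero => simp [Oscillators.apply_of_comm hef, hv]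
  | succ k ih =>
    rw [pow_succ', Module.End.mul_apply, Oscillators.apply_of_comm hef, ih,
      pow_apply_weight hf hv, map_add, map_smul, ← Module.End.mul_apply f, ← pow_succ',
      ← Module.End.mul_apply f, ← pow_succ']
    push_cast
    module

variable (he : Oscillators.Graded h 2 e) (hf : Oscillators.Graded h (-2) f)
  (hef : e * f - f * e = h)

include he hf hef

/-- The `n`-th power of the raising operator is injective on vectors of weight `-n`. -/
theorem eq_zero_of_pow_apply_eq_zero (hn : ∀ v, ∃ k, (f ^ k) v = 0) {n : ℕ} {v : V}
    (hv : h v = (-n : ℂ) • v) (h0 : (e ^ n) v = 0) : v = 0 := by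
  have he' : Oscillators.Graded (-h) (-2) e := by
    unfold Oscillators.Graded at *
    rw [neg_smul, ← he, neg_mul, mul_neg]; abel
  have hfe : f * e - e * f = -h := by rw [← hef]; abel
  obtain ⟨j, hj⟩ := hn v
  induction j generalizing n v with
  | zero => exact hj
  | succ j ih =>
    have comm : ∀ k : ℕ, f ((e ^ (k + 1)) v) = (e ^ (k + 1)) (f v) + ((k + 1) * (n - k : ℂ)) •
        (e ^ k) v := fun k => by
      rw [apply_pow_succ he' hfe (m := n) (by rw [LinearMap.neg_apply, hv]; module)]
      congr 2; ring
    have h1 : (e ^ (n + 1)) (f v) = 0 := by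
      have := comm n
      rw [sub_self, mul_zero, zero_smul, add_zero, pow_succ', Module.End.mul_apply, h0] at this
      rw [pow_succ', ← this, map_zero, map_zero]
    have hfv : f v = 0 := by
      refine ih (n := n + 2) ?_ ?_ ?_
      · rw [hf.apply hv]; congr 1; push_cast; ring
      · rw [pow_succ', Module.End.mul_apply, h1, map_zero]
      · rw [← Module.End.mul_apply, ← pow_succ]; exact hj
    -- descending from `e ^ n v = 0` one power at a time
    have down : ∀ i ≤ n, (e ^ (n - i)) v = 0 := by
      intro i
      induction i with
      | zero => intro _; exact h0
      | succ i ihi =>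
        intro hi
        have h2 := comm (n - (i + 1))
        rw [show n - (i + 1) + 1 = n - i by omega, ihi (by omega), hfv, map_zero, map_zero, zero_add]
          at h2
        refine (smul_eq_zero.1 h2.symm).resolve_left (mul_ne_zero ?_ ?_)
        · exact Nat.cast_add_one_ne_zero _
        · rw [Nat.cast_sub hi]; push_cast
          rw [sub_sub_cancel]; exact_mod_cast Nat.succ_ne_zero i
    simpa using down n le_rfl

/-- The `n`-th power of the raising operator maps the vectors of weight `-n` onto those of weight
`n`, also within an invariant subspace `P`. -/
theorem exists_pow_apply_eq (hn : ∀ v, ∃ k, (e ^ k) v = 0) {P : Submodule ℂ V}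
    (hPe : ∀ v ∈ P, e v ∈ P) (hPf : ∀ v ∈ P, f v ∈ P) {n : ℕ} {w : V} (hwP : w ∈ P)
    (hw : h w = (n : ℂ) • w) : ∃ v ∈ P, h v = (-n : ℂ) • v ∧ (e ^ n) v = w := by
  obtain ⟨j, hj⟩ := hn w
  induction j generalizing n w with
  | zero =>
    refine ⟨0, P.zero_mem, by simp, ?_⟩
    rw [map_zero]; exact hj.symm
  | succ j ih =>
    obtain ⟨u, huP, hu, hue⟩ := ih (n := n + 2) (w := e w) (hPe w hwP)
      (by rw [he.apply hw]; congr 1; push_cast; ring)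
      (by rw [← Module.End.mul_apply, ← pow_succ]; exact hj)
    have heu : h (e u) = (-n : ℂ) • e u := by rw [he.apply hu]; congr 1; push_cast; ring
    set w' := w - (e ^ n) (e u) with hw'
    have hPpow : ∀ T : Module.End ℂ V, (∀ v ∈ P, T v ∈ P) → ∀ k, ∀ v ∈ P, (T ^ k) v ∈ P := by
      intro T hT k
      induction k with
      | zero => exact fun v hv => hv
      | succ k ihk =>
        intro v hv
        rw [pow_succ', Module.End.mul_apply]
        exact hT _ (ihk v hv)
    have hw'P : w' ∈ P := P.sub_mem hwP (hPpow e hPe n _ (hPe u huP))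
    have hw'h : h w' = (n : ℂ) • w' := by
      rw [hw', map_sub, hw, pow_apply_weight he heu, smul_sub]
      congr 2; ring
    have hw'e : e w' = 0 := by
      rw [hw', map_sub, ← hue, ← Module.End.mul_apply, ← Module.End.mul_apply, ← pow_succ',
        ← pow_succ, sub_self]
    have key : ∀ k ≤ n, ∃ z : ℂ, z ≠ 0 ∧ (e ^ k) ((f ^ k) w') = z • w' := by
      intro k
      induction k with
      | zero => exact fun _ => ⟨1, one_ne_zero, by simp⟩
      | succ k ihk =>
        intro hk
        obtain ⟨z, hz, hzk⟩ := ihk (by omega)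
        refine ⟨(k + 1) * (n - k) * z, mul_ne_zero (mul_ne_zero ?_ ?_) hz, ?_⟩
        · exact_mod_cast Nat.succ_ne_zero k
        · rw [← Nat.cast_sub (by omega)]
          exact Nat.cast_ne_zero.2 (by omega)
        · rw [pow_succ e, Module.End.mul_apply, apply_pow_succ hf hef hw'h, hw'e, map_zero, zero_add,
            map_smul, hzk, smul_smul]
          congr 1; ring
    obtain ⟨z, hz, hzn⟩ := key n le_rfl
    refine ⟨z⁻¹ • (f ^ n) w' + e u,
      P.add_mem (P.smul_mem _ (hPpow f hPf n _ hw'P)) (hPe u huP), ?_, ?_⟩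
    · rw [map_add, map_smul, pow_apply_weight hf hw'h, heu]
      module
    · rw [map_add, map_smul, hzn, smul_smul, inv_mul_cancel₀ hz, one_smul, hw']
      abel

end SlTwo

namespace Oscillators

variable {V : Type*} [AddCommGroup V] [Module ℂ V] (O : Oscillators V)

/-! ### Local nilpotency of `M` and its partner -/

/-- An analogue of Leibniz' rule when `[T, x] = y` commutes with `T`. -/
theorem pow_succ_mul {T x y : Module.End ℂ V} (h : T * x - x * T = y) (hy : T * y - y * T = 0)
    (k : ℕ) : T ^ (k + 1) * x = x * T ^ (k + 1) + ((k : ℂ) + 1) • (y * T ^ k) := by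
  induction k with
  | zero => rw [← h]; simp
  | succ k ih =>
    rw [pow_succ' T (k + 1), mul_assoc, ih]
    linear_combination (norm := skip) h * T ^ (k + 1) + ((k : ℂ) + 1) • (hy * T ^ k)
    rw [pow_succ' T k]
    simp only [mul_add, sub_mul, mul_assoc, zero_mul, mul_smul_comm]
    push_cast
    module

theorem pow_succ_apply_eq_zero {T x y : Module.End ℂ V} (h : T * x - x * T = y)
    (hy : T * y - y * T = 0) {v : V} {k : ℕ} (hv : (T ^ k) v = 0) : (T ^ (k + 1)) (x v) = 0 := by
  rw [← Module.End.mul_apply, pow_succ_mul h hy, LinearMap.add_apply, LinearMap.smul_apply,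
    Module.End.mul_apply, Module.End.mul_apply, hv, pow_succ', Module.End.mul_apply, hv]
  simp

theorem exists_pow_apply_eq_zero {T : Module.End ℂ V} (h0 : T O.vac = 0)
    (hα : ∀ μ n, T * O.α μ n - O.α μ n * T = 0)
    (hc : ∀ n, ∃ y, T * O.c n - O.c n * T = y ∧ T * y - y * T = 0)
    (hb : ∀ n, ∃ y, T * O.b n - O.b n * T = y ∧ T * y - y * T = 0) (v : V) :
    ∃ k, (T ^ k) v = 0 := by
  let P : Submodule ℂ V :=
    { carrier := {v | ∃ k, (T ^ k) v = 0}
      zero_mem' := ⟨0, map_zero _⟩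
      add_mem' := by
        rintro v w ⟨k, hk⟩ ⟨l, hl⟩
        refine ⟨k + l, ?_⟩
        rw [map_add, pow_add, Module.End.mul_apply, Module.End.mul_apply, hl, map_zero, add_zero,
          ← Module.End.mul_apply, ← pow_add, add_comm, pow_add, Module.End.mul_apply, hk, map_zero]
      smul_mem' := by
        rintro z v ⟨k, hk⟩
        exact ⟨k, by rw [map_smul, hk, smul_zero]⟩ }
  suffices P = ⊤ by
    have h : v ∈ P := this ▸ Submodule.mem_top
    exact h
  refine O.cyclic P ⟨1, by rw [pow_one, h0]⟩ ?_ ?_ ?_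
  · rintro μ n - v ⟨k, hk⟩
    exact ⟨k + 1, pow_succ_apply_eq_zero (hα μ n) (by simp) hk⟩
  · rintro n - v ⟨k, hk⟩
    obtain ⟨y, h1, h2⟩ := hc n
    exact ⟨k + 1, pow_succ_apply_eq_zero h1 h2 hk⟩
  · rintro n - v ⟨k, hk⟩
    obtain ⟨y, h1, h2⟩ := hb n
    exact ⟨k + 1, pow_succ_apply_eq_zero h1 h2 hk⟩

theorem M_nilpotent (v : V) : ∃ k, (O.M ^ k) v = 0 :=
  O.exists_pow_apply_eq_zero O.M_vac O.M_α (fun n => ⟨_, O.M_c n, by simp⟩)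
    (fun n => ⟨_, O.M_b n, by rw [mul_smul_comm, smul_mul_assoc, ← smul_sub, O.M_c, smul_zero]⟩) v

theorem lower_nilpotent (v : V) : ∃ k, (O.lower ^ k) v = 0 :=
  O.exists_pow_apply_eq_zero O.lower_vac O.lower_α
    (fun n => ⟨_, O.lower_c n, by
      rw [mul_smul_comm, smul_mul_assoc, ← smul_sub, O.lower_b, smul_zero]⟩)
    (fun n => ⟨_, O.lower_b n, by simp⟩) v

/-! ### The spaces `F^n` -/

/-- The state `α_{-n_1}^{μ_1} ⋯ c_{-l_1} ⋯ b_{-m_1} ⋯ |0, p; ↓⟩`; an entry `r` of one of the lists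
stands for the frequency `r + 1`. -/
def oscillatorState (A : List (ℕ × Fin 26)) (C B : List ℕ) : V :=
  ((A.map fun x => O.α x.2 (Int.negSucc x.1)).prod * (C.map fun r => O.c (-((r : ℤ) + 1))).prod *
    (B.map fun r => O.b (-((r : ℤ) + 1))).prod) O.vac

/-- In `oscillatorState` the lists of natural numbers are coerced to lists of integers. -/
theorem oscillatorState_eq (A : List (ℕ × Fin 26)) (C B : List ℕ) :
    O.oscillatorState A C B =
      ((A.map fun x => O.α x.2 (Int.negSucc x.1)).prod *
        (C.map fun r : ℕ => O.c (-((r : ℤ) + 1))).prod *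
        (B.map fun r : ℕ => O.b (-((r : ℤ) + 1))).prod) O.vac := by
  have h : ∀ (f : ℤ → Module.End ℂ V) (l : List ℕ),
      List.map f (do let a ← l; pure (a : ℤ)) = l.map fun r : ℕ => f r := fun f l => by
    simp [List.bind_eq_flatMap, ← List.map_eq_flatMap]
  rw [oscillatorState, h, h]

/-- The span of the states without `c_0` that have `#c - #b = n`. -/
def F (n : ℤ) : Submodule ℂ V :=
  Submodule.span ℂ
    {f | ∃ (A : List (ℕ × Fin 26)) (C B : List ℕ),
      (C.length : ℤ) - B.length = n ∧ f = O.oscillatorState A C B}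

theorem list_prod_graded {D : Module.End ℂ V} {w : ℂ} {l : List (Module.End ℂ V)}
    (h : ∀ T ∈ l, Graded D w T) : Graded D (l.length * w) l.prod := by
  induction l with
  | nil => simpa using Graded.one
  | cons T l ih =>
    rw [List.prod_cons]
    refine ((h T (by simp)).mul (ih fun S hS => h S (by simp [hS]))).congr ?_
    rw [List.length_cons]; push_cast; ring

theorem list_prod_comm {x : Module.End ℂ V} {z : ℂ} {l : List (Module.End ℂ V)}
    (h : ∀ T ∈ l, x * T = z • (T * x)) : x * l.prod = z ^ l.length • (l.prod * x) := by
  induction l with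
  | nil => simp
  | cons T l ih =>
    rw [List.prod_cons, ← mul_assoc, h T (by simp), smul_mul_assoc, mul_assoc,
      ih fun S hS => h S (by simp [hS]), mul_smul_comm, smul_smul, mul_assoc, List.length_cons,
      pow_succ']

theorem ghostNumber_oscillatorState (A : List (ℕ × Fin 26)) (C B : List ℕ) :
    O.ghostNumber (O.oscillatorState A C B) =
      (((C.length : ℤ) - B.length : ℤ) : ℂ) • O.oscillatorState A C B := by
  rw [oscillatorState_eq]
  have hA : Graded O.ghostNumber _ (A.map fun x => O.α x.2 (Int.negSucc x.1)).prod :=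
    list_prod_graded (w := 0) fun T hT => by
      obtain ⟨x, -, rfl⟩ := List.mem_map.1 hT
      exact O.ghostNumber_α _ _
  have hC : Graded O.ghostNumber _ (C.map fun r : ℕ => O.c (-((r : ℤ) + 1))).prod :=
    list_prod_graded (w := 1) fun T hT => by
      obtain ⟨x, -, rfl⟩ := List.mem_map.1 hT
      exact O.ghostNumber_c (by omega)
  have hB : Graded O.ghostNumber _ (B.map fun r : ℕ => O.b (-((r : ℤ) + 1))).prod :=
    list_prod_graded (w := -1) fun T hT => by
      obtain ⟨x, -, rfl⟩ := List.mem_map.1 hT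
      exact O.ghostNumber_b (by omega)
  rw [((hA.mul hC).mul hB).apply (x := 0)
    (by rw [O.isNumberOp_ghostNumber _ O.annihilated_vac, zero_smul])]
  congr 1
  simp only [List.length_map]
  push_cast; ring

theorem b_zero_oscillatorState (A : List (ℕ × Fin 26)) (C B : List ℕ) :
    O.b 0 (O.oscillatorState A C B) = 0 := by
  rw [oscillatorState_eq]
  have hA : O.b 0 * (A.map fun x => O.α x.2 (Int.negSucc x.1)).prod = _ :=
    list_prod_comm (z := 1) fun T hT => by
      obtain ⟨x, -, rfl⟩ := List.mem_map.1 hT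
      rw [one_smul]; exact sub_eq_zero.1 (O.b_α _ _ _)
  have hC : O.b 0 * (C.map fun r : ℕ => O.c (-((r : ℤ) + 1))).prod = _ :=
    list_prod_comm (z := -1) fun T hT => by
      obtain ⟨x, -, rfl⟩ := List.mem_map.1 hT
      have := O.b_c 0 (-((x : ℤ) + 1))
      rw [if_neg (by omega), zero_smul] at this
      rw [neg_one_smul]; exact eq_neg_of_add_eq_zero_left this
  have hB : O.b 0 * (B.map fun r : ℕ => O.b (-((r : ℤ) + 1))).prod = _ :=
    list_prod_comm (z := -1) fun T hT => by
      obtain ⟨x, -, rfl⟩ := List.mem_map.1 hT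
      rw [neg_one_smul]; exact eq_neg_of_add_eq_zero_left (O.b_acomm _ _)
  rw [← Module.End.mul_apply, ← mul_assoc, ← mul_assoc, hA, smul_mul_assoc, mul_assoc _ (O.b 0), hC,
    mul_smul_comm, smul_mul_assoc, smul_mul_assoc, mul_assoc _ _ (List.prod _), mul_assoc _ (O.b 0),
    hB]
  simp [O.b_vac 0 le_rfl]

theorem α_oscillatorState (A : List (ℕ × Fin 26)) (C B : List ℕ) (x : ℕ × Fin 26) :
    O.α x.2 (Int.negSucc x.1) (O.oscillatorState A C B) = O.oscillatorState (x :: A) C B := by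
  simp [oscillatorState_eq]

theorem c_oscillatorState (A : List (ℕ × Fin 26)) (C B : List ℕ) (r : ℕ) :
    O.c (-((r : ℤ) + 1)) (O.oscillatorState A C B) = O.oscillatorState A (r :: C) B := by
  have hA : O.c (-((r : ℤ) + 1)) * (A.map fun x => O.α x.2 (Int.negSucc x.1)).prod = _ :=
    list_prod_comm (z := 1) fun T hT => by
      obtain ⟨x, -, rfl⟩ := List.mem_map.1 hT
      rw [one_smul]; exact sub_eq_zero.1 (O.c_α _ _ _)
  rw [oscillatorState_eq, oscillatorState_eq]
  rw [← Module.End.mul_apply, ← mul_assoc, ← mul_assoc, hA, one_pow, one_smul, List.map_cons,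
    List.prod_cons, mul_assoc _ (O.c _)]

theorem b_oscillatorState (A : List (ℕ × Fin 26)) (C B : List ℕ) (r : ℕ) :
    O.b (-((r : ℤ) + 1)) (O.oscillatorState A C B) =
      (-1 : ℂ) ^ C.length • O.oscillatorState A C (r :: B) := by
  have hA : O.b (-((r : ℤ) + 1)) * (A.map fun x => O.α x.2 (Int.negSucc x.1)).prod = _ :=
    list_prod_comm (z := 1) fun T hT => by
      obtain ⟨x, -, rfl⟩ := List.mem_map.1 hT
      rw [one_smul]; exact sub_eq_zero.1 (O.b_α _ _ _)
  have hC : O.b (-((r : ℤ) + 1)) * (C.map fun r : ℕ => O.c (-((r : ℤ) + 1))).prod = _ :=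
    list_prod_comm (z := -1) fun T hT => by
      obtain ⟨x, -, rfl⟩ := List.mem_map.1 hT
      have := O.b_c (-((r : ℤ) + 1)) (-((x : ℤ) + 1))
      rw [if_neg (by omega), zero_smul] at this
      rw [neg_one_smul]; exact eq_neg_of_add_eq_zero_left this
  rw [oscillatorState_eq, oscillatorState_eq]
  rw [← Module.End.mul_apply, ← mul_assoc, ← mul_assoc, hA, one_pow, one_smul, mul_assoc _ (O.b _),
    hC, List.length_map, mul_smul_comm, smul_mul_assoc, LinearMap.smul_apply, List.map_cons,
    List.prod_cons, mul_assoc, mul_assoc, mul_assoc]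

theorem iSup_F_mem {T : Module.End ℂ V} (h : ∀ A C B, T (O.oscillatorState A C B) ∈ ⨆ n, O.F n)
    {v : V} (hv : v ∈ ⨆ n, O.F n) : T v ∈ ⨆ n, O.F n := by
  suffices (⨆ n, O.F n) ≤ (⨆ n, O.F n).comap T from this hv
  refine iSup_le fun n => Submodule.span_le.2 ?_
  rintro _ ⟨A, C, B, -, rfl⟩
  exact h A C B

theorem oscillatorState_mem_iSup (A : List (ℕ × Fin 26)) (C B : List ℕ) :
    O.oscillatorState A C B ∈ ⨆ n, O.F n :=
  Submodule.mem_iSup_of_mem ((C.length : ℤ) - B.length)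
    (Submodule.subset_span ⟨A, C, B, rfl, rfl⟩)

/-- Every state is of the form `φ + c_0 ω`, where `φ` and `ω` do not contain `c_0`. -/
theorem iSup_F_sup_map_c_zero : (⨆ n, O.F n) ⊔ (⨆ n, O.F n).map (O.c 0) = ⊤ := by
  have hα : ∀ μ, ∀ n < 0, ∀ v ∈ ⨆ n, O.F n, O.α μ n v ∈ ⨆ n, O.F n := fun μ n hn v hv => by
    obtain ⟨k, rfl⟩ := Int.eq_negSucc_of_lt_zero hn
    refine O.iSup_F_mem (fun A C B => ?_) hv
    rw [O.α_oscillatorState A C B (k, μ)]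
    exact O.oscillatorState_mem_iSup _ _ _
  have hc : ∀ n < 0, ∀ v ∈ ⨆ n, O.F n, O.c n v ∈ ⨆ n, O.F n := fun n hn v hv => by
    obtain ⟨k, rfl⟩ : ∃ k : ℕ, n = -((k : ℤ) + 1) := ⟨(-n - 1).toNat, by omega⟩
    refine O.iSup_F_mem (fun A C B => ?_) hv
    rw [c_oscillatorState]
    exact O.oscillatorState_mem_iSup _ _ _
  have hb : ∀ n < 0, ∀ v ∈ ⨆ n, O.F n, O.b n v ∈ ⨆ n, O.F n := fun n hn v hv => by
    obtain ⟨k, rfl⟩ : ∃ k : ℕ, n = -((k : ℤ) + 1) := ⟨(-n - 1).toNat, by omega⟩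
    refine O.iSup_F_mem (fun A C B => ?_) hv
    rw [b_oscillatorState]
    exact Submodule.smul_mem _ _ (O.oscillatorState_mem_iSup _ _ _)
  refine O.cyclic _ (Submodule.mem_sup_left ?_) (fun μ n hn v hv => ?_) (fun n hn v hv => ?_)
    (fun n hn v hv => ?_)
  · simpa [oscillatorState] using O.oscillatorState_mem_iSup [] [] []
  · obtain ⟨x, hx, _, ⟨y, hy, rfl⟩, rfl⟩ := Submodule.mem_sup.1 hv
    refine Submodule.mem_sup.2 ⟨_, hα μ n hn x hx, _, ⟨_, hα μ n hn y hy, rfl⟩, ?_⟩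
    rw [map_add, apply_of_comm (O.α_c μ n 0)]; simp
  · obtain ⟨x, hx, _, ⟨y, hy, rfl⟩, rfl⟩ := Submodule.mem_sup.1 hv
    rcases hn.lt_or_eq with hn | rfl
    · refine Submodule.mem_sup.2 ⟨_, hc n hn x hx, _,
        ⟨_, Submodule.neg_mem _ (hc n hn y hy), rfl⟩, ?_⟩
      rw [map_add, apply_of_acomm (O.c_acomm n 0)]; simp
    · refine Submodule.mem_sup_right ⟨x, hx, ?_⟩
      have h0 : O.c 0 (O.c 0 y) = 0 := by
        have := congrArg (fun T : Module.End ℂ V => T y) (O.c_acomm 0 0)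
        simpa [← two_smul ℂ] using this
      rw [map_add, h0, add_zero]
  · obtain ⟨x, hx, _, ⟨y, hy, rfl⟩, rfl⟩ := Submodule.mem_sup.1 hv
    refine Submodule.mem_sup.2 ⟨_, hb n hn x hx, _, ⟨_, Submodule.neg_mem _ (hb n hn y hy), rfl⟩, ?_⟩
    rw [map_add, apply_of_acomm (O.b_c n 0), if_neg (by omega)]; simp

theorem b_zero_c_zero {v : V} (hv : O.b 0 v = 0) : O.b 0 (O.c 0 v) = v := by
  rw [apply_of_acomm (O.b_c 0 0), hv]; simp

theorem c_zero_c_zero (v : V) : O.c 0 (O.c 0 v) = 0 := by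
  have := congrArg (fun T : Module.End ℂ V => T v) (O.c_acomm 0 0)
  simpa [← two_smul ℂ] using this

/-- The space `F^n` in terms of operators: `b_0` vanishes and the ghost number is `n`. -/
theorem mem_F {n : ℤ} {v : V} : v ∈ O.F n ↔ O.b 0 v = 0 ∧ O.ghostNumber v = (n : ℂ) • v := by
  have hF : ∀ {n : ℤ} {v : V}, v ∈ O.F n → O.b 0 v = 0 ∧ O.ghostNumber v = (n : ℂ) • v := by
    intro n v hv
    suffices O.F n ≤ LinearMap.ker (O.b 0) ⊓ Module.End.eigenspace O.ghostNumber (n : ℂ) by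
      obtain ⟨h1, h2⟩ := this hv
      exact ⟨h1, Module.End.mem_eigenspace_iff.1 h2⟩
    refine Submodule.span_le.2 ?_
    rintro _ ⟨A, C, B, rfl, rfl⟩
    exact ⟨O.b_zero_oscillatorState A C B,
      Module.End.mem_eigenspace_iff.2 (O.ghostNumber_oscillatorState A C B)⟩
  refine ⟨hF, fun ⟨h1, h2⟩ => ?_⟩
  have hb : ∀ x ∈ ⨆ n, O.F n, O.b 0 x = 0 := fun x hx =>
    (iSup_le fun n y hy => (hF hy).1 : (⨆ n, O.F n) ≤ LinearMap.ker (O.b 0)) hx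
  obtain ⟨x, hx, _, ⟨y, hy, rfl⟩, rfl⟩ := Submodule.mem_sup.1
    (O.iSup_F_sup_map_c_zero ▸ Submodule.mem_top (x := v))
  rw [map_add, hb x hx, zero_add, O.b_zero_c_zero (hb y hy)] at h1
  subst h1
  rw [map_zero, add_zero] at h2 ⊢
  rw [iSup_split_single _ n] at hx
  obtain ⟨u, hu, w, hw, rfl⟩ := Submodule.mem_sup.1 hx
  -- the component `w` of ghost number different from `n` vanishes
  have hw1 : w ∈ Module.End.eigenspace O.ghostNumber (n : ℂ) := by
    rw [Module.End.mem_eigenspace_iff]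
    rw [map_add, (hF hu).2, smul_add] at h2
    exact add_left_cancel h2
  have hw2 : w ∈ ⨆ z, ⨆ (_ : z ≠ (n : ℂ)), Module.End.eigenspace O.ghostNumber z := by
    refine (iSup₂_le fun k hk => ?_ : (⨆ k, ⨆ (_ : k ≠ n), O.F k) ≤ _) hw
    intro y hy
    exact Submodule.mem_iSup_of_mem (k : ℂ) (Submodule.mem_iSup_of_mem (by exact_mod_cast hk)
      (Module.End.mem_eigenspace_iff.2 (hF hy).2))
  have hw0 : w = 0 := by
    have := (Module.End.eigenspaces_iSupIndep O.ghostNumber (n : ℂ)).le_bot ⟨hw1, hw2⟩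
    simpa using this
  rw [hw0, add_zero]
  exact hu

theorem b_zero_of_mem_F {n : ℤ} {v : V} (hv : v ∈ O.F n) : O.b 0 v = 0 := (O.mem_F.1 hv).1

theorem mem_F_of_graded {T : Module.End ℂ V} {w n m : ℤ} (hT : Graded O.ghostNumber w T)
    (hb : ∀ v, O.b 0 v = 0 → O.b 0 (T v) = 0) (hm : w + n = m) {v : V} (hv : v ∈ O.F n) :
    T v ∈ O.F m := by
  rw [mem_F] at hv ⊢
  refine ⟨hb v hv.1, ?_⟩
  rw [hT.apply hv.2, ← hm]
  push_cast; rfl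

theorem b_zero_apply_eq_zero {T : Module.End ℂ V} (h : T * O.b 0 - O.b 0 * T = 0) {v : V}
    (hv : O.b 0 v = 0) : O.b 0 (T v) = 0 := by
  have := apply_of_comm h v
  simpa [hv] using this.symm

theorem M_b_zero : O.M * O.b 0 - O.b 0 * O.M = 0 := by
  rw [M_b]; simp

theorem L0_b_zero : O.L0 * O.b 0 - O.b 0 * O.L0 = 0 := by
  have h := (O.level_b 0).L0
  unfold Graded at h
  rw [h]; simp

theorem L0_c_zero : O.L0 * O.c 0 - O.c 0 * O.L0 = 0 := by
  have h := (O.level_c 0).L0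
  unfold Graded at h
  rw [h]; simp

theorem M_mem_F {n m : ℤ} (hm : 2 + n = m) {v : V} (hv : v ∈ O.F n) : O.M v ∈ O.F m :=
  O.mem_F_of_graded (w := 2) (by exact_mod_cast O.ghostNumber_M)
    (fun _ => O.b_zero_apply_eq_zero O.M_b_zero) hm hv

theorem Qt_mem_F {n m : ℤ} (hm : 1 + n = m) {v : V} (hv : v ∈ O.F n) : O.Qt v ∈ O.F m :=
  O.mem_F_of_graded (w := 1) (by exact_mod_cast O.ghostNumber_Qt)
    (fun v h => by have := apply_of_acomm O.Qt_b_zero v; simpa [h] using this.symm) hm hv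

theorem L0_mem_F {n : ℤ} {v : V} (hv : v ∈ O.F n) : O.L0 v ∈ O.F n :=
  O.mem_F_of_graded (w := 0) (by exact_mod_cast O.ghostNumber_L0)
    (fun _ => O.b_zero_apply_eq_zero O.L0_b_zero) (zero_add n) hv

theorem M_pow_mem_F {n m : ℤ} (k : ℕ) (hm : 2 * k + n = m) {v : V} (hv : v ∈ O.F n) :
    (O.M ^ k) v ∈ O.F m := by
  induction k generalizing m with
  | zero =>
    obtain rfl : n = m := by omega
    exact hv
  | succ k ih =>
    rw [pow_succ', Module.End.mul_apply]
    exact O.M_mem_F (n := 2 * k + n) (by push_cast at hm; omega) (ih rfl)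

/-! ### `M^n : F^{-n} → F^n` is bijective -/

theorem M_pow_injective (n : ℕ) {v : V} (hv : v ∈ O.F (-n)) (h : (O.M ^ n) v = 0) : v = 0 :=
  eq_zero_of_pow_apply_eq_zero O.ghostNumber_M O.ghostNumber_lower O.M_lower O.lower_nilpotent
    (by rw [(O.mem_F.1 hv).2]; push_cast; rfl) h

theorem M_pow_surjective (n : ℕ) {w : V} (hw : w ∈ O.F n) : ∃ v ∈ O.F (-n), (O.M ^ n) v = w := by
  obtain ⟨v, h1, h2, h3⟩ := exists_pow_apply_eq O.ghostNumber_M O.ghostNumber_lower O.M_lower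
    O.M_nilpotent (P := LinearMap.ker (O.b 0)) (fun _ => O.b_zero_apply_eq_zero O.M_b_zero)
    (fun _ => O.b_zero_apply_eq_zero (O.lower_b 0)) (n := n) (w := w) (O.mem_F.1 hw).1
    (by rw [(O.mem_F.1 hw).2]; push_cast; rfl)
  exact ⟨v, O.mem_F.2 ⟨h1, by rw [h2]; push_cast; rfl⟩, h3⟩

open Classical in
/-- The inverse of `M^n : F^{-n} → F^n`, extended by `0` outside `F^n`. -/
noncomputable def invM (n : ℕ) (f : V) : V :=
  if h : ∃ g ∈ O.F (-(n : ℤ)), (O.M ^ n) g = f then h.choose else 0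

theorem invM_mem (n : ℕ) (f : V) : O.invM n f ∈ O.F (-n) := by
  unfold invM
  split_ifs with h
  · exact h.choose_spec.1
  · exact Submodule.zero_mem _

theorem invM_M_pow (n : ℕ) {g : V} (hg : g ∈ O.F (-n)) : O.invM n ((O.M ^ n) g) = g := by
  have h : ∃ g' ∈ O.F (-(n : ℤ)), (O.M ^ n) g' = (O.M ^ n) g := ⟨g, hg, rfl⟩
  rw [invM, dif_pos h]
  refine sub_eq_zero.1 (O.M_pow_injective n (Submodule.sub_mem _ h.choose_spec.1 hg) ?_)
  rw [map_sub, h.choose_spec.2, sub_self]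

theorem M_pow_invM (n : ℕ) {f : V} (hf : f ∈ O.F n) : (O.M ^ n) (O.invM n f) = f := by
  obtain ⟨g, hg, rfl⟩ := O.M_pow_surjective n hf
  rw [O.invM_M_pow n hg]

theorem invM_zero (n : ℕ) : O.invM n 0 = 0 := by
  have := O.invM_M_pow n (Submodule.zero_mem _)
  rwa [map_zero] at this

theorem invM_add (n : ℕ) {f g : V} (hf : f ∈ O.F n) (hg : g ∈ O.F n) :
    O.invM n (f + g) = O.invM n f + O.invM n g := by
  obtain ⟨f', hf', rfl⟩ := O.M_pow_surjective n hf
  obtain ⟨g', hg', rfl⟩ := O.M_pow_surjective n hg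
  rw [← map_add, O.invM_M_pow n hf', O.invM_M_pow n hg',
    O.invM_M_pow n (Submodule.add_mem _ hf' hg')]

/-- The operator `W_n` on the full Fock space. -/
noncomputable def W (n : ℕ) (Φ : V) : V :=
  O.invM n (O.b 0 (O.c 0 Φ)) + O.c 0 (O.invM n (O.b 0 Φ))

/-- The components of `W_n (φ + c_0 ω)`. -/
theorem W_add_c_zero (n : ℕ) {φ ω : V} (hφ : O.b 0 φ = 0) (hω : O.b 0 ω = 0) :
    O.W n (φ + O.c 0 ω) = O.invM n φ + O.c 0 (O.invM n ω) := by
  rw [W, map_add, c_zero_c_zero, add_zero, O.b_zero_c_zero hφ, map_add, hφ, zero_add,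
    O.b_zero_c_zero hω]

theorem W_of_b_zero (n : ℕ) {φ : V} (hφ : O.b 0 φ = 0) : O.W n φ = O.invM n φ := by
  rw [W, O.b_zero_c_zero hφ, hφ, invM_zero, map_zero, add_zero]

/-! ### States with `L_0 ≠ 0` -/

/-- The sums of `L_0`-eigenstates with nonzero eigenvalue. -/
noncomputable def nonzeroL0 : Submodule ℂ V :=
  ⨆ (h : ℂ) (_ : h ≠ 0), Module.End.eigenspace O.L0 h

/-- `L_0` is diagonalisable. -/
theorem iSup_eigenspace_L0 : ⨆ h : ℂ, Module.End.eigenspace O.L0 h = ⊤ := by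
  have key : ∀ {w : ℂ} {T : Module.End ℂ V}, Graded O.level w T →
      ∀ v ∈ ⨆ h : ℂ, Module.End.eigenspace O.L0 h, T v ∈ ⨆ h : ℂ, Module.End.eigenspace O.L0 h := by
    intro w T hT v hv
    suffices (⨆ h : ℂ, Module.End.eigenspace O.L0 h) ≤
      (⨆ h : ℂ, Module.End.eigenspace O.L0 h).comap T from this hv
    refine iSup_le fun h x hx => ?_
    exact Submodule.mem_iSup_of_mem (w + h) (Module.End.mem_eigenspace_iff.2
      (hT.L0.apply (Module.End.mem_eigenspace_iff.1 hx)))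
  exact O.cyclic _
    (Submodule.mem_iSup_of_mem O.intercept (Module.End.mem_eigenspace_iff.2 O.L0_vac))
    (fun μ n _ => key (O.level_α μ n)) (fun n _ => key (O.level_c n))
    (fun n _ => key (O.level_b n))

theorem mem_nonzeroL0_of_eigen {h : ℂ} (hh : h ≠ 0) {v : V} (hv : O.L0 v = h • v) :
    v ∈ O.nonzeroL0 :=
  Submodule.mem_iSup_of_mem h (Submodule.mem_iSup_of_mem hh (Module.End.mem_eigenspace_iff.2 hv))

/-- Since `L_0` is diagonalisable, the states with `L_0 ≠ 0` form the range of `L_0`. -/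
theorem nonzeroL0_eq_range : O.nonzeroL0 = LinearMap.range O.L0 := by
  refine le_antisymm (iSup₂_le fun h hh v hv => ?_) ?_
  · rw [Module.End.mem_eigenspace_iff] at hv
    exact ⟨h⁻¹ • v, by rw [map_smul, hv, smul_smul, inv_mul_cancel₀ hh, one_smul]⟩
  · rw [← Submodule.map_top, ← iSup_eigenspace_L0, Submodule.map_iSup]
    refine iSup_le fun h => ?_
    rintro _ ⟨v, hv, rfl⟩
    rw [SetLike.mem_coe, Module.End.mem_eigenspace_iff] at hv
    rw [hv]
    by_cases hh : h = 0
    · rw [hh, zero_smul]; exact Submodule.zero_mem _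
    · exact Submodule.smul_mem _ _ (O.mem_nonzeroL0_of_eigen hh hv)

theorem eq_zero_of_L0_eq_zero {v : V} (hv : v ∈ O.nonzeroL0) (h : O.L0 v = 0) : v = 0 := by
  have := (Module.End.eigenspaces_iSupIndep O.L0 0).le_bot
    ⟨Module.End.mem_eigenspace_iff.2 (by rw [h, zero_smul]), hv⟩
  simpa using this

/-- On the states with `L_0 ≠ 0` the operator `L_0` is surjective. -/
theorem exists_L0_eq {v : V} (hv : v ∈ O.nonzeroL0) : ∃ u ∈ O.nonzeroL0, O.L0 u = v := by
  suffices O.nonzeroL0 ≤ O.nonzeroL0.map O.L0 from this hv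
  refine iSup₂_le fun h hh v hv => ?_
  have hv' := Module.End.mem_eigenspace_iff.1 hv
  exact ⟨h⁻¹ • v, Submodule.smul_mem _ _ (O.mem_nonzeroL0_of_eigen hh hv'), by
    rw [map_smul, hv', smul_smul, inv_mul_cancel₀ hh, one_smul]⟩

theorem mem_nonzeroL0_of_comm {T : Module.End ℂ V} (hT : O.L0 * T - T * O.L0 = 0) {v : V}
    (hv : v ∈ O.nonzeroL0) : T v ∈ O.nonzeroL0 := by
  rw [nonzeroL0_eq_range] at hv ⊢
  obtain ⟨u, rfl⟩ := hv
  exact ⟨T u, by rw [apply_of_comm hT]; simp⟩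

/-- The states of `F^n` with `L_0 ≠ 0`. -/
noncomputable def G (n : ℤ) : Submodule ℂ V := O.F n ⊓ O.nonzeroL0

theorem L0_M_apply (v : V) : O.L0 (O.M v) = O.M (O.L0 v) := by
  rw [apply_of_comm O.L0_M]; simp

theorem L0_Qt_apply (v : V) : O.L0 (O.Qt v) = O.Qt (O.L0 v) := by
  rw [apply_of_comm O.L0_Qt]; simp

theorem M_pow_apply_of_comm {T : Module.End ℂ V} (h : ∀ v, T (O.M v) = O.M (T v)) (k : ℕ) (v : V) :
    T ((O.M ^ k) v) = (O.M ^ k) (T v) := by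
  induction k with
  | zero => rfl
  | succ k ih => rw [pow_succ', Module.End.mul_apply, h, ih, Module.End.mul_apply]

theorem L0_M_pow (k : ℕ) (v : V) : O.L0 ((O.M ^ k) v) = (O.M ^ k) (O.L0 v) :=
  O.M_pow_apply_of_comm O.L0_M_apply k v

theorem Qt_M_apply (v : V) : O.Qt (O.M v) = O.M (O.Qt v) := by
  rw [apply_of_comm O.Qt_M]; simp

theorem Qt_M_pow (k : ℕ) (v : V) : O.Qt ((O.M ^ k) v) = (O.M ^ k) (O.Qt v) :=
  O.M_pow_apply_of_comm O.Qt_M_apply k v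

theorem Qt_Qt_apply (v : V) : O.Qt (O.Qt v) = -O.M (O.L0 v) := by
  have := congrArg (fun T : Module.End ℂ V => T v) (eq_neg_of_add_eq_zero_left O.Qt_Qt)
  simpa [L0_M_apply] using this

theorem M_mem_G {n m : ℤ} (hm : 2 + n = m) {v : V} (hv : v ∈ O.G n) : O.M v ∈ O.G m :=
  ⟨O.M_mem_F hm hv.1, O.mem_nonzeroL0_of_comm O.L0_M hv.2⟩

theorem Qt_mem_G {n m : ℤ} (hm : 1 + n = m) {v : V} (hv : v ∈ O.G n) : O.Qt v ∈ O.G m :=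
  ⟨O.Qt_mem_F hm hv.1, O.mem_nonzeroL0_of_comm O.L0_Qt hv.2⟩

theorem L0_mem_G {n : ℤ} {v : V} (hv : v ∈ O.G n) : O.L0 v ∈ O.G n :=
  ⟨O.L0_mem_F hv.1, O.mem_nonzeroL0_of_comm (sub_self _) hv.2⟩

theorem M_pow_mem_G {n m : ℤ} (k : ℕ) (hm : 2 * k + n = m) {v : V} (hv : v ∈ O.G n) :
    (O.M ^ k) v ∈ O.G m := by
  refine ⟨O.M_pow_mem_F k hm hv.1, ?_⟩
  have hv := hv.2
  rw [nonzeroL0_eq_range] at hv ⊢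
  obtain ⟨u, rfl⟩ := hv
  exact ⟨(O.M ^ k) u, O.L0_M_pow k u⟩

/-- The solution `u` inherits `b_0 u = 0` and the ghost number from `v`, because `L_0` is injective on
the states with `L_0 ≠ 0`. -/
theorem exists_L0_eq_of_mem_G {n : ℤ} {v : V} (hv : v ∈ O.G n) : ∃ u ∈ O.G n, O.L0 u = v := by
  obtain ⟨u, hu, rfl⟩ := O.exists_L0_eq hv.2
  refine ⟨u, ⟨O.mem_F.2 ⟨?_, ?_⟩, hu⟩, rfl⟩
  · refine O.eq_zero_of_L0_eq_zero (O.mem_nonzeroL0_of_comm O.L0_b_zero hu) ?_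
    rw [apply_of_comm O.L0_b_zero, O.b_zero_of_mem_F hv.1]; simp
  · have hN : O.L0 * O.ghostNumber - O.ghostNumber * O.L0 = 0 := by
      have h := O.ghostNumber_L0
      unfold Graded at h
      rw [← neg_sub, h, zero_smul, neg_zero]
    rw [← sub_eq_zero]
    refine O.eq_zero_of_L0_eq_zero (Submodule.sub_mem _ (O.mem_nonzeroL0_of_comm hN hu)
      (Submodule.smul_mem _ _ hu)) ?_
    rw [map_sub, apply_of_comm hN, (O.mem_F.1 hv.1).2, map_smul]
    simp

theorem L0_injective {n : ℤ} {v : V} (hv : v ∈ O.G n) (h : O.L0 v = 0) : v = 0 :=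
  O.eq_zero_of_L0_eq_zero hv.2 h

/-- The preimage under `M ^ n` again has `L_0 ≠ 0`: if `w = L_0 u` and `M ^ n v = u`, then
`w = M ^ n (L_0 v)`. -/
theorem M_pow_surjective_G (n : ℕ) {w : V} (hw : w ∈ O.G n) :
    ∃ v ∈ O.G (-n), (O.M ^ n) v = w := by
  obtain ⟨u, hu, rfl⟩ := O.exists_L0_eq_of_mem_G hw
  obtain ⟨v, hv, rfl⟩ := O.M_pow_surjective n hu.1
  refine ⟨O.L0 v, ⟨O.L0_mem_F hv, ?_⟩, (O.L0_M_pow n v).symm⟩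
  rw [nonzeroL0_eq_range]
  exact ⟨v, rfl⟩

theorem invM_mem_G (n : ℕ) {w : V} (hw : w ∈ O.G n) : O.invM n w ∈ O.G (-n) := by
  obtain ⟨v, hv, rfl⟩ := O.M_pow_surjective_G n hw
  rwa [O.invM_M_pow n hv.1]

/-! ### String fields of definite ghost number -/

/-- The states `φ + c_0 ω` with `φ ∈ F^{n-1}` and `ω ∈ F^{n-2}`. -/
def ghostSector (n : ℤ) : Submodule ℂ V := O.F (n - 1) ⊔ (O.F (n - 2)).map (O.c 0)

/-- String fields of ghost number `n` with `L_0 ≠ 0`. -/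
noncomputable def sector (n : ℤ) : Submodule ℂ V := O.ghostSector n ⊓ O.nonzeroL0

theorem mem_ghostSector {n : ℤ} {Φ : V} :
    Φ ∈ O.ghostSector n ↔ ∃ φ ∈ O.F (n - 1), ∃ ω ∈ O.F (n - 2), φ + O.c 0 ω = Φ := by
  simp [ghostSector, Submodule.mem_sup]

/-- The components of a string field with `L_0 ≠ 0` have `L_0 ≠ 0`, because `b_0` and `c_0` commute
with `L_0`. -/
theorem mem_sector {n : ℤ} {Φ : V} :
    Φ ∈ O.sector n ↔ ∃ φ ∈ O.G (n - 1), ∃ ω ∈ O.G (n - 2), φ + O.c 0 ω = Φ := by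
  constructor
  · rintro ⟨h1, h2⟩
    obtain ⟨φ, hφ, ω, hω, rfl⟩ := O.mem_ghostSector.1 h1
    have e1 : O.b 0 (O.c 0 (φ + O.c 0 ω)) = φ := by
      rw [map_add, c_zero_c_zero, add_zero, O.b_zero_c_zero (O.b_zero_of_mem_F hφ)]
    have e2 : O.b 0 (φ + O.c 0 ω) = ω := by
      rw [map_add, O.b_zero_of_mem_F hφ, zero_add, O.b_zero_c_zero (O.b_zero_of_mem_F hω)]
    refine ⟨φ, ⟨hφ, ?_⟩, ω, ⟨hω, ?_⟩, rfl⟩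
    · rw [← e1]
      exact O.mem_nonzeroL0_of_comm O.L0_b_zero (O.mem_nonzeroL0_of_comm O.L0_c_zero h2)
    · rw [← e2]
      exact O.mem_nonzeroL0_of_comm O.L0_b_zero h2
  · rintro ⟨φ, hφ, ω, hω, rfl⟩
    exact ⟨O.mem_ghostSector.2 ⟨φ, hφ.1, ω, hω.1, rfl⟩,
      Submodule.add_mem _ hφ.2 (O.mem_nonzeroL0_of_comm O.L0_c_zero hω.2)⟩

/-- The BRST operator. -/
noncomputable def Q : Module.End ℂ V := O.Qt + O.c 0 * O.L0 + O.b 0 * O.M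

/-- The free gauge transformation in components. -/
theorem Q_apply {ρ κ : V} (hρ : O.b 0 ρ = 0) (hκ : O.b 0 κ = 0) :
    O.Q (ρ + O.c 0 κ) = (O.Qt ρ + O.M κ) + O.c 0 (O.L0 ρ - O.Qt κ) := by
  have h1 : O.Qt (O.c 0 κ) = -O.c 0 (O.Qt κ) := by
    rw [apply_of_acomm O.Qt_c_zero]; simp
  have h2 : O.L0 (O.c 0 κ) = O.c 0 (O.L0 κ) := by
    rw [apply_of_comm O.L0_c_zero]; simp
  have h3 : O.M (O.c 0 κ) = O.c 0 (O.M κ) := by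
    rw [apply_of_comm (O.M_c 0)]; simp
  simp only [Q, LinearMap.add_apply, Module.End.mul_apply, map_add, h1, h2, h3, c_zero_c_zero,
    O.b_zero_apply_eq_zero O.M_b_zero hρ, O.b_zero_c_zero (O.b_zero_apply_eq_zero O.M_b_zero hκ),
    map_sub]
  abel

/-! ### The gauge conditions in components -/

/-- The left-hand side of the gauge condition at ghost number `1`. -/
noncomputable def gaugeFunction (a : ℝ) (Φ : V) : V :=
  O.b 0 (O.M Φ + (a : ℂ) • O.c 0 (O.Qt Φ))

/-- The left-hand side of the extended gauge condition. -/
noncomputable def extendedGaugeFunction (a : ℝ) (n : ℤ) (Φ : V) : V :=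
  if n ≤ 1 then
    O.b 0 ((O.M ^ (2 - n).toNat) Φ + (a : ℂ) • O.c 0 (O.Qt ((O.M ^ (1 - n).toNat) Φ)))
  else
    O.b 0 (O.W (n - 2).toNat Φ + (a : ℂ) • O.c 0 (O.Qt (O.W (n - 1).toNat Φ)))

theorem gaugeFunction_eq (a : ℝ) (Φ : V) :
    O.gaugeFunction a Φ = O.extendedGaugeFunction a 1 Φ := by
  simp [gaugeFunction, extendedGaugeFunction]

/-- The operator `b_0 c_0 Q̃` extracts `Q̃ φ` from `φ + c_0 ω`. -/
theorem b_zero_add_c_zero_Qt (z : ℂ) {φ ω φ' ω' : V} (hφ : O.b 0 φ = 0) (hω : O.b 0 ω = 0)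
    (hφ' : O.b 0 φ' = 0) :
    O.b 0 ((φ + O.c 0 ω) + z • O.c 0 (O.Qt (φ' + O.c 0 ω'))) = ω + z • O.Qt φ' := by
  have h1 : O.Qt (O.c 0 ω') = -O.c 0 (O.Qt ω') := by
    rw [apply_of_acomm O.Qt_c_zero]; simp
  have h2 : O.b 0 (O.Qt φ') = 0 := by
    have := apply_of_acomm O.Qt_b_zero φ'
    simpa [hφ'] using this.symm
  simp only [map_add, map_smul, h1, map_neg, c_zero_c_zero, neg_zero, add_zero, hφ, zero_add,
    O.b_zero_c_zero hω, O.b_zero_c_zero h2]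

theorem M_pow_add_c_zero (k : ℕ) (φ ω : V) :
    (O.M ^ k) (φ + O.c 0 ω) = (O.M ^ k) φ + O.c 0 ((O.M ^ k) ω) := by
  have h3 : ∀ v, O.c 0 (O.M v) = O.M (O.c 0 v) := fun v => by
    rw [apply_of_comm (O.M_c 0)]; simp
  rw [map_add, O.M_pow_apply_of_comm h3]

theorem b_zero_M_pow (k : ℕ) {v : V} (hv : O.b 0 v = 0) : O.b 0 ((O.M ^ k) v) = 0 := by
  have h3 : ∀ v, O.b 0 (O.M v) = O.M (O.b 0 v) := fun v => by
    rw [apply_of_comm O.M_b_zero]; simp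
  rw [O.M_pow_apply_of_comm h3, hv, map_zero]

theorem extendedGaugeFunction_of_le (a : ℝ) {n : ℤ} (hn : n ≤ 1) {φ ω : V} (hφ : O.b 0 φ = 0)
    (hω : O.b 0 ω = 0) : O.extendedGaugeFunction a n (φ + O.c 0 ω) =
      (O.M ^ (2 - n).toNat) ω + (a : ℂ) • O.Qt ((O.M ^ (1 - n).toNat) φ) := by
  rw [extendedGaugeFunction, if_pos hn, M_pow_add_c_zero, M_pow_add_c_zero,
    O.b_zero_add_c_zero_Qt _ (O.b_zero_M_pow _ hφ) (O.b_zero_M_pow _ hω) (O.b_zero_M_pow _ hφ)]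

theorem extendedGaugeFunction_of_ge (a : ℝ) {n : ℤ} (hn : 2 ≤ n) {φ ω : V} (hφ : O.b 0 φ = 0)
    (hω : O.b 0 ω = 0) : O.extendedGaugeFunction a n (φ + O.c 0 ω) =
      O.invM (n - 2).toNat ω + (a : ℂ) • O.Qt (O.invM (n - 1).toNat φ) := by
  have hb : ∀ m f, O.b 0 (O.invM m f) = 0 := fun m f => O.b_zero_of_mem_F (O.invM_mem m f)
  rw [extendedGaugeFunction, if_neg (by omega), O.W_add_c_zero _ hφ hω, O.W_add_c_zero _ hφ hω,
    O.b_zero_add_c_zero_Qt _ (hb _ _) (hb _ _) (hb _ _)]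

/-- The extended condition for ghost number `1 - k`. -/
theorem extendedGaugeFunction_one_sub (a : ℝ) (k : ℕ) {φ ω : V} (hφ : O.b 0 φ = 0)
    (hω : O.b 0 ω = 0) : O.extendedGaugeFunction a (1 - k) (φ + O.c 0 ω) =
      (O.M ^ (k + 1)) ω + (a : ℂ) • O.Qt ((O.M ^ k) φ) := by
  rw [O.extendedGaugeFunction_of_le a (by omega) hφ hω, show (2 - (1 - (k : ℤ))).toNat = k + 1 by omega,
    show (1 - (1 - (k : ℤ))).toNat = k by omega]

/-- The extended condition for ghost number `k + 2`. -/
theorem extendedGaugeFunction_add_two (a : ℝ) (k : ℕ) {φ ω : V} (hφ : O.b 0 φ = 0)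
    (hω : O.b 0 ω = 0) : O.extendedGaugeFunction a (k + 2) (φ + O.c 0 ω) =
      O.invM k ω + (a : ℂ) • O.Qt (O.invM (k + 1) φ) := by
  rw [O.extendedGaugeFunction_of_ge a (by omega) hφ hω, show ((k : ℤ) + 2 - 2).toNat = k by omega,
    show ((k : ℤ) + 2 - 1).toNat = k + 1 by omega]

/-- On a fixed ghost number the gauge condition is linear. -/
theorem extendedGaugeFunction_add (a : ℝ) {n : ℤ} {φ ω φ' ω' : V} (hφ : φ ∈ O.F (n - 1))
    (hω : ω ∈ O.F (n - 2)) (hφ' : φ' ∈ O.F (n - 1)) (hω' : ω' ∈ O.F (n - 2)) :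
    O.extendedGaugeFunction a n ((φ + O.c 0 ω) + (φ' + O.c 0 ω')) =
      O.extendedGaugeFunction a n (φ + O.c 0 ω) + O.extendedGaugeFunction a n (φ' + O.c 0 ω') := by
  have e : (φ + O.c 0 ω) + (φ' + O.c 0 ω') = (φ + φ') + O.c 0 (ω + ω') := by
    rw [map_add]; abel
  have b1 := O.b_zero_of_mem_F hφ
  have b2 := O.b_zero_of_mem_F hω
  have b3 := O.b_zero_of_mem_F hφ'
  have b4 := O.b_zero_of_mem_F hω'
  have b5 := O.b_zero_of_mem_F (Submodule.add_mem _ hφ hφ')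
  have b6 := O.b_zero_of_mem_F (Submodule.add_mem _ hω hω')
  rw [e]
  rcases le_or_gt n 1 with hn | hn
  · rw [O.extendedGaugeFunction_of_le a hn b5 b6, O.extendedGaugeFunction_of_le a hn b1 b2,
      O.extendedGaugeFunction_of_le a hn b3 b4]
    simp only [map_add]
    module
  · have hn : 2 ≤ n := hn
    have c1 : (((n - 1).toNat : ℕ) : ℤ) = n - 1 := by omega
    have c2 : (((n - 2).toNat : ℕ) : ℤ) = n - 2 := by omega
    rw [O.extendedGaugeFunction_of_ge a hn b5 b6, O.extendedGaugeFunction_of_ge a hn b1 b2,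
      O.extendedGaugeFunction_of_ge a hn b3 b4, O.invM_add _ (by rwa [c2]) (by rwa [c2]),
      O.invM_add _ (by rwa [c1]) (by rwa [c1]), map_add]
    module

/-! ### Reaching the gauge -/

/-- Every string field of ghost number `n` can be brought to satisfy `C` by a gauge
transformation. -/
def CanBeReached (n : ℤ) (C : V → Prop) : Prop :=
  ∀ Φ ∈ O.sector n, ∃ Λ ∈ O.sector (n - 1), C (Φ + O.Q Λ)

/-- Gauge transformations between string fields of ghost number `n` that both satisfy `C` are
trivial. -/
def NoResidualSymmetry (n : ℤ) (C : V → Prop) : Prop :=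
  ∀ Φ ∈ O.sector n, ∀ Λ ∈ O.sector (n - 1), C Φ → C (Φ + O.Q Λ) → O.Q Λ = 0

theorem one_sub_ne_zero {a : ℝ} (ha : a ≠ 1) : (1 - a : ℂ) ≠ 0 := by
  rw [sub_ne_zero]
  exact_mod_cast ha.symm

/-- For ghost number `n ≤ 1` a parameter `ρ` without `c_0` changes the gauge function by
`(1 - a) M^{2-n} L_0 ρ`, which takes all values. -/
theorem canBeReached_one_sub {a : ℝ} (ha : a ≠ 1) (k : ℕ) :
    O.CanBeReached (1 - k) (fun Φ => O.extendedGaugeFunction a (1 - k) Φ = 0) := by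
  intro Φ hΦ
  obtain ⟨φ, hφ, ω, hω, rfl⟩ := O.mem_sector.1 hΦ
  have hg : (O.M ^ (k + 1)) ω + (a : ℂ) • O.Qt ((O.M ^ k) φ) ∈ O.G ((k + 1 : ℕ) : ℤ) :=
    Submodule.add_mem _ (O.M_pow_mem_G (k + 1) (by push_cast; ring) hω)
      (Submodule.smul_mem _ _ (O.Qt_mem_G (n := k) (by push_cast; ring)
        (O.M_pow_mem_G k (by ring) hφ)))
  obtain ⟨v, hv, hv'⟩ := O.M_pow_surjective_G _ hg
  obtain ⟨u, hu, rfl⟩ := O.exists_L0_eq_of_mem_G hv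
  have ha' := one_sub_ne_zero ha
  set ρ := (-(1 - a : ℂ)⁻¹) • u with hρ
  have hρG : ρ ∈ O.G (1 - (k : ℤ) - 1 - 1) := by
    have e : 1 - (k : ℤ) - 1 - 1 = -((k + 1 : ℕ) : ℤ) := by push_cast; ring
    rw [e]
    exact Submodule.smul_mem _ _ hu
  refine ⟨ρ, O.mem_sector.2 ⟨ρ, hρG, 0, Submodule.zero_mem _, by rw [map_zero, add_zero]⟩, ?_⟩
  have b1 := O.b_zero_of_mem_F hρG.1
  have hQ := O.Q_apply b1 (map_zero (O.b 0))
  simp only [map_zero, add_zero, sub_zero] at hQ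
  have e : φ + O.c 0 ω + O.Q ρ = (φ + O.Qt ρ) + O.c 0 (ω + O.L0 ρ) := by
    rw [hQ, map_add]; abel
  beta_reduce
  rw [e, O.extendedGaugeFunction_one_sub a k
    (O.b_zero_of_mem_F (Submodule.add_mem _ hφ.1 (O.Qt_mem_F (by ring) hρG.1)))
    (O.b_zero_of_mem_F (Submodule.add_mem _ hω.1
      (O.L0_mem_F (by
        rw [show 1 - (k : ℤ) - 2 = 1 - (k : ℤ) - 1 - 1 by ring]; exact hρG.1)))),
    map_add, map_add, map_add, O.Qt_M_pow k (O.Qt ρ), Qt_Qt_apply, map_neg,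
    ← Module.End.mul_apply (O.M ^ k), ← pow_succ]
  have h1 : (O.M ^ (k + 1)) (O.L0 ρ) = (-(1 - a : ℂ)⁻¹) •
      ((O.M ^ (k + 1)) ω + (a : ℂ) • O.Qt ((O.M ^ k) φ)) := by
    rw [hρ, map_smul, map_smul, hv']
  have h2 : (1 - a : ℂ) * (1 - a : ℂ)⁻¹ = 1 := mul_inv_cancel₀ ha'
  rw [h1]
  generalize (1 - a : ℂ)⁻¹ = r at h2
  trans (1 - (1 - a) * r : ℂ) • ((O.M ^ (k + 1)) ω + (a : ℂ) • O.Qt ((O.M ^ k) φ))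
  · module
  · rw [h2, sub_self, zero_smul]

/-- For ghost number `n ≥ 2` the component `κ = a / (1 - a) M^{n-2} W_{n-1} Q̃ ρ` of the parameter
`ρ + c_0 κ` compensates the contribution of `Q̃ ρ`; then the gauge function changes by
`W_{n-2} L_0 ρ`. -/
theorem canBeReached_add_two {a : ℝ} (ha : a ≠ 1) (k : ℕ) :
    O.CanBeReached (k + 2) (fun Φ => O.extendedGaugeFunction a (k + 2) Φ = 0) := by
  intro Φ hΦ
  obtain ⟨φ, hφ, ω, hω, rfl⟩ := O.mem_sector.1 hΦ
  have e1 : (k : ℤ) + 2 - 1 = ((k + 1 : ℕ) : ℤ) := by push_cast; ring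
  have e2 : (k : ℤ) + 2 - 2 = k := by ring
  rw [e1] at hφ
  rw [e2] at hω
  have hg : O.invM k ω + (a : ℂ) • O.Qt (O.invM (k + 1) φ) ∈ O.G (-k) :=
    Submodule.add_mem _ (O.invM_mem_G k hω) (Submodule.smul_mem _ _
      (O.Qt_mem_G (by push_cast; ring) (O.invM_mem_G (k + 1) hφ)))
  obtain ⟨u, hu, hu'⟩ := O.exists_L0_eq_of_mem_G hg
  have ha' := one_sub_ne_zero ha
  -- `ρ` is chosen such that `W_{n-2} L_0 ρ` is the negative of the gauge function of `Φ`
  set ρ := -(O.M ^ k) u with hρ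
  have hρG : ρ ∈ O.G k := Submodule.neg_mem _ (O.M_pow_mem_G k (by ring) hu)
  obtain ⟨x, hx, hx'⟩ := O.M_pow_surjective_G (k + 1) (O.Qt_mem_G (by push_cast; ring) hρG)
  set r : ℂ := a * (1 - a : ℂ)⁻¹ with hr
  have hr' : (a : ℂ) * (1 + r) = r := by
    rw [hr]; field_simp; ring
  have hκG : r • (O.M ^ k) x ∈ O.G (k - 1) :=
    Submodule.smul_mem _ _ (O.M_pow_mem_G k (by push_cast; ring) hx)
  have b1 := O.b_zero_of_mem_F hρG.1
  have b2 := O.b_zero_of_mem_F hκG.1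
  refine ⟨ρ + O.c 0 (r • (O.M ^ k) x), O.mem_sector.2 ⟨ρ, ?_, _, ?_, rfl⟩, ?_⟩
  · rwa [show (k : ℤ) + 2 - 1 - 1 = k by ring]
  · rwa [show (k : ℤ) + 2 - 1 - 2 = k - 1 by ring]
  have h1 : O.Qt ρ + O.M (r • (O.M ^ k) x) = (O.M ^ (k + 1)) ((1 + r) • x) := by
    rw [← hx', map_smul, map_smul, pow_succ', Module.End.mul_apply]; module
  have h2 : O.L0 ρ - O.Qt (r • (O.M ^ k) x) =
      (O.M ^ k) (-(O.invM k ω + (a : ℂ) • O.Qt (O.invM (k + 1) φ)) - r • O.Qt x) := by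
    rw [hρ, map_neg, L0_M_pow, hu', map_smul, Qt_M_pow]
    simp only [map_sub, map_neg, map_smul]
  have hx1 : (1 + r) • x ∈ O.F (-((k + 1 : ℕ) : ℤ)) := Submodule.smul_mem _ _ hx.1
  have hx2 : -(O.invM k ω + (a : ℂ) • O.Qt (O.invM (k + 1) φ)) - r • O.Qt x ∈ O.F (-k) :=
    Submodule.sub_mem _ (Submodule.neg_mem _ hg.1)
      (Submodule.smul_mem _ _ (O.Qt_mem_F (by push_cast; ring) hx.1))
  have hφ' : O.Qt ρ + O.M (r • (O.M ^ k) x) ∈ O.F ((k + 1 : ℕ) : ℤ) := by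
    rw [h1]; exact O.M_pow_mem_F _ (by push_cast; ring) hx1
  have hω' : O.L0 ρ - O.Qt (r • (O.M ^ k) x) ∈ O.F k := by
    rw [h2]; exact O.M_pow_mem_F _ (by ring) hx2
  beta_reduce
  rw [O.Q_apply b1 b2, O.extendedGaugeFunction_add a (by rw [e1]; exact hφ.1) (by rw [e2]; exact hω.1)
    (by rw [e1]; exact hφ') (by rw [e2]; exact hω'), O.extendedGaugeFunction_add_two a k
    (O.b_zero_of_mem_F hφ.1) (O.b_zero_of_mem_F hω.1), O.extendedGaugeFunction_add_two a k
    (O.b_zero_of_mem_F hφ') (O.b_zero_of_mem_F hω'), h1, h2, O.invM_M_pow _ hx1,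
    O.invM_M_pow _ hx2, map_smul, smul_smul, hr']
  abel

/-! ### Absence of a residual symmetry -/

/-- A pure gauge field is BRST closed. -/
theorem closed_of_exact {ρ κ φ ω : V} (hφ : φ = O.Qt ρ + O.M κ) (hω : ω = O.L0 ρ - O.Qt κ) :
    O.Qt φ + O.M ω = 0 ∧ O.L0 φ = O.Qt ω := by
  subst hφ hω
  constructor
  · simp only [map_add, map_sub, Qt_Qt_apply, Qt_M_apply]; abel
  · simp only [map_add, map_sub, Qt_Qt_apply, L0_M_apply, L0_Qt_apply]; abel

/-- Closedness turns the gauge condition into `(1 - a) M^{2-n} ω = 0`, hence `ω = 0` and `L_0 φ = 0`. -/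
theorem eq_zero_of_closed_one_sub {a : ℝ} (ha : a ≠ 1) (k : ℕ) {φ ω : V}
    (hφ : φ ∈ O.G (1 - k - 1)) (hω : ω ∈ O.G (1 - k - 2)) (h1 : O.Qt φ + O.M ω = 0)
    (h2 : O.L0 φ = O.Qt ω) (hg : O.extendedGaugeFunction a (1 - k) (φ + O.c 0 ω) = 0) :
    φ = 0 ∧ ω = 0 := by
  rw [O.extendedGaugeFunction_one_sub a k (O.b_zero_of_mem_F hφ.1) (O.b_zero_of_mem_F hω.1),
    Qt_M_pow, eq_neg_of_add_eq_zero_left h1, map_neg, ← Module.End.mul_apply (O.M ^ k),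
    ← pow_succ] at hg
  have h3 : (1 - a : ℂ) • (O.M ^ (k + 1)) ω = 0 := by rw [← hg]; module
  have hω0 : ω = 0 := by
    refine O.M_pow_injective (k + 1) ?_ ((smul_eq_zero.1 h3).resolve_left (one_sub_ne_zero ha))
    rw [show -((k + 1 : ℕ) : ℤ) = 1 - k - 2 by push_cast; ring]
    exact hω.1
  refine ⟨O.L0_injective hφ ?_, hω0⟩
  rw [h2, hω0, map_zero]

/-- With `φ = M^{n-1} φ'` and `ω = M^{n-2} ω'` the gauge condition reads `ω' = -a Q̃ φ'`, and
closedness turns it into `(1 - a) L_0 φ = 0`. -/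
theorem eq_zero_of_closed_add_two {a : ℝ} (ha : a ≠ 1) (k : ℕ) {φ ω : V}
    (hφ : φ ∈ O.G (k + 2 - 1)) (hω : ω ∈ O.G (k + 2 - 2)) (h2 : O.L0 φ = O.Qt ω)
    (hg : O.extendedGaugeFunction a (k + 2) (φ + O.c 0 ω) = 0) : φ = 0 ∧ ω = 0 := by
  rw [O.extendedGaugeFunction_add_two a k (O.b_zero_of_mem_F hφ.1) (O.b_zero_of_mem_F hω.1)] at hg
  have e1 : (k : ℤ) + 2 - 1 = ((k + 1 : ℕ) : ℤ) := by push_cast; ring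
  have e2 : (k : ℤ) + 2 - 2 = k := by ring
  obtain ⟨φ', hφ', rfl⟩ := O.M_pow_surjective_G (k + 1) (e1 ▸ hφ)
  obtain ⟨ω', hω', rfl⟩ := O.M_pow_surjective_G k (e2 ▸ hω)
  rw [O.invM_M_pow _ hφ'.1, O.invM_M_pow _ hω'.1] at hg
  have h3 : (1 - a : ℂ) • O.L0 ((O.M ^ (k + 1)) φ') = 0 := by
    have h4 : O.L0 ((O.M ^ (k + 1)) φ') = (a : ℂ) • O.L0 ((O.M ^ (k + 1)) φ') := by
      calc O.L0 ((O.M ^ (k + 1)) φ') = (O.M ^ k) (O.Qt ω') := by rw [h2, Qt_M_pow]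
        _ = (a : ℂ) • (O.M ^ (k + 1)) (O.L0 φ') := by
          rw [eq_neg_of_add_eq_zero_left hg, map_neg, map_smul, Qt_Qt_apply, smul_neg, neg_neg,
            map_smul, pow_succ, Module.End.mul_apply]
        _ = _ := by rw [L0_M_pow]
    rw [sub_smul, one_smul, ← h4, sub_self]
  have hφ0 : (O.M ^ (k + 1)) φ' = 0 :=
    O.L0_injective hφ ((smul_eq_zero.1 h3).resolve_left (one_sub_ne_zero ha))
  have hφ0' : φ' = 0 := O.M_pow_injective _ hφ'.1 hφ0
  rw [hφ0', map_zero, smul_zero, add_zero] at hg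
  exact ⟨hφ0, by rw [hg, map_zero]⟩

/-- Residual symmetries are pure gauge fields that satisfy the condition, by linearity. -/
theorem noResidualSymmetry {a : ℝ} {n : ℤ}
    (h : ∀ φ ∈ O.G (n - 1), ∀ ω ∈ O.G (n - 2), O.Qt φ + O.M ω = 0 → O.L0 φ = O.Qt ω →
      O.extendedGaugeFunction a n (φ + O.c 0 ω) = 0 → φ = 0 ∧ ω = 0) :
    O.NoResidualSymmetry n (fun Φ => O.extendedGaugeFunction a n Φ = 0) := by
  intro Φ hΦ Λ hΛ h1 h2
  obtain ⟨φ, hφ, ω, hω, rfl⟩ := O.mem_sector.1 hΦ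
  obtain ⟨ρ, hρ, κ, hκ, rfl⟩ := O.mem_sector.1 hΛ
  have hφ' : O.Qt ρ + O.M κ ∈ O.G (n - 1) :=
    Submodule.add_mem _ (O.Qt_mem_G (by ring) hρ) (O.M_mem_G (by ring) hκ)
  have hω' : O.L0 ρ - O.Qt κ ∈ O.G (n - 2) := by
    refine Submodule.sub_mem _ ?_ (O.Qt_mem_G (by ring) hκ)
    rw [show n - 2 = n - 1 - 1 by ring]
    exact O.L0_mem_G hρ
  rw [O.Q_apply (O.b_zero_of_mem_F hρ.1) (O.b_zero_of_mem_F hκ.1)] at h2 ⊢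
  rw [O.extendedGaugeFunction_add a hφ.1 hω.1 hφ'.1 hω'.1, h1, zero_add] at h2
  obtain ⟨h3, h4⟩ := O.closed_of_exact (ρ := ρ) (κ := κ) rfl rfl
  obtain ⟨h5, h6⟩ := h _ hφ' _ hω' h3 h4 h2
  rw [h5, h6, map_zero, add_zero]

/-- For `a ≠ 1` the extended condition fixes the gauge exactly. -/
theorem gauge_fixed {a : ℝ} (ha : a ≠ 1) (n : ℤ) :
    O.CanBeReached n (fun Φ => O.extendedGaugeFunction a n Φ = 0) ∧
      O.NoResidualSymmetry n (fun Φ => O.extendedGaugeFunction a n Φ = 0) := by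
  rcases le_or_gt n 1 with hn | hn
  · obtain ⟨k, rfl⟩ : ∃ k : ℕ, n = 1 - k := ⟨(1 - n).toNat, by omega⟩
    exact ⟨O.canBeReached_one_sub ha k, O.noResidualSymmetry fun φ hφ ω hω h1 h2 hg =>
      O.eq_zero_of_closed_one_sub ha k hφ hω h1 h2 hg⟩
  · obtain ⟨k, rfl⟩ : ∃ k : ℕ, n = k + 2 := ⟨(n - 2).toNat, by omega⟩
    exact ⟨O.canBeReached_add_two ha k, O.noResidualSymmetry fun φ hφ ω hω _ h2 hg =>
      O.eq_zero_of_closed_add_two ha k hφ hω h2 hg⟩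

/-! ### The values `a = 0` and `a = 1` -/

/-- At `a = 0` the condition is the Siegel gauge. -/
theorem extendedGaugeFunction_zero {n : ℤ} {Φ : V} (hΦ : Φ ∈ O.ghostSector n) :
    O.extendedGaugeFunction 0 n Φ = 0 ↔ O.b 0 Φ = 0 := by
  obtain ⟨φ, hφ, ω, hω, rfl⟩ := O.mem_ghostSector.1 hΦ
  have b1 := O.b_zero_of_mem_F hφ
  have b2 := O.b_zero_of_mem_F hω
  rw [map_add, b1, zero_add, O.b_zero_c_zero b2]
  rcases le_or_gt n 1 with hn | hn
  · obtain ⟨k, rfl⟩ : ∃ k : ℕ, n = 1 - k := ⟨(1 - n).toNat, by omega⟩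
    rw [O.extendedGaugeFunction_one_sub 0 k b1 b2, Complex.ofReal_zero, zero_smul, add_zero]
    refine ⟨O.M_pow_injective (k + 1) ?_, fun h => by rw [h, map_zero]⟩
    rwa [show -((k + 1 : ℕ) : ℤ) = 1 - k - 2 by push_cast; ring]
  · obtain ⟨k, rfl⟩ : ∃ k : ℕ, n = k + 2 := ⟨(n - 2).toNat, by omega⟩
    rw [O.extendedGaugeFunction_add_two 0 k b1 b2, Complex.ofReal_zero, zero_smul, add_zero]
    rw [show (k : ℤ) + 2 - 2 = k by ring] at hω
    refine ⟨fun h => ?_, fun h => by rw [h, invM_zero]⟩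
    rw [← O.M_pow_invM k hω, h, map_zero]

/-- At `a = 1` the gauge function is invariant, by the nilpotency of the BRST operator. -/
theorem gaugeFunction_one_add_Q {Φ Λ : V} (hΛ : Λ ∈ O.ghostSector 0) :
    O.gaugeFunction 1 (Φ + O.Q Λ) = O.gaugeFunction 1 Φ := by
  have h : O.gaugeFunction 1 (Φ + O.Q Λ) = O.gaugeFunction 1 Φ + O.gaugeFunction 1 (O.Q Λ) := by
    simp only [gaugeFunction, map_add, map_smul]
    module
  obtain ⟨ρ, hρ, κ, hκ, rfl⟩ := O.mem_ghostSector.1 hΛ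
  have hφ : O.Qt ρ + O.M κ ∈ O.F 0 :=
    Submodule.add_mem _ (O.Qt_mem_F (by norm_num) hρ) (O.M_mem_F (by norm_num) hκ)
  have hω : O.L0 ρ - O.Qt κ ∈ O.F (-1) :=
    Submodule.sub_mem _ (O.L0_mem_F (by simpa using hρ)) (O.Qt_mem_F (by norm_num) hκ)
  have h0 := O.extendedGaugeFunction_one_sub 1 0 (O.b_zero_of_mem_F hφ) (O.b_zero_of_mem_F hω)
  obtain ⟨h3, -⟩ := O.closed_of_exact (ρ := ρ) (κ := κ) rfl rfl
  rw [Nat.cast_zero, sub_zero, ← gaugeFunction_eq] at h0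
  rw [h, O.Q_apply (O.b_zero_of_mem_F hρ) (O.b_zero_of_mem_F hκ), h0]
  simp only [zero_add, pow_one, Complex.ofReal_one, one_smul, pow_zero, Module.End.one_apply]
  rw [add_comm (O.M _), h3, add_zero]

/-- Among `b_{-1} |0⟩` and `b_{-2} |0⟩` there is a state with `L_0 ≠ 0`. -/
theorem exists_mem_G_neg_one : ∃ β ∈ O.G (-1), β ≠ 0 := by
  obtain ⟨m, hm, hm'⟩ : ∃ m : ℤ, 0 < m ∧ (m : ℂ) + O.intercept ≠ 0 := by
    by_cases h : (1 : ℂ) + O.intercept = 0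
    · refine ⟨2, by norm_num, ?_⟩
      have e : ((2 : ℤ) : ℂ) + O.intercept = 1 + (1 + O.intercept) := by push_cast; ring
      rw [e, h]; norm_num
    · exact ⟨1, by norm_num, by simpa using h⟩
  refine ⟨O.b (-m) O.vac, ⟨O.mem_F.2 ⟨?_, ?_⟩, O.mem_nonzeroL0_of_eigen hm' ?_⟩, fun h => ?_⟩
  · rw [apply_of_acomm (O.b_acomm 0 (-m)), O.b_vac 0 le_rfl]; simp
  · rw [(O.ghostNumber_b (by omega : -m ≠ 0)).apply (x := 0)
      (by rw [O.isNumberOp_ghostNumber _ O.annihilated_vac, zero_smul])]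
    simp
  · rw [(O.level_b (-m)).L0.apply O.L0_vac]
    push_cast; rw [neg_neg]
  · have h1 := apply_of_acomm (O.c_b m (-m)) O.vac
    rw [h, O.c_vac m hm, if_pos (by ring)] at h1
    simp only [map_zero, sub_zero, one_smul, Module.End.one_apply] at h1
    exact O.vac_ne_zero h1.symm

/-- The gauge function of `c_0 β` is `M β ≠ 0` and cannot be changed. -/
theorem not_canBeReached_one :
    ¬ O.CanBeReached 1 (fun Φ => O.gaugeFunction 1 Φ = 0) := by
  intro h
  obtain ⟨β, hβ, hβ0⟩ := O.exists_mem_G_neg_one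
  have hΦ : O.c 0 β ∈ O.sector 1 :=
    O.mem_sector.2 ⟨0, Submodule.zero_mem _, β, by simpa using hβ, by rw [zero_add]⟩
  obtain ⟨Λ, hΛ, hC⟩ := h _ hΦ
  rw [O.gaugeFunction_one_add_Q (by simpa using hΛ.1)] at hC
  have h0 := O.extendedGaugeFunction_one_sub 1 0 (map_zero (O.b 0)) (O.b_zero_of_mem_F hβ.1)
  rw [Nat.cast_zero, sub_zero, ← gaugeFunction_eq, zero_add, hC] at h0
  simp only [zero_add, map_zero, smul_zero, add_zero] at h0
  exact hβ0 (O.M_pow_injective 1 (by exact_mod_cast hβ.1) h0.symm)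

/-- The parameter `β` generates the nontrivial transformation with `c_0` component `L_0 β`. -/
theorem not_noResidualSymmetry_one :
    ¬ O.NoResidualSymmetry 1 (fun Φ => O.gaugeFunction 1 Φ = 0) := by
  intro h
  obtain ⟨β, hβ, hβ0⟩ := O.exists_mem_G_neg_one
  have hΛ : β ∈ O.sector (1 - 1) :=
    O.mem_sector.2 ⟨β, by simpa using hβ, 0, Submodule.zero_mem _, by rw [map_zero, add_zero]⟩
  have h0 : O.gaugeFunction 1 (0 : V) = 0 := by simp [gaugeFunction]
  have hQ := h 0 (Submodule.zero_mem _) β hΛ h0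
    ((O.gaugeFunction_one_add_Q (by simpa using hΛ.1)).trans h0)
  have b1 := O.b_zero_of_mem_F hβ.1
  have hQ' := O.Q_apply b1 (map_zero (O.b 0))
  simp only [map_zero, add_zero, sub_zero] at hQ'
  rw [hQ'] at hQ
  -- the `c_0` component of `Q β` is `L_0 β`
  have h1 := congrArg (O.b 0) hQ
  rw [map_add, O.b_zero_of_mem_F (O.Qt_mem_F (m := 0) (by norm_num) hβ.1), zero_add,
    O.b_zero_c_zero (O.b_zero_of_mem_F (O.L0_mem_F hβ.1)), map_zero] at h1
  exact hβ0 (O.L0_injective hβ h1)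

end Oscillators

/-! ### The string Fock space -/

theorem fockOscillators_gaugeFunction (s : ℝ) (p : Momentum) (a : ℝ) :
    (fockOscillators s p).gaugeFunction a = gaugeFunction s p a := rfl

theorem fockOscillators_extendedGaugeFunction (s : ℝ) (p : Momentum) (a : ℝ) (n : ℤ) :
    (fockOscillators s p).extendedGaugeFunction a n = extendedGaugeFunction s p a n := rfl

theorem fockOscillators_canBeReached (s : ℝ) (p : Momentum) (n : ℤ) :
    (fockOscillators s p).CanBeReached n = CanBeReached s p n := rfl

theorem fockOscillators_noResidualSymmetry (s : ℝ) (p : Momentum) (n : ℤ) :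
    (fockOscillators s p).NoResidualSymmetry n = NoResidualSymmetry s p n := rfl

end StringFieldTheory

open StringFieldTheory in
theorem mainTheorem2 (slope : ℝ) (hslope : 0 < slope) (p : Momentum) :
    -- `W_n` is a two-sided inverse of `M^n : F^{-n} → F^n`
    (∀ n : ℕ,
      (∀ f ∈ F (-(n : ℤ)), (M ^ n) f ∈ F n ∧ W n ((M ^ n) f) = f) ∧
      (∀ f ∈ F n, W n f ∈ F (-(n : ℤ)) ∧ (M ^ n) (W n f) = f)) ∧
    -- the conditions in terms of the components of `Φ = φ + c_0 ω`
    (∀ a : ℝ, ∀ φ ∈ F 0, ∀ ω ∈ F (-1),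
      gaugeFunction slope p a (φ + c 0 ω) = 0 ↔
        M ω + (a : ℂ) • Qtilde slope p φ = 0) ∧
    (∀ a : ℝ, ∀ n : ℤ, n ≤ 1 → ∀ φ ∈ F (n - 1), ∀ ω ∈ F (n - 2),
      extendedGaugeFunction slope p a n (φ + c 0 ω) = 0 ↔
        (M ^ (2 - n).toNat) ω + (a : ℂ) • Qtilde slope p ((M ^ (1 - n).toNat) φ) = 0) ∧
    (∀ a : ℝ, ∀ n : ℤ, 2 ≤ n → ∀ φ ∈ F (n - 1), ∀ ω ∈ F (n - 2),
      extendedGaugeFunction slope p a n (φ + c 0 ω) = 0 ↔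
        W (n - 2).toNat ω + (a : ℂ) • Qtilde slope p (W (n - 1).toNat φ) = 0) ∧
    -- for `a ≠ 1` the condition on `Φ_1` fixes the gauge exactly
    (∀ a : ℝ, a ≠ 1 →
      CanBeReached slope p 1 (fun Φ => gaugeFunction slope p a Φ = 0) ∧
      NoResidualSymmetry slope p 1 (fun Φ => gaugeFunction slope p a Φ = 0)) ∧
    -- for `a ≠ 1` the extended conditions fix the gauge exactly for every ghost number
    (∀ a : ℝ, a ≠ 1 → ∀ n : ℤ,
      CanBeReached slope p n (fun Φ => extendedGaugeFunction slope p a n Φ = 0) ∧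
      NoResidualSymmetry slope p n (fun Φ => extendedGaugeFunction slope p a n Φ = 0)) ∧
    -- for `a = 0` the conditions are the Siegel gauge
    (∀ Φ ∈ ghostSector 1, gaugeFunction slope p 0 Φ = 0 ↔ b 0 Φ = 0) ∧
    (∀ n : ℤ, ∀ Φ ∈ ghostSector n, extendedGaugeFunction slope p 0 n Φ = 0 ↔ b 0 Φ = 0) ∧
    -- for `a = 1` the condition is gauge invariant, cannot always be reached, and leaves a
    -- residual gauge symmetry
    (∀ Φ ∈ ghostSector 1, ∀ Λ ∈ ghostSector 0,
      gaugeFunction slope p 1 (Φ + Q slope p Λ) = gaugeFunction slope p 1 Φ) ∧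
    ¬ CanBeReached slope p 1 (fun Φ => gaugeFunction slope p 1 Φ = 0) ∧
    ¬ NoResidualSymmetry slope p 1 (fun Φ => gaugeFunction slope p 1 Φ = 0) := by
  let O := fockOscillators slope p
  have hb : ∀ {n : ℤ} {f : Fock}, f ∈ F n → b 0 f = 0 := fun hf => O.b_zero_of_mem_F hf
  have hfix : ∀ a : ℝ, a ≠ 1 → ∀ n : ℤ,
      CanBeReached slope p n (fun Φ => extendedGaugeFunction slope p a n Φ = 0) ∧
      NoResidualSymmetry slope p n (fun Φ => extendedGaugeFunction slope p a n Φ = 0) := by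
    intro a ha n
    have h := (fockOscillators slope p).gauge_fixed ha n
    rwa [fockOscillators_canBeReached, fockOscillators_noResidualSymmetry,
      fockOscillators_extendedGaugeFunction] at h
  have hone : ∀ a : ℝ, gaugeFunction slope p a = extendedGaugeFunction slope p a 1 := fun a => by
    funext Φ
    rw [← fockOscillators_gaugeFunction, ← fockOscillators_extendedGaugeFunction]
    exact (fockOscillators slope p).gaugeFunction_eq a Φ
  refine ⟨fun n => ⟨fun f hf => ?_, fun f hf => ?_⟩, fun a φ hφ ω hω => ?_,
    fun a n hn φ hφ ω hω => ?_, fun a n hn φ hφ ω hω => ?_, fun a ha => ?_, hfix,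
    fun Φ hΦ => ?_, fun n Φ hΦ => O.extendedGaugeFunction_zero hΦ, fun Φ _ Λ hΛ => ?_, ?_, ?_⟩
  · have hf' : f ∈ O.F (-n) := hf
    have h := O.M_pow_mem_F n (m := n) (by ring) hf'
    exact ⟨h, (O.W_of_b_zero n (O.b_zero_of_mem_F h)).trans (O.invM_M_pow n hf')⟩
  · have hf' : f ∈ O.F n := hf
    have h : O.W n f = O.invM n f := O.W_of_b_zero n (hb hf)
    have h1 : O.W n f ∈ O.F (-n) := by rw [h]; exact O.invM_mem n f
    have h2 : (O.M ^ n) (O.W n f) = f := by rw [h]; exact O.M_pow_invM n hf'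
    exact ⟨h1, h2⟩
  · rw [hone]
    have h := O.extendedGaugeFunction_one_sub a 0 (hb hφ) (hb hω)
    rw [Nat.cast_zero, sub_zero, zero_add, pow_one, pow_zero] at h
    exact Eq.congr_left h
  · exact Eq.congr_left (O.extendedGaugeFunction_of_le a hn (hb hφ) (hb hω))
  · have h1 : O.W (n - 2).toNat ω = O.invM (n - 2).toNat ω := O.W_of_b_zero _ (hb hω)
    have h2 : O.W (n - 1).toNat φ = O.invM (n - 1).toNat φ := O.W_of_b_zero _ (hb hφ)
    have h := O.extendedGaugeFunction_of_ge a hn (hb hφ) (hb hω)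
    rw [← h1, ← h2] at h
    exact Eq.congr_left h
  · rw [hone]
    exact hfix a ha 1
  · rw [hone]
    exact O.extendedGaugeFunction_zero hΦ
  · rw [← fockOscillators_gaugeFunction]
    exact O.gaugeFunction_one_add_Q hΛ
  · rw [← fockOscillators_gaugeFunction, ← fockOscillators_canBeReached]
    exact (fockOscillators slope p).not_canBeReached_one
  · rw [← fockOscillators_gaugeFunction, ← fockOscillators_noResidualSymmetry]
    exact (fockOscillators slope p).not_noResidualSymmetry_one
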